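/- **Proposition 4.6 (Nonasymptotic BvM for log-concave exponential families).** *Setting.* Let $d,n\ge1$ and let $\mu$ be a measure on $\mathbb R^d$ that has a log-concave density with respect to Lebesgue measure and generates a full, regular, minimal exponential family $$p(y\mid\theta)=\exp(\theta^\top y-\psi(\theta)),\qquad \psi(\theta)=\log\int e^{\theta^\top y}\,\mu(dy),\qquad \theta\in\Theta=\Big\{\theta\in\mathbb R^d:\int e^{\theta^\top y}\,\mu(dy)<\infty\Big\},$$ that is, $\Theta$ is open and $\mu$ is not concentrated on an affine hyperplane. Fix $\theta^*\in\Theta$ and let $Y_1,\dots,Y_n$ be i.i.d. with law $p(\cdot\mid\theta^*)\,d\mu$. Put $F(\theta)=\mathrm{Var}_\theta(Y)$, $F^*=F(\theta^*)$, $|u|_{F^*}=(u^\top F^*u)^{1/2}$ and $\|v\|_{F^*}=|(F^*)^{-1/2}v|$ for $u,v\in\mathbb R^d$. Let $\ell(\theta)=-\frac1n\sum_{i=1}^n\log p(Y_i\mid\theta)$, and let $\hat\theta$ be the maximum likelihood estimator, i.e. the minimizer of $\ell$ over $\Theta$. Let $\pi_0\ge0$ be a measurable prior density on $\Theta$, which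 may be improper but is integrable or bounded on $\Theta$ (e.g. a flat prior). Let $\pi$ be the posterior distribution, with density proportional to $e^{-n\ell}\pi_0$ on $\Theta$, and let $\gamma^*=\mathcal N(\hat\theta,(nF^*)^{-1})$. For $s\ge0$ define $$U^*(s)=\{\theta\in\mathbb R^d:|\theta-\theta^*|_{F^*}\le s\sqrt{d/n}\},\qquad M_0^*=\frac1d\log\sup_{\theta\in\Theta}\frac{\pi_0(\theta)}{\pi_0(\theta^*)},$$ $$\delta^*_{01}(s)=\sup_{\theta\in U^*(s)}\|\nabla\log\pi_0(\theta)\|_{F^*},\qquad \delta^*_2(s)=\sup_{\theta\in U^*(s)}\big\|(F^*)^{-1/2}F(\theta)(F^*)^{-1/2}\big\|,$$ $$\delta_3^*(s)=\sup_{\theta\in U^*(s),\,u\ne0}\frac{\mathbb E_\theta\big[(u^\top Y-\mathbb E_\theta[u^\top Y])^3\big]}{\mathrm{Var}_{\theta^*}(u^\top Y)^{3/2}},$$ where $\delta^*_{01}(s)=\infty$ if $\pi_0$ is not $C^1$ or not strictly positive on $U^*(s)$. Call a constant $C_{23}>0$ *admissible* if $\delta_3^*(s)\le C_{23}\,\delta_2^*(s)^{3/2}$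 for all $d,n\ge1$, all $\mu$ and $\theta^*$ as above, and all $s\ge0$ with $U^*(s)\subset\Theta$. *Claim.* An admissible constant exists. Moreover, there is an absolute constant $C>0$ such that the following holds for every admissible $C_{23}$ and all $d,n,\mu,\theta^*,\pi_0$ as above. Suppose that for some $s\ge12$ $$\delta_2^*(2s)\le\tfrac32,\qquad s\sqrt{d/n}\le\frac1{16\,C_{23}},\qquad \delta_{01}^*(2s)\le\frac{\sqrt{nd}}6,\qquad U^*(2s)\subset\Theta .$$ Then there is an event of probability at least $1-\exp(-ds^2/10)$ with respect to the distribution of $(Y_1,\dots,Y_n)$ on which the maximum likelihood estimator $\hat\theta$ exists and is unique, the posterior $\pi$ is a well-defined probability measure, and $$\mathrm{TV}(\pi,\gamma^*)\le C\left(\frac{\delta^*_{01}(2s)}{\sqrt n}+\frac{s\,d}{\sqrt n}+e^{d\left(M_0^*-(s/12)^2\right)}\right).$$ -/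

import Mathlib

open MeasureTheory ProbabilityTheory
open scoped ENNReal Matrix

noncomputable section

namespace BvM

variable {d n : ℕ}

/-! ### Weighted norms -/

/-- The weighted Euclidean norm `|u|_A = |A^{1/2} u| = (uᵀ A u)^{1/2}`. -/
def vecNorm (A : Matrix (Fin d) (Fin d) ℝ) (u : EuclideanSpace ℝ (Fin d)) : ℝ :=
  √(u.ofLp ⬝ᵥ (A *ᵥ u.ofLp))

/-- The `A`-weighted operator norm `‖S‖_A = sup_{|u|_A = 1} ⟨S, u^{⊗k}⟩` of a symmetric `k`-linear
form `S`, which is given here through the function `u ↦ ⟨S, u^{⊗k}⟩`. It is applied only to forms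
for which the supremum is nonnegative (odd `k`, or positive semidefinite `S`). For `k = 1` it is
`|A^{-1/2} S|`, for `k = 2` it is the operator norm of `A^{-1/2} S A^{-1/2}`. -/
def formNorm (A : Matrix (Fin d) (Fin d) ℝ) (S : EuclideanSpace ℝ (Fin d) → ℝ) : ℝ≥0∞ :=
  ⨆ (u : EuclideanSpace ℝ (Fin d)) (_ : vecNorm A u = 1), ENNReal.ofReal (S u)

/-! ### The exponential family generated by a base measure `μ` on `ℝᵈ` -/

/-- The natural parameter domain `{θ : ∫ e^{θᵀy} μ(dy) < ∞}`. -/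
def natDomain (μ : Measure (EuclideanSpace ℝ (Fin d))) : Set (EuclideanSpace ℝ (Fin d)) :=
  {θ | ∫⁻ y, ENNReal.ofReal (Real.exp (inner ℝ θ y)) ∂μ < ∞}

/-- The log-partition function `ψ(θ) = log ∫ e^{θᵀy} μ(dy)`. -/
def logPartition (μ : Measure (EuclideanSpace ℝ (Fin d))) (θ : EuclideanSpace ℝ (Fin d)) : ℝ :=
  Real.log (∫ y, Real.exp (inner ℝ θ y) ∂μ)

/-- The density `p(y ∣ θ) = exp(θᵀy - ψ(θ))` with respect to `μ`. -/
def expDensity (μ : Measure (EuclideanSpace ℝ (Fin d))) (θ y : EuclideanSpace ℝ (Fin d)) : ℝ :=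
  Real.exp (inner ℝ θ y - logPartition μ θ)

/-- The distribution `p(· ∣ θ) dμ` of one observation. -/
def expFamily (μ : Measure (EuclideanSpace ℝ (Fin d))) (θ : EuclideanSpace ℝ (Fin d)) :
    Measure (EuclideanSpace ℝ (Fin d)) :=
  μ.withDensity fun y => ENNReal.ofReal (expDensity μ θ y)

/-- The exponential family with base measure `μ` (over its whole natural domain, i.e. full) is
regular and minimal: the natural domain is open, and `μ` is not concentrated on an affine
hyperplane. -/
structure IsRegularMinimal (μ : Measure (EuclideanSpace ℝ (Fin d))) : Prop where
  isOpen : IsOpen (natDomain μ)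
  minimal : ∀ u : EuclideanSpace ℝ (Fin d), u ≠ 0 → ∀ c : ℝ, μ {y | inner ℝ u y ≠ c} ≠ 0

/-- `μ` has a log-concave density with respect to Lebesgue measure (the density may vanish). -/
def HasLogConcaveDensity (μ : Measure (EuclideanSpace ℝ (Fin d))) : Prop :=
  ∃ h : EuclideanSpace ℝ (Fin d) → ℝ, Measurable h ∧ (∀ y, 0 ≤ h y) ∧
    (∀ x y : EuclideanSpace ℝ (Fin d), ∀ a b : ℝ, 0 < a → 0 < b → a + b = 1 →
      h x ^ a * h y ^ b ≤ h (a • x + b • y)) ∧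
    μ = volume.withDensity fun y => ENNReal.ofReal (h y)

/-- `F(θ) = Var_θ(Y)`, the covariance matrix of one observation. -/
def fisher (μ : Measure (EuclideanSpace ℝ (Fin d))) (θ : EuclideanSpace ℝ (Fin d)) :
    Matrix (Fin d) (Fin d) ℝ :=
  Matrix.of fun i j => cov[fun y => y i, fun y => y j; expFamily μ θ]

/-- The third central moment `E_θ[(uᵀY - E_θ[uᵀY])³]`. -/
def thirdMoment (μ : Measure (EuclideanSpace ℝ (Fin d))) (θ u : EuclideanSpace ℝ (Fin d)) : ℝ :=
  ∫ y, (inner ℝ u y - ∫ z, inner ℝ u z ∂expFamily μ θ) ^ 3 ∂expFamily μ θ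

/-! ### Local quantities around the ground truth `θ₀` with sample size `n` -/

/-- The neighborhood `U*(s) = {θ : |θ - θ₀|_{F*} ≤ s √(d/n)}`, where `F* = F(θ₀)`. -/
def nbhd (n : ℕ) (μ : Measure (EuclideanSpace ℝ (Fin d))) (θ₀ : EuclideanSpace ℝ (Fin d))
    (s : ℝ) : Set (EuclideanSpace ℝ (Fin d)) :=
  {θ | vecNorm (fisher μ θ₀) (θ - θ₀) ≤ s * √((d : ℝ) / n)}

/-- `δ₂*(s) = sup_{θ ∈ U*(s)} ‖F(θ)‖_{F*}`. -/
def delta2 (n : ℕ) (μ : Measure (EuclideanSpace ℝ (Fin d))) (θ₀ : EuclideanSpace ℝ (Fin d))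
    (s : ℝ) : ℝ≥0∞ :=
  ⨆ θ ∈ nbhd n μ θ₀ s, formNorm (fisher μ θ₀) fun u => u.ofLp ⬝ᵥ (fisher μ θ *ᵥ u.ofLp)

/-- `δ₃*(s)`, the supremum over `θ ∈ U*(s)` and `u ≠ 0` of
`E_θ[(uᵀY - E_θ[uᵀY])³] / Var_{θ₀}(uᵀY)^{3/2}`; by homogeneity in `u` the supremum is taken over
`|u|_{F*} = 1`. -/
def delta3 (n : ℕ) (μ : Measure (EuclideanSpace ℝ (Fin d))) (θ₀ : EuclideanSpace ℝ (Fin d))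
    (s : ℝ) : ℝ≥0∞ :=
  ⨆ θ ∈ nbhd n μ θ₀ s, formNorm (fisher μ θ₀) (thirdMoment μ θ)

open Classical in
/-- `δ₀₁*(s) = sup_{θ ∈ U*(s)} ‖∇ log π₀(θ)‖_{F*}`, with value `∞` if the prior density `π₀` is not
`C¹` or not strictly positive on `U*(s)`. -/
def delta01 (n : ℕ) (μ : Measure (EuclideanSpace ℝ (Fin d))) (θ₀ : EuclideanSpace ℝ (Fin d))
    (π₀ : EuclideanSpace ℝ (Fin d) → ℝ) (s : ℝ) : ℝ≥0∞ :=
  if ContDiffOn ℝ 1 π₀ (nbhd n μ θ₀ s) ∧ ∀ θ ∈ nbhd n μ θ₀ s, 0 < π₀ θ then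
    ⨆ θ ∈ nbhd n μ θ₀ s, formNorm (fisher μ θ₀) fun u =>
      inner ℝ (gradientWithin (fun t => Real.log (π₀ t)) (nbhd n μ θ₀ s) θ) u
  else ∞

/-- `M₀* = d⁻¹ log sup_{θ ∈ Θ} π₀(θ)/π₀(θ₀)`, possibly `+∞`. -/
def M0 (μ : Measure (EuclideanSpace ℝ (Fin d))) (θ₀ : EuclideanSpace ℝ (Fin d))
    (π₀ : EuclideanSpace ℝ (Fin d) → ℝ) : EReal :=
  ENNReal.log (⨆ θ ∈ natDomain μ, ENNReal.ofReal (π₀ θ / π₀ θ₀)) / (d : EReal)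

/-- `C` is an admissible value of the constant `C₂₃`: for all log-concave exponential families in
all dimensions, `δ₃*(s) ≤ C · δ₂*(s)^{3/2}` whenever `U*(s) ⊆ Θ`. -/
def IsAdmissibleC23 (C : ℝ) : Prop :=
  ∀ (d n : ℕ), 0 < d → 0 < n → ∀ μ : Measure (EuclideanSpace ℝ (Fin d)),
    IsRegularMinimal μ → HasLogConcaveDensity μ → ∀ θ₀ ∈ natDomain μ, ∀ s : ℝ, 0 ≤ s →
      nbhd n μ θ₀ s ⊆ natDomain μ →
      delta3 n μ θ₀ s ≤ ENNReal.ofReal C * delta2 n μ θ₀ s ^ (3 / 2 : ℝ)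

/-! ### Likelihood, maximum likelihood estimator, posterior, total variation -/

/-- The likelihood `L(θ) = ∏ᵢ p(Yᵢ ∣ θ)`. -/
def likelihood (μ : Measure (EuclideanSpace ℝ (Fin d))) (Y : Fin n → EuclideanSpace ℝ (Fin d))
    (θ : EuclideanSpace ℝ (Fin d)) : ℝ :=
  ∏ i, expDensity μ θ (Y i)

/-- The normalized negative log-likelihood `ℓ(θ) = -(1/n) log L(θ)`. -/
def negLogLik (μ : Measure (EuclideanSpace ℝ (Fin d))) (Y : Fin n → EuclideanSpace ℝ (Fin d))
    (θ : EuclideanSpace ℝ (Fin d)) : ℝ :=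
  -(1 / (n : ℝ)) * Real.log (likelihood μ Y θ)

/-- `θhat` is the unique global minimizer of `ℓ` over `Θ`. -/
def IsUniqueMLE (μ : Measure (EuclideanSpace ℝ (Fin d))) (Y : Fin n → EuclideanSpace ℝ (Fin d))
    (θhat : EuclideanSpace ℝ (Fin d)) : Prop :=
  θhat ∈ natDomain μ ∧ ∀ θ ∈ natDomain μ, θ ≠ θhat → negLogLik μ Y θhat < negLogLik μ Y θ

/-- The measure on `Θ` with density `e^{-nℓ(θ)} π₀(θ)`. -/
def unnormalizedPosterior (μ : Measure (EuclideanSpace ℝ (Fin d)))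
    (π₀ : EuclideanSpace ℝ (Fin d) → ℝ) (Y : Fin n → EuclideanSpace ℝ (Fin d)) :
    Measure (EuclideanSpace ℝ (Fin d)) :=
  (volume.restrict (natDomain μ)).withDensity fun θ =>
    ENNReal.ofReal (Real.exp (-((n : ℝ) * negLogLik μ Y θ)) * π₀ θ)

/-- The posterior distribution. -/
def bayesPosterior (μ : Measure (EuclideanSpace ℝ (Fin d)))
    (π₀ : EuclideanSpace ℝ (Fin d) → ℝ) (Y : Fin n → EuclideanSpace ℝ (Fin d)) :
    Measure (EuclideanSpace ℝ (Fin d)) :=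
  (unnormalizedPosterior μ π₀ Y Set.univ)⁻¹ • unnormalizedPosterior μ π₀ Y

/-- The total variation distance `sup_A |P(A) - Q(A)|` of two probability measures. -/
def tv {α : Type*} [MeasurableSpace α] (P Q : Measure α) : ℝ≥0∞ :=
  ⨆ (A : Set α) (_ : MeasurableSet A), ENNReal.ofReal |P.real A - Q.real A|

end BvM

end

open BvM

/-! Put `T = (nF*)^{-1/2}` and use the coordinate z with θ = θhat + T z. The Gaussian becomes
standard, and the posterior gets a density proportional to e^{-W} q, where W is convex with minimum
W(0) = 0 and q is the prior in the new coordinate. Everything rests on one consequence of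
log-concavity: the third central moment of a linear functional is at most an absolute constant times
its variance to the power 3/2 (`thirdMoment_le`). It follows from the Prékopa–Leindler inequality
through Borell's lemma, and it gives an admissible constant at once.

The third central moment is the third derivative of the log-partition function ψ, and whitening
multiplies the third derivative of nψ by a factor of order 1/√n. Hence the whitened Hessian of nψ at
θ₀ + T v differs from the identity by at most b‖v‖ with b of order 1/√n, on the ball ‖v‖ ≤ 2s√d that
represents U*(2s) (`Whitens.hessianNear`). The assumption on s√(d/n) keeps this error below 2/5.

This estimate is used three times. It makes the score at θ₀ locally sub-Gaussian, so that its norm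
is at most (4/5)s√d with the required probability (`le_measure_norm_score_le`). On that event it
produces a critical point of the likelihood within s√d of θ₀, which by strict convexity is the
unique maximum likelihood estimator (`HessianNear.exists_critical`). Finally it shows that ∇W(z) is
within ε‖z‖ of z on the ball of radius s√d, where ε is of order s√(d/n)
(`HessianNear.nearGaussian`).

The total variation bound splits at a ball. Inside, let g be the ratio of e^{-W} q to the Gaussian;
its logarithm has gradient at most L + ε‖z‖. The L¹ Poincaré inequality of Maurey and Pisier bounds
the double integral of |g(x) - g(y)| by the integral of ‖∇g‖, hence by a multiple of L + ε√d times
the total mass, because the mean of ‖z‖ under the model is O(√d). This is what gives the rate sd/√n.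
Outside, convexity makes W grow at least linearly, and the posterior tail is at most e^{d(M₀* -
(s/12)²)} up to a factor (`NearGaussian.tv_modelMeasure_le`). -/

namespace BvM

/-! ### The Prékopa–Leindler inequality. -/

section PrekopaLeindler

open Set Filter Topology
open scoped Pointwise

lemma ennreal_add_le_of_forall_lt {x y z : ℝ≥0∞} (hx : x ≠ 0) (hy : y ≠ 0)
    (h : ∀ r < x, ∀ q < y, r + q ≤ z) : x + y ≤ z := by
  obtain ⟨u, -, hu, hut⟩ := exists_seq_strictMono_tendsto' (pos_iff_ne_zero.2 hx)
  obtain ⟨v, -, hv, hvt⟩ := exists_seq_strictMono_tendsto' (pos_iff_ne_zero.2 hy)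
  exact le_of_tendsto' (hut.add hvt) fun n => h _ (hu n).2 _ (hv n).2

/-- The translates K + min L and max K + L both lie in C and meet only at the point max K + min L,
so their volumes add up. -/
lemma volume_add_le_of_isCompact {K L C : Set ℝ} (hK : IsCompact K) (hL : IsCompact L)
    (hK0 : K.Nonempty) (hL0 : L.Nonempty) (h : ∀ x ∈ K, ∀ y ∈ L, x + y ∈ C) :
    volume K + volume L ≤ volume C := by
  have hy := hK.sSup_mem hK0
  have hx := hL.sInf_mem hL0
  set y := sSup K
  set x := sInf L
  have hd : AEDisjoint volume ((fun z => z + x) '' K) ((fun z => y + z) '' L) := by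
    refine measure_mono_null (t := {y + x}) ?_ (by simp)
    rintro _ ⟨⟨k, hk, rfl⟩, l, hl, hkl⟩
    have h1 : k ≤ y := le_csSup hK.bddAbove hk
    have h2 : x ≤ l := csInf_le hL.bddBelow hl
    simp only at hkl
    simp only [mem_singleton_iff]
    linarith
  calc volume K + volume L = volume ((fun z => z + x) '' K) + volume ((fun z => y + z) '' L) := by
        simp only [image_add_left, image_add_right, measure_preimage_add, measure_preimage_add_right]
    _ = volume ((fun z => z + x) '' K ∪ (fun z => y + z) '' L) :=
        (measure_union₀ ((hL.image (by fun_prop)).measurableSet.nullMeasurableSet) hd).symm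
    _ ≤ volume C := by
        refine measure_mono (union_subset ?_ ?_)
        · rintro _ ⟨k, hk, rfl⟩; exact h _ hk _ hx
        · rintro _ ⟨l, hl, rfl⟩; exact h _ hy _ hl

/-- The one-dimensional Brunn–Minkowski inequality. -/
lemma volume_add_le {A B C : Set ℝ} (hA : MeasurableSet A) (hB : MeasurableSet B)
    (hA0 : A.Nonempty) (hB0 : B.Nonempty) (h : ∀ x ∈ A, ∀ y ∈ B, x + y ∈ C) :
    volume A + volume B ≤ volume C := by
  obtain ⟨x₀, hx₀⟩ := hA0
  obtain ⟨y₀, hy₀⟩ := hB0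
  by_cases hA1 : volume A = 0
  -- A null set cannot be replaced by a compact subset of positive measure, but a single translate
  -- of the other set already fits into C.
  · rw [hA1, zero_add, ← measure_preimage_add volume (-x₀) B, ← image_add_left]
    refine measure_mono ?_
    rintro _ ⟨l, hl, rfl⟩; exact h _ hx₀ _ hl
  by_cases hB1 : volume B = 0
  · rw [hB1, add_zero, ← measure_preimage_add_right volume (-y₀) A, ← image_add_right]
    refine measure_mono ?_
    rintro _ ⟨l, hl, rfl⟩; exact h _ hl _ hy₀
  refine ennreal_add_le_of_forall_lt hA1 hB1 fun r hr q hq => ?_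
  obtain ⟨K, hKA, hK, hrK⟩ := hA.exists_lt_isCompact hr
  obtain ⟨L, hLB, hL, hqL⟩ := hB.exists_lt_isCompact hq
  refine (add_le_add hrK.le hqL.le).trans (volume_add_le_of_isCompact hK hL
    (nonempty_of_measure_ne_zero (pos_of_gt hrK).ne')
    (nonempty_of_measure_ne_zero (pos_of_gt hqL).ne') fun x hx y hy => h x (hKA hx) y (hLB hy))

lemma ennreal_geom_mean_le_arith_mean {a b : ℝ} (ha : 0 < a) (hb : 0 < b) (hab : a + b = 1)
    (x y : ℝ≥0∞) : x ^ a * y ^ b ≤ ENNReal.ofReal a * x + ENNReal.ofReal b * y := by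
  have hpq : (a⁻¹).HolderConjugate b⁻¹ :=
    Real.holderConjugate_iff.2 ⟨(one_lt_inv₀ ha).2 (by linarith), by simpa using hab⟩
  have := ENNReal.young_inequality (x ^ a) (y ^ b) hpq
  rw [← ENNReal.rpow_mul, ← ENNReal.rpow_mul, mul_inv_cancel₀ ha.ne', mul_inv_cancel₀ hb.ne',
    ENNReal.rpow_one, ENNReal.rpow_one, ENNReal.ofReal_inv_of_pos ha, ENNReal.ofReal_inv_of_pos hb,
    div_eq_mul_inv, div_eq_mul_inv, inv_inv, inv_inv] at this
  simpa [mul_comm] using this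

/-- By the layer cake formula it suffices to compare superlevel sets, where a{f > t} + b{g > t} ⊆ {h
> t} and one-dimensional Brunn–Minkowski applies. Both suprema are normalised to 1, so that the two
superlevel sets are nonempty for the same t; this is why the conclusion has the stronger arithmetic
mean. -/
lemma prekopa_leindler_real_normalized {a b : ℝ} (ha : 0 < a) (hb : 0 < b)
    {f g h : ℝ → ℝ} (hf : Measurable f) (hg : Measurable g) (hh : Measurable h)
    (hf0 : ∀ x, 0 ≤ f x) (hg0 : ∀ x, 0 ≤ g x) (hh0 : ∀ x, 0 ≤ h x)
    (hf1 : ∀ t < 1, ∃ x, t < f x) (hg1 : ∀ t < 1, ∃ x, t < g x)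
    (hf2 : ∀ x, f x ≤ 1) (hg2 : ∀ x, g x ≤ 1)
    (H : ∀ t > 0, ∀ x y, t < f x → t < g y → t < h (a * x + b * y)) :
    ENNReal.ofReal a * (∫⁻ x, ENNReal.ofReal (f x)) +
      ENNReal.ofReal b * (∫⁻ x, ENNReal.ofReal (g x)) ≤
      ∫⁻ x, ENNReal.ofReal (h x) := by
  rw [lintegral_eq_lintegral_meas_lt volume (Eventually.of_forall hf0) hf.aemeasurable,
    lintegral_eq_lintegral_meas_lt volume (Eventually.of_forall hg0) hg.aemeasurable,
    lintegral_eq_lintegral_meas_lt volume (Eventually.of_forall hh0) hh.aemeasurable]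
  have hanti : ∀ k : ℝ → ℝ, Measurable fun t : ℝ => volume {x | t < k x} := fun k =>
    Antitone.measurable fun s t hst => measure_mono fun x (hx : t < k x) => hst.trans_lt hx
  rw [← lintegral_const_mul _ (hanti f), ← lintegral_const_mul _ (hanti g),
    ← lintegral_add_left ((hanti f).const_mul _)]
  refine setLIntegral_mono (hanti h) fun t (ht : 0 < t) => ?_
  by_cases ht1 : t < 1
  · have e1 : ENNReal.ofReal a * volume {x | t < f x} = volume (a • {x | t < f x}) := by
      rw [Measure.addHaar_smul]; simp [abs_of_pos ha]
    have e2 : ENNReal.ofReal b * volume {x | t < g x} = volume (b • {x | t < g x}) := by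
      rw [Measure.addHaar_smul]; simp [abs_of_pos hb]
    rw [e1, e2]
    refine volume_add_le ((measurableSet_lt measurable_const hf).const_smul₀ a)
      ((measurableSet_lt measurable_const hg).const_smul₀ b) (Set.Nonempty.smul_set (hf1 t ht1)) (Set.Nonempty.smul_set (hg1 t ht1))
      ?_
    rintro _ ⟨x, hx, rfl⟩ _ ⟨y, hy, rfl⟩
    exact H t ht x y hx hy
  · have e1 : {x | t < f x} = ∅ := by ext x; simpa using (hf2 x).trans (not_lt.1 ht1)
    have e2 : {x | t < g x} = ∅ := by ext x; simpa using (hg2 x).trans (not_lt.1 ht1)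
    simp [e1, e2]

/-- Dividing f, g and h by S, R and S^a R^b reduces to suprema equal to 1; the weighted
arithmetic-geometric mean inequality then turns the additive bound into the multiplicative one. -/
lemma prekopa_leindler_real {a b : ℝ} (ha : 0 < a) (hb : 0 < b) (hab : a + b = 1)
    {f g h : ℝ → ℝ} (hf : Measurable f) (hg : Measurable g) (hh : Measurable h)
    (hf0 : ∀ x, 0 ≤ f x) (hg0 : ∀ x, 0 ≤ g x) (hh0 : ∀ x, 0 ≤ h x)
    (hfb : BddAbove (range f)) (hgb : BddAbove (range g))
    (H : ∀ x y, f x ^ a * g y ^ b ≤ h (a * x + b * y)) :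
    (∫⁻ x, ENNReal.ofReal (f x)) ^ a * (∫⁻ x, ENNReal.ofReal (g x)) ^ b ≤
      ∫⁻ x, ENNReal.ofReal (h x) := by
  set S := ⨆ x, f x with hS
  set R := ⨆ x, g x with hR
  have hfS : ∀ x, f x ≤ S := fun x => le_ciSup hfb x
  have hgR : ∀ x, g x ≤ R := fun x => le_ciSup hgb x
  rcases (le_trans (hf0 0) (hfS 0)).eq_or_lt with hS0 | hS0
  · have : ∀ x, f x = 0 := fun x => le_antisymm (hS0 ▸ hfS x) (hf0 x)
    simp [this, ha]
  rcases (le_trans (hg0 0) (hgR 0)).eq_or_lt with hR0 | hR0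
  · have : ∀ x, g x = 0 := fun x => le_antisymm (hR0 ▸ hgR x) (hg0 x)
    simp [this, hb]
  set c := S ^ a * R ^ b with hc
  have hc0 : 0 < c := by positivity
  have key := prekopa_leindler_real_normalized ha hb (hf.div_const S) (hg.div_const R)
    (hh.div_const c) (fun x => div_nonneg (hf0 x) hS0.le) (fun x => div_nonneg (hg0 x) hR0.le)
    (fun x => div_nonneg (hh0 x) hc0.le)
    (fun t ht => by
      obtain ⟨x, hx⟩ := exists_lt_of_lt_ciSup (f := f) (show t * S < ⨆ x, f x by
        rw [← hS]; nlinarith)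
      exact ⟨x, by rwa [lt_div_iff₀ hS0]⟩)
    (fun t ht => by
      obtain ⟨x, hx⟩ := exists_lt_of_lt_ciSup (f := g) (show t * R < ⨆ x, g x by
        rw [← hR]; nlinarith)
      exact ⟨x, by rwa [lt_div_iff₀ hR0]⟩)
    (fun x => by rw [div_le_one hS0]; exact hfS x) (fun x => by rw [div_le_one hR0]; exact hgR x)
    (fun t ht x y hx hy => by
      rw [lt_div_iff₀ hS0] at hx
      rw [lt_div_iff₀ hR0] at hy
      rw [lt_div_iff₀ hc0]
      refine lt_of_lt_of_le ?_ (H x y)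
      have h1 : (t * S) ^ a < f x ^ a := Real.rpow_lt_rpow (by positivity) hx ha
      have h2 : (t * R) ^ b < g y ^ b := Real.rpow_lt_rpow (by positivity) hy hb
      calc t * c = (t * S) ^ a * (t * R) ^ b := by
            rw [Real.mul_rpow ht.le hS0.le, Real.mul_rpow ht.le hR0.le, hc]
            have : t ^ a * t ^ b = t := by rw [← Real.rpow_add ht, hab, Real.rpow_one]
            calc t * (S ^ a * R ^ b) = (t ^ a * t ^ b) * (S ^ a * R ^ b) := by rw [this]
              _ = _ := by ring
        _ < f x ^ a * g y ^ b := mul_lt_mul'' h1 h2 (by positivity) (by positivity))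
  have scale : ∀ (k : ℝ → ℝ) (_ : Measurable k) (r : ℝ) (_ : 0 < r),
      ∫⁻ x, ENNReal.ofReal (k x) = ENNReal.ofReal r * ∫⁻ x, ENNReal.ofReal (k x / r) := by
    intro k hk r hr
    rw [← lintegral_const_mul _ (by fun_prop)]
    congr with x
    rw [← ENNReal.ofReal_mul hr.le]
    congr 1
    field_simp
  rw [scale f hf S hS0, scale g hg R hR0, scale h hh c hc0, ENNReal.mul_rpow_of_nonneg _ _ ha.le,
    ENNReal.mul_rpow_of_nonneg _ _ hb.le]
  calc _ = ENNReal.ofReal c * ((∫⁻ x, ENNReal.ofReal (f x / S)) ^ a *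
      (∫⁻ x, ENNReal.ofReal (g x / R)) ^ b) := by
        rw [hc, ENNReal.ofReal_mul (by positivity), ENNReal.ofReal_rpow_of_pos hS0,
          ENNReal.ofReal_rpow_of_pos hR0]
        ring
    _ ≤ _ := by
        gcongr
        exact (ennreal_geom_mean_le_arith_mean ha hb hab _ _).trans key

lemma tendsto_lintegral_min_nat {α : Type*} [MeasurableSpace α] (ν : Measure α) {f : α → ℝ≥0∞}
    (hf : Measurable f) :
    Tendsto (fun k : ℕ => ∫⁻ x, min (f x) k ∂ν) atTop (𝓝 (∫⁻ x, f x ∂ν)) := by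
  refine lintegral_tendsto_of_tendsto_of_monotone (fun k => (by fun_prop))
    (Eventually.of_forall fun x k l hkl => min_le_min le_rfl (by exact_mod_cast hkl))
    (Eventually.of_forall fun x => ?_)
  have : Tendsto (fun k : ℕ => min (f x) (k : ℝ≥0∞)) atTop (𝓝 (min (f x) ⊤)) :=
    tendsto_const_nhds.min ENNReal.tendsto_nat_nhds_top
  simpa using this

/-- The one-dimensional Prékopa–Leindler inequality. -/
lemma prekopa_leindler_one {a b : ℝ} (ha : 0 < a) (hb : 0 < b) (hab : a + b = 1)
    {f g h : ℝ → ℝ≥0∞} (hf : Measurable f) (hg : Measurable g) (hh : Measurable h)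
    (H : ∀ x y, f x ^ a * g y ^ b ≤ h (a * x + b * y)) :
    (∫⁻ x, f x) ^ a * (∫⁻ x, g x) ^ b ≤ ∫⁻ x, h x := by
  by_cases hf0 : ∫⁻ x, f x = 0
  · simp [hf0, ha]
  by_cases hg0 : ∫⁻ x, g x = 0
  · simp [hg0, hb]
  have hlim := ENNReal.Tendsto.mul
    ((tendsto_lintegral_min_nat volume hf).ennrpow_const a)
    (Or.inl (by simp [hf0, ha, ha.not_gt]))
    ((tendsto_lintegral_min_nat volume hg).ennrpow_const b)
    (Or.inl (by simp [hg0, hb, hb.not_gt]))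
  -- Truncating all three functions at the level k keeps the hypothesis, because k^a k^b = k.
  refine le_of_tendsto' hlim fun k => ?_
  have hfin : ∀ z : ℝ≥0∞, min z (k : ℝ≥0∞) ≠ ∞ := fun z =>
    ((min_le_right _ _).trans_lt (ENNReal.natCast_lt_top k)).ne
  have hle : ∀ z : ℝ≥0∞, (min z (k : ℝ≥0∞)).toReal ≤ k := fun z => by
    simpa using ENNReal.toReal_mono (ENNReal.natCast_ne_top k) (min_le_right z (k : ℝ≥0∞))
  have key := prekopa_leindler_real ha hb hab (f := fun x => (min (f x) k).toReal)
    (g := fun x => (min (g x) k).toReal) (h := fun x => (min (h x) k).toReal)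
    (by fun_prop) (by fun_prop) (by fun_prop) (fun _ => ENNReal.toReal_nonneg)
    (fun _ => ENNReal.toReal_nonneg) (fun _ => ENNReal.toReal_nonneg)
    ⟨k, by rintro _ ⟨x, rfl⟩; exact hle _⟩ ⟨k, by rintro _ ⟨x, rfl⟩; exact hle _⟩
    (fun x y => by
      rw [ENNReal.toReal_rpow, ENNReal.toReal_rpow, ← ENNReal.toReal_mul]
      refine ENNReal.toReal_mono (hfin _) (le_min ?_ ?_)
      · refine le_trans ?_ (H x y)
        gcongr <;> exact min_le_left _ _
      · calc min (f x) (k : ℝ≥0∞) ^ a * min (g y) (k : ℝ≥0∞) ^ b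
            ≤ (k : ℝ≥0∞) ^ a * (k : ℝ≥0∞) ^ b := by gcongr <;> exact min_le_right _ _
          _ = k := by
            rw [← ENNReal.rpow_add_of_nonneg _ _ ha.le hb.le, hab, ENNReal.rpow_one])
  simp only [ENNReal.ofReal_toReal (hfin _)] at key
  exact key.trans (lintegral_mono fun x => min_le_left _ _)

lemma lintegral_fin_succ {n : ℕ} {f : (Fin (n + 1) → ℝ) → ℝ≥0∞} (hf : Measurable f) :
    ∫⁻ x, f x = ∫⁻ t : ℝ, ∫⁻ x : Fin n → ℝ, f (Fin.cons t x) := by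
  have hp := (volume_preserving_piFinSuccAbove (fun _ : Fin (n + 1) => ℝ) 0).symm
  rw [← hp.lintegral_comp hf, Measure.volume_eq_prod, lintegral_prod]
  · simp [MeasurableEquiv.piFinSuccAbove, Fin.insertNthEquiv]
  · exact (hf.comp hp.measurable).aemeasurable

lemma measurable_fin_cons {n : ℕ} :
    Measurable fun p : ℝ × (Fin n → ℝ) => (Fin.cons p.1 p.2 : Fin (n + 1) → ℝ) := by
  refine measurable_pi_lambda _ fun i => ?_
  refine Fin.cases ?_ (fun j => ?_) i
  · simpa using measurable_fst
  · simp only [Fin.cons_succ]; fun_prop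

/-- Induction on the dimension: for fixed first coordinates the induction hypothesis shows that the
fibre integrals satisfy the one-dimensional hypothesis. -/
lemma prekopa_leindler_pi {a b : ℝ} (ha : 0 < a) (hb : 0 < b) (hab : a + b = 1) (n : ℕ) :
    ∀ {f g h : (Fin n → ℝ) → ℝ≥0∞}, Measurable f → Measurable g → Measurable h →
    (∀ x y, f x ^ a * g y ^ b ≤ h (a • x + b • y)) →
    (∫⁻ x, f x) ^ a * (∫⁻ x, g x) ^ b ≤ ∫⁻ x, h x := by
  induction n with
  | zero =>
    intro f g h hf hg hh H
    rw [Measure.volume_pi_eq_dirac (0 : Fin 0 → ℝ), lintegral_dirac' _ hf, lintegral_dirac' _ hg,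
      lintegral_dirac' _ hh]
    simpa using H 0 0
  | succ n ih =>
    intro f g h hf hg hh H
    rw [lintegral_fin_succ hf, lintegral_fin_succ hg, lintegral_fin_succ hh]
    have hm : ∀ {k : (Fin (n + 1) → ℝ) → ℝ≥0∞}, Measurable k →
        Measurable fun p : ℝ × (Fin n → ℝ) => k (Fin.cons p.1 p.2) :=
      fun hk => hk.comp measurable_fin_cons
    have hs : ∀ {k : (Fin (n + 1) → ℝ) → ℝ≥0∞}, Measurable k → ∀ t : ℝ,
        Measurable fun x : Fin n → ℝ => k (Fin.cons t x) :=
      fun hk t => (hm hk).comp measurable_prodMk_left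
    refine prekopa_leindler_one ha hb hab (hm hf).lintegral_prod_right'
      (hm hg).lintegral_prod_right' (hm hh).lintegral_prod_right' fun s t => ?_
    refine ih (hs hf s) (hs hg t) (hs hh _) fun x y => ?_
    convert H (Fin.cons s x) (Fin.cons t y) using 2
    ext i
    refine Fin.cases ?_ (fun j => ?_) i <;> simp

/-- The Prékopa–Leindler inequality. -/
theorem prekopa_leindler {d : ℕ} {a b : ℝ} (ha : 0 < a) (hb : 0 < b) (hab : a + b = 1)
    {f g h : EuclideanSpace ℝ (Fin d) → ℝ≥0∞}
    (hf : Measurable f) (hg : Measurable g) (hh : Measurable h)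
    (H : ∀ x y, f x ^ a * g y ^ b ≤ h (a • x + b • y)) :
    (∫⁻ x, f x) ^ a * (∫⁻ x, g x) ^ b ≤ ∫⁻ x, h x := by
  have hp := PiLp.volume_preserving_toLp (Fin d)
  rw [← hp.lintegral_comp hf, ← hp.lintegral_comp hg, ← hp.lintegral_comp hh]
  refine prekopa_leindler_pi ha hb hab d (hf.comp hp.measurable) (hg.comp hp.measurable)
    (hh.comp hp.measurable) fun x y => ?_
  simpa using H (WithLp.toLp 2 x) (WithLp.toLp 2 y)

end PrekopaLeindler

/-! ### Differentiation under the integral in exponential families. -/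

section ExponentialFamily

set_option linter.unusedSectionVars false

open Set Filter Topology

variable {d : ℕ} {F : Type*} [NormedAddCommGroup F] [NormedSpace ℝ F]

/-- Continuous functions that are bounded by a polynomial in the norm. -/
def PolyGrowth (g : EuclideanSpace ℝ (Fin d) → F) : Prop :=
  Continuous g ∧ ∃ (C : ℝ) (k : ℕ), ∀ y, ‖g y‖ ≤ C * (1 + ‖y‖) ^ k

lemma PolyGrowth.exists_nonneg {g : EuclideanSpace ℝ (Fin d) → F} (hg : PolyGrowth g) :
    ∃ (C : ℝ) (k : ℕ), 0 ≤ C ∧ ∀ y, ‖g y‖ ≤ C * (1 + ‖y‖) ^ k := by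
  obtain ⟨-, C, k, h⟩ := hg
  refine ⟨C, k, ?_, h⟩
  simpa using (norm_nonneg _).trans (h 0)

lemma polyGrowth_const (c : F) : PolyGrowth fun _ : EuclideanSpace ℝ (Fin d) => c :=
  ⟨continuous_const, ‖c‖, 0, fun y => by simp⟩

lemma polyGrowth_clm (L : EuclideanSpace ℝ (Fin d) →L[ℝ] F) : PolyGrowth fun y => L y :=
  ⟨L.continuous, ‖L‖, 1, fun y => (L.le_opNorm y).trans (by gcongr; simp)⟩

lemma polyGrowth_id : PolyGrowth fun y : EuclideanSpace ℝ (Fin d) => y :=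
  polyGrowth_clm (ContinuousLinearMap.id ℝ _)

lemma polyGrowth_inner (u : EuclideanSpace ℝ (Fin d)) :
    PolyGrowth fun y : EuclideanSpace ℝ (Fin d) => inner ℝ u y :=
  polyGrowth_clm (innerSL ℝ u)

lemma PolyGrowth.add {g h : EuclideanSpace ℝ (Fin d) → F} (hg : PolyGrowth g) (hh : PolyGrowth h) :
    PolyGrowth fun y => g y + h y := by
  obtain ⟨C, k, hC, h1⟩ := hg.exists_nonneg
  obtain ⟨D, l, hD, h2⟩ := hh.exists_nonneg
  refine ⟨hg.1.add hh.1, C + D, k + l, fun y => (norm_add_le _ _).trans ?_⟩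
  have e : 1 ≤ 1 + ‖y‖ := by simp
  rw [add_mul]
  refine add_le_add ((h1 y).trans ?_) ((h2 y).trans ?_)
  · gcongr
    omega
  · gcongr
    omega

lemma PolyGrowth.bilin {G H : Type*} [NormedAddCommGroup G] [NormedSpace ℝ G]
    [NormedAddCommGroup H] [NormedSpace ℝ H] (B : F →L[ℝ] G →L[ℝ] H)
    {g : EuclideanSpace ℝ (Fin d) → F} {h : EuclideanSpace ℝ (Fin d) → G}
    (hg : PolyGrowth g) (hh : PolyGrowth h) : PolyGrowth fun y => B (g y) (h y) := by
  obtain ⟨C, k, hC, h1⟩ := hg.exists_nonneg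
  obtain ⟨D, l, hD, h2⟩ := hh.exists_nonneg
  refine ⟨(B.continuous.comp hg.1).clm_apply hh.1, ‖B‖ * C * D, k + l, fun y => ?_⟩
  calc ‖B (g y) (h y)‖ ≤ ‖B‖ * ‖g y‖ * ‖h y‖ := B.le_opNorm₂ _ _
    _ ≤ ‖B‖ * (C * (1 + ‖y‖) ^ k) * (D * (1 + ‖y‖) ^ l) := by
      gcongr
      · exact h1 y
      · exact h2 y
    _ = _ := by ring

lemma PolyGrowth.mul {g h : EuclideanSpace ℝ (Fin d) → ℝ} (hg : PolyGrowth g) (hh : PolyGrowth h) :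
    PolyGrowth fun y => g y * h y :=
  PolyGrowth.bilin (ContinuousLinearMap.mul ℝ ℝ) hg hh

lemma PolyGrowth.sub_const {g : EuclideanSpace ℝ (Fin d) → ℝ} (hg : PolyGrowth g) (c : ℝ) :
    PolyGrowth fun y => g y - c := by
  simpa [sub_eq_add_neg] using hg.add (polyGrowth_const (-c))

lemma polyGrowth_inner_sub (u c : EuclideanSpace ℝ (Fin d)) :
    PolyGrowth fun y : EuclideanSpace ℝ (Fin d) => (inner ℝ u (y - c) : ℝ) := by
  simpa [inner_sub_right] using (polyGrowth_inner u).sub_const (inner ℝ u c)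

variable {μ : Measure (EuclideanSpace ℝ (Fin d))} {θ : EuclideanSpace ℝ (Fin d)}

lemma integrable_exp_of_mem (hθ : θ ∈ natDomain μ) :
    Integrable (fun y => Real.exp (inner ℝ θ y)) μ := by
  refine ⟨by fun_prop, ?_⟩
  rw [hasFiniteIntegral_iff_ofReal (Eventually.of_forall fun y => (Real.exp_pos _).le)]
  exact hθ

/-- Since ‖y‖ ≤ d max |y_j|, the function e^{r‖y‖} is dominated by a sum of exponentials of ±d r
y_i. These only shift θ to the 2d points θ ± d r e_i, and r is chosen to keep them in a ball inside
the open natural domain. -/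
lemma exists_integrable_exp_add_norm (ho : IsOpen (natDomain μ)) (hθ : θ ∈ natDomain μ) :
    ∃ r > 0, Integrable (fun y => Real.exp (inner ℝ θ y + r * ‖y‖)) μ := by
  obtain ⟨ρ, hρ, hball⟩ := Metric.isOpen_iff.1 ho θ hθ
  set r := ρ / (2 * (d + 1)) with hr
  have hr0 : 0 < r := by positivity
  have hmem : ∀ i : Fin d, ∀ c : ℝ, |c| = d * r →
      θ + c • EuclideanSpace.single i (1 : ℝ) ∈ natDomain μ := by
    intro i c hc
    apply hball
    rw [Metric.mem_ball, dist_eq_norm]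
    simp only [add_sub_cancel_left, norm_smul, Real.norm_eq_abs, hc, PiLp.norm_single,
      abs_one, mul_one]
    rw [hr]
    have : (d : ℝ) * (ρ / (2 * (d + 1))) = ρ * (d / (2 * (d + 1))) := by ring
    rw [this]
    have h2 : (d : ℝ) / (2 * (d + 1)) < 1 := by
      rw [div_lt_one (by positivity)]; linarith [Nat.cast_nonneg (α := ℝ) d]
    nlinarith
  have key : ∀ y : EuclideanSpace ℝ (Fin d), Real.exp (inner ℝ θ y + r * ‖y‖) ≤
      Real.exp (inner ℝ θ y) + ∑ i : Fin d,
        (Real.exp (inner ℝ (θ + (d * r) • EuclideanSpace.single i (1 : ℝ)) y) +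
        Real.exp (inner ℝ (θ + (-(d * r)) • EuclideanSpace.single i (1 : ℝ)) y)) := by
    intro y
    have hin : ∀ (i : Fin d) (c : ℝ), inner ℝ (θ + c • EuclideanSpace.single i (1 : ℝ)) y =
        inner ℝ θ y + c * y i := by
      intro i c
      simp [inner_add_left, inner_smul_left, EuclideanSpace.inner_single_left]
    simp only [hin]
    rcases isEmpty_or_nonempty (Fin d) with he | hne
    · have : y = 0 := Subsingleton.elim _ _
      simp [this]
    obtain ⟨j, hj⟩ := Finite.exists_max fun i => |y i|
    have hn : ‖y‖ ≤ d * |y j| := by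
      have h1 : ‖y‖ ≤ ∑ i, |y i| := by
        have hy : y = ∑ i, y i • EuclideanSpace.single i (1 : ℝ) := by
          ext k; simp [Finset.sum_apply, Pi.single_apply]
        calc ‖y‖ = ‖∑ i, y i • EuclideanSpace.single i (1 : ℝ)‖ := by rw [← hy]
          _ ≤ ∑ i, ‖y i • EuclideanSpace.single i (1 : ℝ)‖ := norm_sum_le _ _
          _ = _ := by simp [norm_smul]
      exact h1.trans ((Finset.sum_le_sum fun i _ => hj i).trans (by simp))
    have hnn : ∀ i, 0 ≤ Real.exp (inner ℝ θ y + (d * r) * y i) +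
        Real.exp (inner ℝ θ y + (-(d * r)) * y i) := fun i => by positivity
    have h2 := Finset.single_le_sum (f := fun i => Real.exp (inner ℝ θ y + (d * r) * y i) +
        Real.exp (inner ℝ θ y + (-(d * r)) * y i)) (fun i _ => hnn i) (Finset.mem_univ j)
    refine le_trans ?_ (le_add_of_nonneg_of_le (Real.exp_pos _).le h2)
    have h3 : Real.exp (inner ℝ θ y + r * ‖y‖) ≤ Real.exp (inner ℝ θ y + r * (d * |y j|)) := by
      gcongr
    refine h3.trans ?_
    rcases abs_cases (y j) with ⟨h, -⟩ | ⟨h, -⟩ <;> rw [h]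
    · have := (Real.exp_pos (inner ℝ θ y + (-(d * r)) * y j)).le
      have e : r * (d * y j) = d * r * y j := by ring
      simp only [e]; linarith
    · have := (Real.exp_pos (inner ℝ θ y + ((d * r)) * y j)).le
      have e : r * (d * -y j) = -(d * r) * y j := by ring
      simp only [e]; linarith
  have hi : Integrable (fun y : EuclideanSpace ℝ (Fin d) => Real.exp (inner ℝ θ y) + ∑ i : Fin d,
      (Real.exp (inner ℝ (θ + (d * r) • EuclideanSpace.single i (1 : ℝ)) y) +
        Real.exp (inner ℝ (θ + (-(d * r)) • EuclideanSpace.single i (1 : ℝ)) y))) μ := by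
    refine (integrable_exp_of_mem hθ).add (integrable_finsetSum _ fun i _ =>
      (integrable_exp_of_mem (hmem i (d * r) ?_)).add
        (integrable_exp_of_mem (hmem i (-(d * r)) ?_)))
    · exact abs_of_nonneg (by positivity)
    · rw [abs_neg]; exact abs_of_nonneg (by positivity)
  refine ⟨r, hr0, hi.mono' (by fun_prop) (Eventually.of_forall fun y => ?_)⟩
  rw [Real.norm_of_nonneg (Real.exp_pos _).le]
  exact key y

lemma exists_one_add_pow_le_exp {r : ℝ} (hr : 0 < r) (k : ℕ) :
    ∃ C, 0 ≤ C ∧ ∀ t : ℝ, 0 ≤ t → (1 + t) ^ k ≤ C * Real.exp (r * t) := by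
  refine ⟨k.factorial / r ^ k * Real.exp r, by positivity, fun t ht => ?_⟩
  have := Real.pow_div_factorial_le_exp (r * (1 + t)) (by positivity) k
  rw [div_le_iff₀ (by positivity), mul_pow] at this
  have e : Real.exp (r * (1 + t)) = Real.exp r * Real.exp (r * t) := by
    rw [← Real.exp_add]; ring_nf
  rw [e] at this
  rw [div_mul_eq_mul_div, div_mul_eq_mul_div, le_div_iff₀ (by positivity)]
  nlinarith

/-- The unnormalised expectation `∫ e^{θᵀy} g(y) μ(dy)`. -/
noncomputable def tiltIntegral (μ : Measure (EuclideanSpace ℝ (Fin d)))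
    (g : EuclideanSpace ℝ (Fin d) → F) (θ : EuclideanSpace ℝ (Fin d)) : F :=
  ∫ y, Real.exp (inner ℝ θ y) • g y ∂μ

/-- The integrand of the derivative of `tiltIntegral μ g`. -/
noncomputable def tiltDeriv (g : EuclideanSpace ℝ (Fin d) → F) (y : EuclideanSpace ℝ (Fin d)) :
    EuclideanSpace ℝ (Fin d) →L[ℝ] F :=
  (innerSL ℝ y).smulRight (g y)

/-- The class of integrands is closed under differentiation in θ, so one domination argument serves
every order of derivative. -/
lemma PolyGrowth.tiltDeriv {g : EuclideanSpace ℝ (Fin d) → F} (hg : PolyGrowth g) :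
    PolyGrowth (tiltDeriv g) :=
  PolyGrowth.bilin (ContinuousLinearMap.smulRightL ℝ (EuclideanSpace ℝ (Fin d)) F)
    (polyGrowth_clm (innerSL ℝ)) hg

/-- Half of the exponential margin r absorbs the displacement of η from θ and the other half absorbs
the polynomial growth of g. -/
lemma exists_tilt_bound (ho : IsOpen (natDomain μ)) (hθ : θ ∈ natDomain μ)
    {g : EuclideanSpace ℝ (Fin d) → F} (hg : PolyGrowth g) :
    ∃ r > 0, ∃ b : EuclideanSpace ℝ (Fin d) → ℝ, Integrable b μ ∧
      ∀ η ∈ Metric.ball θ r, ∀ y, ‖Real.exp (inner ℝ η y) • g y‖ ≤ b y := by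
  obtain ⟨r, hr, hint⟩ := exists_integrable_exp_add_norm ho hθ
  obtain ⟨C, k, hC, hCk⟩ := hg.exists_nonneg
  obtain ⟨D, hD, hDk⟩ := exists_one_add_pow_le_exp (half_pos hr) k
  refine ⟨r / 2, half_pos hr, fun y => C * D * Real.exp (inner ℝ θ y + r * ‖y‖),
    hint.const_mul _, fun η hη y => ?_⟩
  rw [norm_smul, Real.norm_of_nonneg (Real.exp_pos _).le]
  have h1 : inner ℝ η y ≤ inner ℝ θ y + r / 2 * ‖y‖ := by
    have : inner ℝ η y = inner ℝ θ y + inner ℝ (η - θ) y := by rw [inner_sub_left]; ring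
    rw [this]
    have h2 : inner ℝ (η - θ) y ≤ ‖η - θ‖ * ‖y‖ := real_inner_le_norm _ _
    have h3 : ‖η - θ‖ ≤ r / 2 := by rw [← dist_eq_norm]; exact (Metric.mem_ball.1 hη).le
    nlinarith [norm_nonneg y]
  calc Real.exp (inner ℝ η y) * ‖g y‖
      ≤ Real.exp (inner ℝ θ y + r / 2 * ‖y‖) * (C * (D * Real.exp (r / 2 * ‖y‖))) := by
        gcongr
        exact (hCk y).trans (by gcongr; exact hDk _ (norm_nonneg y))
    _ = C * D * (Real.exp (inner ℝ θ y + r / 2 * ‖y‖) * Real.exp (r / 2 * ‖y‖)) := by ring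
    _ = _ := by rw [← Real.exp_add]; ring_nf

lemma integrable_tilt (ho : IsOpen (natDomain μ)) (hθ : θ ∈ natDomain μ)
    {g : EuclideanSpace ℝ (Fin d) → F} (hg : PolyGrowth g) :
    Integrable (fun y => Real.exp (inner ℝ θ y) • g y) μ := by
  obtain ⟨r, hr, b, hb, h⟩ := exists_tilt_bound ho hθ hg
  have := hg.1
  exact hb.mono' (by fun_prop) (Eventually.of_forall fun y => h θ (Metric.mem_ball_self hr) y)

lemma hasFDerivAt_tiltIntegral (ho : IsOpen (natDomain μ)) (hθ : θ ∈ natDomain μ)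
    {g : EuclideanSpace ℝ (Fin d) → F} (hg : PolyGrowth g) :
    HasFDerivAt (tiltIntegral μ g) (tiltIntegral μ (tiltDeriv g) θ) θ := by
  obtain ⟨r, hr, b, hb, h⟩ := exists_tilt_bound ho hθ hg.tiltDeriv
  have hc := hg.1
  have hc' := hg.tiltDeriv.1
  have hsc : SecondCountableTopologyEither (EuclideanSpace ℝ (Fin d))
      (EuclideanSpace ℝ (Fin d) →L[ℝ] F) := secondCountableTopologyEither_of_left _ _
  refine hasFDerivAt_integral_of_dominated_of_fderiv_le (bound := b)
    (F' := fun η y => Real.exp (inner ℝ η y) • tiltDeriv g y)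
    (Metric.ball_mem_nhds θ hr) ?_ (integrable_tilt ho hθ hg) ?_ ?_ hb ?_
  · exact Eventually.of_forall fun η => by fun_prop
  · exact Continuous.aestronglyMeasurable (by fun_prop)
  · exact Eventually.of_forall fun y η hη => h η hη y
  · refine Eventually.of_forall fun y η _ => ?_
    have h1 : HasFDerivAt (fun η : EuclideanSpace ℝ (Fin d) => (inner ℝ η y : ℝ)) (innerSL ℝ y) η := by
      have := (innerSL ℝ y).hasFDerivAt (x := η)
      refine this.congr_of_eventuallyEq (Eventually.of_forall fun z => ?_)
      simp [real_inner_comm]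
    convert! h1.exp.smul_const (g y) using 1
    ext v
    simp [tiltDeriv, smul_smul]

/-- Positive dimension matters here: in dimension 0 there is no nonzero direction, and minimality
says nothing. -/
lemma measure_ne_zero (hμ : IsRegularMinimal μ) (hd : 0 < d) : μ ≠ 0 := by
  have : NeZero d := ⟨hd.ne'⟩
  have := hμ.minimal (EuclideanSpace.single 0 (1 : ℝ)) (by simp) 0
  rintro rfl
  simp at this

lemma tiltIntegral_one_eq : tiltIntegral μ (fun _ => (1 : ℝ)) θ = ∫ y, Real.exp (inner ℝ θ y) ∂μ := by
  simp [tiltIntegral]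

lemma tiltIntegral_one_pos (h0 : μ ≠ 0) (hθ : θ ∈ natDomain μ) :
    0 < tiltIntegral μ (fun _ => (1 : ℝ)) θ := by
  rw [tiltIntegral_one_eq]
  have : NeZero μ := ⟨h0⟩
  exact integral_exp_pos (integrable_exp_of_mem hθ)

lemma expDensity_eq (h0 : μ ≠ 0) (hθ : θ ∈ natDomain μ) (y : EuclideanSpace ℝ (Fin d)) :
    expDensity μ θ y = (tiltIntegral μ (fun _ => (1 : ℝ)) θ)⁻¹ * Real.exp (inner ℝ θ y) := by
  rw [expDensity, logPartition, Real.exp_sub, ← tiltIntegral_one_eq,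
    Real.exp_log (tiltIntegral_one_pos h0 hθ), div_eq_inv_mul]

lemma measurable_expDensity : Measurable (expDensity μ θ) := by
  unfold expDensity; fun_prop

lemma isProbabilityMeasure_expFamily (h0 : μ ≠ 0) (hθ : θ ∈ natDomain μ) :
    IsProbabilityMeasure (expFamily μ θ) := by
  constructor
  have hp := tiltIntegral_one_pos h0 hθ
  rw [expFamily, withDensity_apply _ MeasurableSet.univ, Measure.restrict_univ]
  simp_rw [expDensity_eq h0 hθ]
  rw [← ofReal_integral_eq_lintegral_ofReal ((integrable_exp_of_mem hθ).const_mul _)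
    (Eventually.of_forall fun y => by positivity), integral_const_mul, ← tiltIntegral_one_eq,
    inv_mul_cancel₀ hp.ne', ENNReal.ofReal_one]

lemma integral_expFamily (h0 : μ ≠ 0) (hθ : θ ∈ natDomain μ) (g : EuclideanSpace ℝ (Fin d) → F) :
    ∫ y, g y ∂expFamily μ θ =
      (tiltIntegral μ (fun _ => (1 : ℝ)) θ)⁻¹ • tiltIntegral μ g θ := by
  rw [expFamily, integral_withDensity_eq_integral_toReal_smul
    (measurable_expDensity.ennreal_ofReal) (Eventually.of_forall fun y => ENNReal.ofReal_lt_top)]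
  rw [tiltIntegral, tiltIntegral, ← integral_smul]
  refine integral_congr_ae (Eventually.of_forall fun y => ?_)
  simp only
  rw [ENNReal.toReal_ofReal (show 0 ≤ expDensity μ θ y from (Real.exp_pos _).le),
    expDensity_eq h0 hθ, smul_smul]
  rfl

lemma integrable_expFamily (hμ : IsRegularMinimal μ) (h0 : μ ≠ 0) (hθ : θ ∈ natDomain μ)
    {g : EuclideanSpace ℝ (Fin d) → F} (hg : PolyGrowth g) : Integrable g (expFamily μ θ) := by
  rw [expFamily, integrable_withDensity_iff_integrable_smul'
    (measurable_expDensity.ennreal_ofReal) (Eventually.of_forall fun y => ENNReal.ofReal_lt_top)]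
  refine ((integrable_tilt hμ.isOpen hθ hg).smul
    (tiltIntegral μ (fun _ => (1 : ℝ)) θ)⁻¹).congr (Eventually.of_forall fun y => ?_)
  simp only [Pi.smul_apply]
  rw [ENNReal.toReal_ofReal (show 0 ≤ expDensity μ θ y from (Real.exp_pos _).le),
    expDensity_eq h0 hθ, smul_smul]

/-- The mean `E_θ Y`. -/
noncomputable def mean (μ : Measure (EuclideanSpace ℝ (Fin d))) (θ : EuclideanSpace ℝ (Fin d)) :
    EuclideanSpace ℝ (Fin d) :=
  ∫ y, y ∂expFamily μ θ

lemma tiltDeriv_tiltIntegral_apply (ho : IsOpen (natDomain μ)) (hθ : θ ∈ natDomain μ)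
    {g : EuclideanSpace ℝ (Fin d) → F} (hg : PolyGrowth g) (v : EuclideanSpace ℝ (Fin d)) :
    tiltIntegral μ (tiltDeriv g) θ v = tiltIntegral μ (fun y => (inner ℝ v y : ℝ) • g y) θ := by
  rw [tiltIntegral, ContinuousLinearMap.integral_apply (integrable_tilt ho hθ hg.tiltDeriv)]
  simp [tiltIntegral, tiltDeriv, real_inner_comm]

lemma differentiableAt_integral_expFamily (hμ : IsRegularMinimal μ) (h0 : μ ≠ 0)
    (hθ : θ ∈ natDomain μ) {g : EuclideanSpace ℝ (Fin d) → F} (hg : PolyGrowth g) :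
    DifferentiableAt ℝ (fun η => ∫ y, g y ∂expFamily μ η) θ := by
  have h1 := (hasFDerivAt_tiltIntegral hμ.isOpen hθ (polyGrowth_const (1 : ℝ))).differentiableAt
  have h2 := (hasFDerivAt_tiltIntegral hμ.isOpen hθ hg).differentiableAt
  refine ((h1.inv (tiltIntegral_one_pos h0 hθ).ne').smul h2).congr_of_eventuallyEq ?_
  filter_upwards [hμ.isOpen.mem_nhds hθ] with η hη
  exact integral_expFamily h0 hη g

lemma integral_inner_expFamily (hμ : IsRegularMinimal μ) (h0 : μ ≠ 0) (hθ : θ ∈ natDomain μ)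
    (v : EuclideanSpace ℝ (Fin d)) :
    ∫ y, (inner ℝ v y : ℝ) ∂expFamily μ θ = inner ℝ v (mean μ θ) :=
  (innerSL ℝ v).integral_comp_comm (integrable_expFamily hμ h0 hθ polyGrowth_id)

lemma hasFDerivAt_logPartition (hμ : IsRegularMinimal μ) (h0 : μ ≠ 0) (hθ : θ ∈ natDomain μ) :
    HasFDerivAt (logPartition μ) (innerSL ℝ (mean μ θ)) θ := by
  have h1 := (hasFDerivAt_tiltIntegral hμ.isOpen hθ (polyGrowth_const (1 : ℝ))).log
    (tiltIntegral_one_pos h0 hθ).ne'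
  have h2 : logPartition μ = fun η => Real.log (tiltIntegral μ (fun _ => (1 : ℝ)) η) := by
    ext η; rw [logPartition, tiltIntegral_one_eq]
  rw [h2]
  convert! h1 using 1
  ext v
  rw [_root_.smul_apply,
    tiltDeriv_tiltIntegral_apply hμ.isOpen hθ (polyGrowth_const (1 : ℝ)), innerSL_apply_apply,
    real_inner_comm, ← integral_inner_expFamily hμ h0 hθ, integral_expFamily h0 hθ]
  simp

/-- Differentiating an expectation in the natural parameter gives a covariance with the sufficient
statistic. With g linear and g quadratic this identifies the derivative of the mean with the
covariance and the derivative of the variance with the third central moment. -/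
lemma hasDerivAt_integral_expFamily (hμ : IsRegularMinimal μ) (h0 : μ ≠ 0)
    (hθ : θ ∈ natDomain μ) {g : EuclideanSpace ℝ (Fin d) → ℝ} (hg : PolyGrowth g)
    (v : EuclideanSpace ℝ (Fin d)) :
    fderiv ℝ (fun η => ∫ y, g y ∂expFamily μ η) θ v =
      ∫ y, g y * inner ℝ v (y - mean μ θ) ∂expFamily μ θ := by
  have hp := (tiltIntegral_one_pos h0 hθ).ne'
  have h1 := hasFDerivAt_tiltIntegral hμ.isOpen hθ (polyGrowth_const (d := d) (1 : ℝ))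
  have h2 := hasFDerivAt_tiltIntegral hμ.isOpen hθ hg
  have h3 : HasFDerivAt (fun η => ∫ y, g y ∂expFamily μ η) _ θ :=
    ((hasFDerivAt_inv hp).comp θ h1 |>.smul h2).congr_of_eventuallyEq (by
      filter_upwards [hμ.isOpen.mem_nhds hθ] with η hη
      exact integral_expFamily h0 hη g)
  rw [h3.fderiv]
  have h4 : ∫ y, g y * inner ℝ v (y - mean μ θ) ∂expFamily μ θ =
      ∫ y, (inner ℝ v y : ℝ) • g y ∂expFamily μ θ -
        (∫ y, g y ∂expFamily μ θ) * ∫ y, (inner ℝ v y : ℝ) ∂expFamily μ θ := by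
    rw [integral_inner_expFamily hμ h0 hθ, ← integral_mul_const, ← integral_sub]
    · congr with y
      rw [inner_sub_right, smul_eq_mul]; ring
    · exact integrable_expFamily hμ h0 hθ ((polyGrowth_inner v).mul hg)
    · exact (integrable_expFamily hμ h0 hθ hg).mul_const _
  rw [h4, integral_expFamily h0 hθ, integral_expFamily h0 hθ, integral_expFamily h0 hθ]
  simp only [Function.comp_apply, _root_.add_apply, _root_.smul_apply,
    ContinuousLinearMap.smulRight_apply, ContinuousLinearMap.comp_apply,
    tiltDeriv_tiltIntegral_apply hμ.isOpen hθ hg,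
    tiltDeriv_tiltIntegral_apply hμ.isOpen hθ (polyGrowth_const (1 : ℝ))]
  simp
  field_simp
  ring

end ExponentialFamily

/-! ### Covariance and third central moment as derivatives in θ. -/

section Moments

open Set Filter Topology

variable {d : ℕ} {μ : Measure (EuclideanSpace ℝ (Fin d))} {θ : EuclideanSpace ℝ (Fin d)}

/-- The covariance `Cov_θ(uᵀY, vᵀY)`. -/
noncomputable def covForm (μ : Measure (EuclideanSpace ℝ (Fin d)))
    (θ u v : EuclideanSpace ℝ (Fin d)) : ℝ :=
  ∫ y, inner ℝ u (y - mean μ θ) * inner ℝ v (y - mean μ θ) ∂expFamily μ θ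

/-- The mixed third central moment. -/
noncomputable def cubicForm (μ : Measure (EuclideanSpace ℝ (Fin d)))
    (θ u v w : EuclideanSpace ℝ (Fin d)) : ℝ :=
  ∫ y, inner ℝ u (y - mean μ θ) * inner ℝ v (y - mean μ θ) * inner ℝ w (y - mean μ θ)
    ∂expFamily μ θ

lemma mean_apply (hμ : IsRegularMinimal μ) (h0 : μ ≠ 0) (hθ : θ ∈ natDomain μ) (i : Fin d) :
    mean μ θ i = ∫ y, y i ∂expFamily μ θ := by
  have := integral_inner_expFamily hμ h0 hθ (EuclideanSpace.single i (1 : ℝ))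
  simpa [EuclideanSpace.inner_single_left] using this.symm

lemma polyGrowth_inner_sub_mul (u v c : EuclideanSpace ℝ (Fin d)) :
    PolyGrowth fun y : EuclideanSpace ℝ (Fin d) => (inner ℝ u (y - c) * inner ℝ v (y - c) : ℝ) :=
  (polyGrowth_inner_sub u c).mul (polyGrowth_inner_sub v c)

lemma dotProduct_fisher (hμ : IsRegularMinimal μ) (h0 : μ ≠ 0) (hθ : θ ∈ natDomain μ)
    (u v : EuclideanSpace ℝ (Fin d)) :
    u.ofLp ⬝ᵥ (fisher μ θ *ᵥ v.ofLp) = covForm μ θ u v := by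
  have hg : ∀ i j : Fin d, Integrable (fun y : EuclideanSpace ℝ (Fin d) =>
      (y i - mean μ θ i) * (y j - mean μ θ j)) (expFamily μ θ) := by
    intro i j
    have := integrable_expFamily hμ h0 hθ (polyGrowth_inner_sub_mul
      (EuclideanSpace.single i (1 : ℝ)) (EuclideanSpace.single j (1 : ℝ)) (mean μ θ))
    simpa [EuclideanSpace.inner_single_left] using this
  have h1 : covForm μ θ u v = ∫ y, ∑ i, ∑ j, u i * v j *
      ((y i - mean μ θ i) * (y j - mean μ θ j)) ∂expFamily μ θ := by
    rw [covForm]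
    congr with y
    simp only [PiLp.inner_apply, Finset.sum_mul_sum, PiLp.sub_apply, RCLike.inner_apply,
      conj_trivial]
    exact Finset.sum_congr rfl fun i _ => Finset.sum_congr rfl fun j _ => by ring
  rw [h1, integral_finsetSum _ fun i _ => integrable_finsetSum _ fun j _ => (hg i j).const_mul _]
  simp only [dotProduct, Matrix.mulVec, Finset.mul_sum]
  refine Finset.sum_congr rfl fun i _ => ?_
  rw [integral_finsetSum _ fun j _ => (hg i j).const_mul _]
  refine Finset.sum_congr rfl fun j _ => ?_
  rw [integral_const_mul, fisher, Matrix.of_apply, covariance, mean_apply hμ h0 hθ,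
    mean_apply hμ h0 hθ]
  ring

lemma covForm_comm (u v : EuclideanSpace ℝ (Fin d)) : covForm μ θ u v = covForm μ θ v u := by
  simp only [covForm, mul_comm]

lemma covForm_add_left (hμ : IsRegularMinimal μ) (h0 : μ ≠ 0) (hθ : θ ∈ natDomain μ)
    (u v w : EuclideanSpace ℝ (Fin d)) :
    covForm μ θ (u + v) w = covForm μ θ u w + covForm μ θ v w := by
  rw [covForm, covForm, covForm, ← integral_add
    (integrable_expFamily hμ h0 hθ (polyGrowth_inner_sub_mul u w _))
    (integrable_expFamily hμ h0 hθ (polyGrowth_inner_sub_mul v w _))]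
  congr with y
  rw [inner_add_left]; ring

lemma covForm_smul_left (c : ℝ) (u v : EuclideanSpace ℝ (Fin d)) :
    covForm μ θ (c • u) v = c * covForm μ θ u v := by
  simp only [covForm, inner_smul_left, mul_assoc, integral_const_mul, conj_trivial]

lemma covForm_self_nonneg (u : EuclideanSpace ℝ (Fin d)) : 0 ≤ covForm μ θ u u :=
  integral_nonneg fun _ => mul_self_nonneg _

/-- Zero variance would make uᵀY constant almost surely; as the density is positive, μ itself would
sit on a hyperplane, against minimality. -/
lemma covForm_self_pos (hμ : IsRegularMinimal μ) (h0 : μ ≠ 0) (hθ : θ ∈ natDomain μ)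
    {u : EuclideanSpace ℝ (Fin d)} (hu : u ≠ 0) : 0 < covForm μ θ u u := by
  refine (covForm_self_nonneg u).lt_of_ne' fun h => ?_
  rw [covForm, integral_eq_zero_iff_of_nonneg (fun y => mul_self_nonneg _)
    (integrable_expFamily hμ h0 hθ (polyGrowth_inner_sub_mul u u _))] at h
  apply hμ.minimal u hu (inner ℝ u (mean μ θ))
  have h1 : ∀ᵐ y ∂expFamily μ θ, inner ℝ u y = (inner ℝ u (mean μ θ) : ℝ) := by
    filter_upwards [h] with y hy
    have := mul_self_eq_zero.1 hy
    rw [inner_sub_right] at this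
    linarith
  rw [expFamily, ae_withDensity_iff measurable_expDensity.ennreal_ofReal] at h1
  rw [← ae_iff]
  filter_upwards [h1] with y hy
  exact hy (by simpa [expDensity] using Real.exp_pos _)

lemma thirdMoment_eq (hμ : IsRegularMinimal μ) (h0 : μ ≠ 0) (hθ : θ ∈ natDomain μ)
    (u : EuclideanSpace ℝ (Fin d)) : thirdMoment μ θ u = cubicForm μ θ u u u := by
  rw [thirdMoment, cubicForm, integral_inner_expFamily hμ h0 hθ]
  congr with y
  rw [inner_sub_right]; ring

lemma polyGrowth_cubic (u v w c : EuclideanSpace ℝ (Fin d)) :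
    PolyGrowth fun y : EuclideanSpace ℝ (Fin d) =>
      (inner ℝ u (y - c) * inner ℝ v (y - c) * inner ℝ w (y - c) : ℝ) :=
  (polyGrowth_inner_sub_mul u v c).mul (polyGrowth_inner_sub w c)

lemma thirdMoment_smul (hμ : IsRegularMinimal μ) (h0 : μ ≠ 0) (hθ : θ ∈ natDomain μ) (c : ℝ)
    (u : EuclideanSpace ℝ (Fin d)) : thirdMoment μ θ (c • u) = c ^ 3 * thirdMoment μ θ u := by
  rw [thirdMoment_eq hμ h0 hθ, thirdMoment_eq hμ h0 hθ, cubicForm, cubicForm, ← integral_const_mul]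
  congr with y
  simp only [inner_smul_left, conj_trivial]
  ring

/-- This recovers the mixed form, which appears as a derivative of the variance, from the pure third
moments that are the only quantities controlled by `delta3`. -/
lemma cubicForm_polarization (hμ : IsRegularMinimal μ) (h0 : μ ≠ 0) (hθ : θ ∈ natDomain μ)
    (u v : EuclideanSpace ℝ (Fin d)) :
    6 * cubicForm μ θ u u v =
      thirdMoment μ θ (u + v) - thirdMoment μ θ (u - v) - 2 * thirdMoment μ θ v := by
  simp only [thirdMoment_eq hμ h0 hθ, cubicForm]
  rw [← integral_const_mul, ← integral_const_mul, ← integral_sub, ← integral_sub]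
  · congr with y
    simp only [inner_add_left, inner_sub_left]
    ring
  · exact (integrable_expFamily hμ h0 hθ (polyGrowth_cubic _ _ _ _)).sub
      (integrable_expFamily hμ h0 hθ (polyGrowth_cubic _ _ _ _))
  · exact (integrable_expFamily hμ h0 hθ (polyGrowth_cubic _ _ _ _)).const_mul _
  · exact integrable_expFamily hμ h0 hθ (polyGrowth_cubic _ _ _ _)
  · exact integrable_expFamily hμ h0 hθ (polyGrowth_cubic _ _ _ _)

lemma integral_inner_sub_mean (hμ : IsRegularMinimal μ) (h0 : μ ≠ 0) (hθ : θ ∈ natDomain μ)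
    (v : EuclideanSpace ℝ (Fin d)) : ∫ y, inner ℝ v (y - mean μ θ) ∂expFamily μ θ = 0 := by
  have := isProbabilityMeasure_expFamily h0 hθ
  simp_rw [inner_sub_right]
  rw [integral_sub (integrable_expFamily hμ h0 hθ (polyGrowth_inner v)) (integrable_const _),
    integral_inner_expFamily hμ h0 hθ]
  simp

lemma hasDerivAt_line {G : EuclideanSpace ℝ (Fin d) → ℝ} {θ v : EuclideanSpace ℝ (Fin d)} {t : ℝ}
    (hG : DifferentiableAt ℝ G (θ + t • v)) :
    HasDerivAt (fun t : ℝ => G (θ + t • v)) (fderiv ℝ G (θ + t • v) v) t := by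
  have h1 : HasDerivAt (fun t : ℝ => θ + t • v) v t := by
    simpa using ((hasDerivAt_id t).smul_const v).const_add θ
  exact hG.hasFDerivAt.comp_hasDerivAt t h1

lemma hasDerivAt_inner_mean (hμ : IsRegularMinimal μ) (h0 : μ ≠ 0) {v : EuclideanSpace ℝ (Fin d)}
    {t : ℝ} (hθ : θ + t • v ∈ natDomain μ) (u : EuclideanSpace ℝ (Fin d)) :
    HasDerivAt (fun t : ℝ => (inner ℝ u (mean μ (θ + t • v)) : ℝ))
      (covForm μ (θ + t • v) u v) t := by
  have hg := polyGrowth_inner u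
  have h1 := hasDerivAt_line (differentiableAt_integral_expFamily hμ h0 hθ hg)
  rw [hasDerivAt_integral_expFamily hμ h0 hθ hg] at h1
  have h2 : covForm μ (θ + t • v) u v =
      ∫ y, inner ℝ u y * inner ℝ v (y - mean μ (θ + t • v)) ∂expFamily μ (θ + t • v) := by
    have h3 : ∀ y, inner ℝ u y * inner ℝ v (y - mean μ (θ + t • v)) =
        inner ℝ u (y - mean μ (θ + t • v)) * inner ℝ v (y - mean μ (θ + t • v)) +
        inner ℝ u (mean μ (θ + t • v)) * inner ℝ v (y - mean μ (θ + t • v)) := by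
      intro y
      rw [inner_sub_right u]; ring
    simp_rw [h3]
    rw [integral_add (integrable_expFamily hμ h0 hθ (polyGrowth_inner_sub_mul _ _ _))
      ((integrable_expFamily hμ h0 hθ (polyGrowth_inner_sub _ _)).const_mul _), integral_const_mul,
      integral_inner_sub_mean hμ h0 hθ, covForm]
    ring
  rw [h2]
  refine h1.congr_of_eventuallyEq ?_
  have hc : ContinuousAt (fun t : ℝ => θ + t • v) t := by fun_prop
  filter_upwards [hc.preimage_mem_nhds (hμ.isOpen.mem_nhds hθ)] with s hs
  exact (integral_inner_expFamily hμ h0 hs u).symm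

lemma hasDerivAt_covForm (hμ : IsRegularMinimal μ) (h0 : μ ≠ 0) {v : EuclideanSpace ℝ (Fin d)}
    {t : ℝ} (hθ : θ + t • v ∈ natDomain μ) (u : EuclideanSpace ℝ (Fin d)) :
    HasDerivAt (fun t : ℝ => covForm μ (θ + t • v) u u) (cubicForm μ (θ + t • v) u u v) t := by
  have hg := (polyGrowth_inner u).mul (polyGrowth_inner u)
  have h1 := hasDerivAt_line (differentiableAt_integral_expFamily hμ h0 hθ hg)
  rw [hasDerivAt_integral_expFamily hμ h0 hθ hg] at h1
  have h2 := hasDerivAt_inner_mean hμ h0 hθ u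
  have h3 := h1.sub (h2.mul h2)
  -- Written as second moment minus squared mean, the variance is differentiated term by term;
  -- centring the integrand again afterwards produces the third central moment.
  have hm : ∀ η ∈ natDomain μ, covForm μ η u u =
      (∫ y, inner ℝ u y * inner ℝ u y ∂expFamily μ η) -
        inner ℝ u (mean μ η) * inner ℝ u (mean μ η) := by
    intro η hη
    have := isProbabilityMeasure_expFamily h0 hη
    have e : ∀ y, inner ℝ u (y - mean μ η) * inner ℝ u (y - mean μ η) =
        inner ℝ u y * inner ℝ u y - (2 * inner ℝ u (mean μ η)) * inner ℝ u (y - mean μ η)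
          - inner ℝ u (mean μ η) * inner ℝ u (mean μ η) := by
      intro y; rw [inner_sub_right]; ring
    rw [covForm]
    simp_rw [e]
    have i1 := integrable_expFamily hμ h0 hη hg
    have i2 := (integrable_expFamily hμ h0 hη (polyGrowth_inner_sub u (mean μ η))).const_mul
      (2 * inner ℝ u (mean μ η))
    rw [integral_sub (by exact i1.sub i2) (integrable_const _), integral_sub i1 i2,
      integral_const_mul, integral_inner_sub_mean hμ h0 hη]
    simp
  have h4 : cubicForm μ (θ + t • v) u u v =
      (∫ y, inner ℝ u y * inner ℝ u y * inner ℝ v (y - mean μ (θ + t • v))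
        ∂expFamily μ (θ + t • v)) -
      (covForm μ (θ + t • v) u v * inner ℝ u (mean μ (θ + t • v)) +
        inner ℝ u (mean μ (θ + t • v)) * covForm μ (θ + t • v) u v) := by
    set m := mean μ (θ + t • v)
    have e : ∀ y, inner ℝ u y * inner ℝ u y * inner ℝ v (y - m) =
        inner ℝ u (y - m) * inner ℝ u (y - m) * inner ℝ v (y - m)
        + (2 * inner ℝ u m) * (inner ℝ u (y - m) * inner ℝ v (y - m))
        + (inner ℝ u m * inner ℝ u m) * inner ℝ v (y - m) := by
      intro y; rw [inner_sub_right u]; ring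
    simp_rw [e]
    have i1 := integrable_expFamily hμ h0 hθ (polyGrowth_cubic u u v m)
    have i2 := (integrable_expFamily hμ h0 hθ (polyGrowth_inner_sub_mul u v m)).const_mul
      (2 * inner ℝ u m)
    have i3 := (integrable_expFamily hμ h0 hθ (polyGrowth_inner_sub v m)).const_mul
      (inner ℝ u m * inner ℝ u m)
    rw [integral_add (by exact i1.add i2) i3, integral_add i1 i2, integral_const_mul, integral_const_mul,
      integral_inner_sub_mean hμ h0 hθ, cubicForm, covForm]
    ring
  rw [h4]
  refine h3.congr_of_eventuallyEq ?_
  have hc : ContinuousAt (fun t : ℝ => θ + t • v) t := by fun_prop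
  filter_upwards [hc.preimage_mem_nhds (hμ.isOpen.mem_nhds hθ)] with s hs
  exact hm _ hs

end Moments

/-! ### Borell's lemma and the reverse Hölder inequality for third moments. -/

section ReverseHolder

open Set Filter Topology

variable {d : ℕ} {μ : Measure (EuclideanSpace ℝ (Fin d))} {θ : EuclideanSpace ℝ (Fin d)}

/-- An exponential tilt multiplies the density by the exponential of an affine function, for which
the log-concavity inequality is an equality. -/
lemma exists_logconcave_density (hlc : HasLogConcaveDensity μ) :
    ∃ k : EuclideanSpace ℝ (Fin d) → ℝ≥0∞, Measurable k ∧
      (∀ x y : EuclideanSpace ℝ (Fin d), ∀ a b : ℝ, 0 < a → 0 < b → a + b = 1 →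
        k x ^ a * k y ^ b ≤ k (a • x + b • y)) ∧ expFamily μ θ = volume.withDensity k := by
  obtain ⟨h, hm, hn, hl, rfl⟩ := hlc
  set ν := volume.withDensity fun y => ENNReal.ofReal (h y)
  refine ⟨fun y => ENNReal.ofReal (h y) * ENNReal.ofReal (expDensity ν θ y),
    hm.ennreal_ofReal.mul measurable_expDensity.ennreal_ofReal, fun x y a b ha hb hab => ?_, ?_⟩
  · have hp : ∀ z, 0 ≤ expDensity ν θ z := fun z => (Real.exp_pos _).le
    simp only
    rw [← ENNReal.ofReal_mul (hn _), ← ENNReal.ofReal_mul (hn _), ← ENNReal.ofReal_mul (hn _),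
      ENNReal.ofReal_rpow_of_nonneg (mul_nonneg (hn _) (hp _)) ha.le,
      ENNReal.ofReal_rpow_of_nonneg (mul_nonneg (hn _) (hp _)) hb.le,
      ← ENNReal.ofReal_mul (Real.rpow_nonneg (mul_nonneg (hn _) (hp _)) _)]
    refine ENNReal.ofReal_le_ofReal ?_
    rw [Real.mul_rpow (hn _) (hp _), Real.mul_rpow (hn _) (hp _)]
    have e : expDensity ν θ x ^ a * expDensity ν θ y ^ b = expDensity ν θ (a • x + b • y) := by
      simp only [expDensity]
      rw [← Real.exp_mul, ← Real.exp_mul, ← Real.exp_add, inner_add_right, inner_smul_right,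
        inner_smul_right]
      congr 1
      linear_combination (-logPartition ν θ) * hab
    rw [← e]
    calc _ = (h x ^ a * h y ^ b) * (expDensity ν θ x ^ a * expDensity ν θ y ^ b) := by ring
      _ ≤ _ := mul_le_mul_of_nonneg_right (hl x y a b ha hb hab)
        (mul_nonneg (Real.rpow_nonneg (hp _) _) (Real.rpow_nonneg (hp _) _))
  · rw [expFamily]
    exact (withDensity_mul _ hm.ennreal_ofReal measurable_expDensity.ennreal_ofReal).symm

/-- Borell's lemma for linear functionals. -/
lemma borell_linear {k : EuclideanSpace ℝ (Fin d) → ℝ≥0∞} (hk : Measurable k)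
    (hlc : ∀ x y : EuclideanSpace ℝ (Fin d), ∀ a b : ℝ, 0 < a → 0 < b → a + b = 1 →
      k x ^ a * k y ^ b ≤ k (a • x + b • y)) (u m : EuclideanSpace ℝ (Fin d)) {t r : ℝ}
    (hr : 1 < r) :
    volume.withDensity k {y | r * t < |inner ℝ u (y - m)|} ^ (2 / (r + 1)) *
      volume.withDensity k {y | |inner ℝ u (y - m)| ≤ t} ^ ((r - 1) / (r + 1)) ≤
      volume.withDensity k {y | t < |inner ℝ u (y - m)|} := by
  have m1 : MeasurableSet {y : EuclideanSpace ℝ (Fin d) | r * t < |inner ℝ u (y - m)|} :=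
    measurableSet_lt (by fun_prop) (by fun_prop)
  have m2 : MeasurableSet {y : EuclideanSpace ℝ (Fin d) | |inner ℝ u (y - m)| ≤ t} :=
    measurableSet_le (by fun_prop) (by fun_prop)
  have m3 : MeasurableSet {y : EuclideanSpace ℝ (Fin d) | t < |inner ℝ u (y - m)|} :=
    measurableSet_lt (by fun_prop) (by fun_prop)
  rw [withDensity_apply _ m1, withDensity_apply _ m2, withDensity_apply _ m3,
    ← lintegral_indicator m1, ← lintegral_indicator m2, ← lintegral_indicator m3]
  have hr1 : 0 < r + 1 := by linarith
  have ha : 0 < 2 / (r + 1) := by positivity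
  have hb : 0 < (r - 1) / (r + 1) := div_pos (by linarith) hr1
  have hab : 2 / (r + 1) + (r - 1) / (r + 1) = 1 := by field_simp; ring
  -- With weights a = 2/(r+1) and b = (r-1)/(r+1), a point outside the strip of width rt averaged
  -- with a point of the strip of width t stays outside the latter, because a r t - b t = t.
  refine prekopa_leindler ha hb hab (hk.indicator m1) (hk.indicator m2) (hk.indicator m3)
    fun x y => ?_
  by_cases hx : x ∈ {y : EuclideanSpace ℝ (Fin d) | r * t < |inner ℝ u (y - m)|}
  swap
  · simp [indicator_of_notMem hx, ha]
  by_cases hy : y ∈ {y : EuclideanSpace ℝ (Fin d) | |inner ℝ u (y - m)| ≤ t}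
  swap
  · simp [indicator_of_notMem hy, hb]
  rw [indicator_of_mem hx, indicator_of_mem hy, indicator_of_mem]
  · exact hlc x y _ _ ha hb hab
  · set a := 2 / (r + 1)
    set b := (r - 1) / (r + 1)
    have e : inner ℝ u (a • x + b • y - m) = a * inner ℝ u (x - m) + b * inner ℝ u (y - m) := by
      simp only [inner_sub_right, inner_add_right, inner_smul_right]
      linear_combination (inner ℝ u m) * hab
    have hx' : r * t < |inner ℝ u (x - m)| := hx
    have hy' : |inner ℝ u (y - m)| ≤ t := hy
    show t < |inner ℝ u (a • x + b • y - m)|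
    rw [e]
    have h1 : |a * inner ℝ u (x - m)| - |b * inner ℝ u (y - m)| ≤
        |a * inner ℝ u (x - m) + b * inner ℝ u (y - m)| := by
      have := abs_sub_abs_le_abs_sub (a * inner ℝ u (x - m)) (-(b * inner ℝ u (y - m)))
      rwa [abs_neg, sub_neg_eq_add] at this
    rw [abs_mul, abs_mul, abs_of_pos ha, abs_of_pos hb] at h1
    have h2 : a * (r * t) - b * t = t := by simp only [a, b]; field_simp; ring
    nlinarith [mul_lt_mul_of_pos_left hx' ha, mul_le_mul_of_nonneg_left hy' hb.le]

/-- Borell's lemma with dilation k gives p² (3/4)^(k-1) ≤ (1/4)^(k+1), that is p² ≤ 3^{-(k-1)}/16.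
The ratio 3/5 is a rational upper bound for 1/√3. -/
lemma measureReal_le_pow_of_borell (hlc : HasLogConcaveDensity μ)
    [IsProbabilityMeasure (expFamily μ θ)] (u m : EuclideanSpace ℝ (Fin d)) {t : ℝ}
    (h : (expFamily μ θ).real {y | t < |inner ℝ u (y - m)|} ≤ 1 / 4) (k : ℕ) :
    (expFamily μ θ).real {y | k * t < |inner ℝ u (y - m)|} ≤ (3 / 5) ^ k := by
  rcases Nat.lt_or_ge k 2 with hk | hk
  · interval_cases k
    · simp [measureReal_le_one]
    · simp only [Nat.cast_one, one_mul, pow_one]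
      linarith
  obtain ⟨κ, hκ, hl, he⟩ := exists_logconcave_density (θ := θ) hlc
  have hk1 : (1 : ℝ) < k := by exact_mod_cast hk
  have key := borell_linear hκ hl u m (t := t) hk1
  rw [← he] at key
  set P := expFamily μ θ
  have m3 : MeasurableSet {y : EuclideanSpace ℝ (Fin d) | t < |inner ℝ u (y - m)|} :=
    measurableSet_lt (by fun_prop) (by fun_prop)
  have h34 : 3 / 4 ≤ P.real {y | |inner ℝ u (y - m)| ≤ t} := by
    have e : {y : EuclideanSpace ℝ (Fin d) | |inner ℝ u (y - m)| ≤ t} =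
        {y | t < |inner ℝ u (y - m)|}ᶜ := by ext y; simp
    rw [e, probReal_compl_eq_one_sub m3]
    linarith
  have key2 := ENNReal.toReal_mono (measure_ne_top _ _) key
  rw [ENNReal.toReal_mul, ← ENNReal.toReal_rpow, ← ENNReal.toReal_rpow] at key2
  change P.real _ ^ _ * P.real _ ^ _ ≤ P.real _ at key2
  set p := P.real {y | k * t < |inner ℝ u (y - m)|}
  set q := P.real {y | |inner ℝ u (y - m)| ≤ t}
  have hp0 : 0 ≤ p := measureReal_nonneg
  have hq0 : 0 ≤ q := measureReal_nonneg
  have key3 := pow_le_pow_left₀ (by positivity) (key2.trans h) (k + 1)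
  have e1 : (p ^ (2 / ((k : ℝ) + 1))) ^ (k + 1) = p ^ 2 := by
    rw [← Real.rpow_natCast, ← Real.rpow_mul hp0, ← Real.rpow_natCast]
    congr 1
    push_cast
    field_simp
  have e2 : (q ^ (((k : ℝ) - 1) / ((k : ℝ) + 1))) ^ (k + 1) = q ^ (k - 1) := by
    rw [← Real.rpow_natCast, ← Real.rpow_mul hq0, ← Real.rpow_natCast]
    congr 1
    rw [Nat.cast_sub (by omega)]
    push_cast
    field_simp
  rw [mul_pow, e1, e2] at key3
  have h5 : p ^ 2 * (3 / 4) ^ (k - 1) ≤ (1 / 4) ^ (k + 1) :=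
    (mul_le_mul_of_nonneg_left (pow_le_pow_left₀ (by norm_num) h34 _) (by positivity)).trans key3
  obtain ⟨l, rfl⟩ : ∃ l, k = l + 1 := ⟨k - 1, by omega⟩
  rw [Nat.add_sub_cancel] at h5
  refine (pow_le_pow_iff_left₀ hp0 (by positivity) two_ne_zero).1 ?_
  have h6 : p ^ 2 ≤ 1 / 16 * (1 / 3) ^ l := by
    have : (1 / 4 : ℝ) ^ (l + 1 + 1) = (1 / 16 * (1 / 3) ^ l) * (3 / 4) ^ l := by
      rw [mul_assoc, ← mul_pow, pow_succ, pow_succ]; norm_num; ring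
    rw [this] at h5
    exact le_of_mul_le_mul_right h5 (by positivity)
  calc p ^ 2 ≤ 1 / 16 * (1 / 3) ^ l := h6
    _ ≤ (9 / 25) * (9 / 25) ^ l :=
      mul_le_mul (by norm_num) (pow_le_pow_left₀ (by norm_num) (by norm_num) l) (by positivity)
        (by norm_num)
    _ = ((3 / 5) ^ (l + 1)) ^ 2 := by
      rw [← pow_mul, mul_comm (l + 1) 2, pow_mul, pow_succ]; norm_num; ring

/-- A discrete layer cake: 3k² + 3k + 1 = (k+1)³ - k³, so the sum telescopes to (t⌈x/t⌉)³. -/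
lemma ofReal_cube_le_tsum {x t : ℝ} (hx : 0 ≤ x) (ht : 0 < t) :
    ENNReal.ofReal (x ^ 3) ≤ ∑' k : ℕ, ENNReal.ofReal (t ^ 3 * (3 * k ^ 2 + 3 * k + 1)) *
      (if k * t < x then 1 else 0) := by
  set N := ⌈x / t⌉₊
  have h1 : x ≤ N * t := by rw [← div_le_iff₀ ht]; exact Nat.le_ceil _
  have h2 : ∀ k ∈ Finset.range N, (k : ℝ) * t < x := by
    intro k hk
    rw [← lt_div_iff₀ ht]
    exact Nat.lt_ceil.1 (Finset.mem_range.1 hk)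
  have h3 : ∀ M : ℕ, ∑ k ∈ Finset.range M, (t ^ 3 * (3 * (k : ℝ) ^ 2 + 3 * k + 1)) =
      t ^ 3 * M ^ 3 := by
    intro M
    induction M with
    | zero => simp
    | succ M ih => rw [Finset.sum_range_succ, ih]; push_cast; ring
  refine le_trans ?_ (ENNReal.sum_le_tsum (Finset.range N))
  rw [Finset.sum_congr rfl fun k hk => by rw [if_pos (h2 k hk), mul_one],
    ← ENNReal.ofReal_sum_of_nonneg fun k _ => by positivity, h3]
  refine ENNReal.ofReal_le_ofReal ((pow_le_pow_left₀ hx h1 3).trans_eq (by ring))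

lemma summable_reverseHolder :
    Summable fun k : ℕ => (3 * (k : ℝ) ^ 2 + 3 * k + 1) * (3 / 5) ^ k := by
  have h : ∀ j : ℕ, Summable fun k : ℕ => (k : ℝ) ^ j * (3 / 5 : ℝ) ^ k := fun j =>
    summable_pow_mul_geometric_of_norm_lt_one j (by norm_num [abs_lt])
  refine ((((h 2).mul_left 3).add ((h 1).mul_left 3)).add (h 0)).congr fun k => ?_
  simp; ring

/-- The reverse Hölder constant for third moments of linear functionals. -/
noncomputable def reverseHolderConst : ℝ :=
  8 * ∑' k : ℕ, (3 * (k : ℝ) ^ 2 + 3 * k + 1) * (3 / 5) ^ k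

lemma reverseHolderConst_pos : 0 < reverseHolderConst := by
  refine mul_pos (by norm_num) (summable_reverseHolder.tsum_pos (fun k => by positivity) 0 ?_)
  norm_num

/-- Chebyshev's inequality at t = 2√v, two standard deviations, starts the geometric decay of the
tail, and summing over the layers kt gives a multiple of t³ = 8 v^{3/2}. -/
lemma thirdMoment_le (hμ : IsRegularMinimal μ) (hlc : HasLogConcaveDensity μ) (h0 : μ ≠ 0)
    (hθ : θ ∈ natDomain μ) {u : EuclideanSpace ℝ (Fin d)} (hu : u ≠ 0) :
    thirdMoment μ θ u ≤ reverseHolderConst * covForm μ θ u u ^ (3 / 2 : ℝ) := by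
  have hP := isProbabilityMeasure_expFamily h0 hθ
  set P := expFamily μ θ with hPdef
  set m := mean μ θ
  set v := covForm μ θ u u with hv
  have hv0 : 0 < v := covForm_self_pos hμ h0 hθ hu
  set t := 2 * √v with htd
  have ht : 0 < t := by positivity
  have ht2 : t ^ 2 = 4 * v := by rw [htd, mul_pow, Real.sq_sqrt hv0.le]; norm_num
  have hcheb : P.real {y | t < |inner ℝ u (y - m)|} ≤ 1 / 4 := by
    have h1 := mul_meas_ge_le_integral_of_nonneg (μ := P)
      (Eventually.of_forall fun y : EuclideanSpace ℝ (Fin d) => mul_self_nonneg (inner ℝ u (y - m)))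
      (integrable_expFamily hμ h0 hθ (polyGrowth_inner_sub_mul u u m)) (t ^ 2)
    have h2 : P.real {y | t < |inner ℝ u (y - m)|} ≤
        P.real {y | t ^ 2 ≤ inner ℝ u (y - m) * inner ℝ u (y - m)} := by
      refine measureReal_mono fun y (hy : t < |inner ℝ u (y - m)|) => ?_
      show t ^ 2 ≤ inner ℝ u (y - m) * inner ℝ u (y - m)
      rw [← abs_mul_abs_self, ← sq]
      exact pow_le_pow_left₀ ht.le hy.le 2
    change t ^ 2 * P.real {y | t ^ 2 ≤ inner ℝ u (y - m) * inner ℝ u (y - m)} ≤ v at h1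
    rw [ht2] at h1 h2
    nlinarith
  have hb := measureReal_le_pow_of_borell hlc u m hcheb
  have hint := integrable_expFamily hμ h0 hθ (polyGrowth_cubic u u u m)
  have hms : ∀ k : ℕ, MeasurableSet {y : EuclideanSpace ℝ (Fin d) | k * t < |inner ℝ u (y - m)|} :=
    fun k => measurableSet_lt (by fun_prop) (by fun_prop)
  have hlin : ∫⁻ y, ENNReal.ofReal (|inner ℝ u (y - m)| ^ 3) ∂P ≤
      ENNReal.ofReal (reverseHolderConst * v ^ (3 / 2 : ℝ)) := by
    calc ∫⁻ y, ENNReal.ofReal (|inner ℝ u (y - m)| ^ 3) ∂P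
        ≤ ∫⁻ y, ∑' k : ℕ, ENNReal.ofReal (t ^ 3 * (3 * k ^ 2 + 3 * k + 1)) *
          {y : EuclideanSpace ℝ (Fin d) | k * t < |inner ℝ u (y - m)|}.indicator 1 y ∂P := by
          refine lintegral_mono fun y => (ofReal_cube_le_tsum (abs_nonneg _) ht).trans_eq ?_
          rfl
      _ = ∑' k : ℕ, ENNReal.ofReal (t ^ 3 * (3 * k ^ 2 + 3 * k + 1)) *
          P {y : EuclideanSpace ℝ (Fin d) | k * t < |inner ℝ u (y - m)|} := by
          rw [lintegral_tsum fun k => ((measurable_one.indicator (hms k)).const_mul _).aemeasurable]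
          refine tsum_congr fun k => ?_
          rw [lintegral_const_mul _ (measurable_one.indicator (hms k)),
            lintegral_indicator_one (hms k)]
      _ ≤ ∑' k : ℕ, ENNReal.ofReal (t ^ 3 * ((3 * k ^ 2 + 3 * k + 1) * (3 / 5) ^ k)) := by
          refine ENNReal.tsum_le_tsum fun k => ?_
          have e : t ^ 3 * ((3 * (k : ℝ) ^ 2 + 3 * k + 1) * (3 / 5) ^ k) =
            t ^ 3 * (3 * (k : ℝ) ^ 2 + 3 * k + 1) * (3 / 5) ^ k := by ring
          rw [e, ENNReal.ofReal_mul (q := (3 / 5 : ℝ) ^ k) (by positivity)]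
          refine mul_le_mul' le_rfl ?_
          rw [← ofReal_measureReal]
          exact ENNReal.ofReal_le_ofReal (hb k)
      _ = ENNReal.ofReal (reverseHolderConst * v ^ (3 / 2 : ℝ)) := by
          rw [← ENNReal.ofReal_tsum_of_nonneg (fun k => by positivity)
            (summable_reverseHolder.mul_left _), tsum_mul_left]
          congr 1
          have e : v ^ (3 / 2 : ℝ) = √v ^ 3 := by
            rw [Real.sqrt_eq_rpow, ← Real.rpow_natCast, ← Real.rpow_mul hv0.le]; norm_num
          rw [e, reverseHolderConst, htd]
          ring
  rw [thirdMoment_eq hμ h0 hθ, cubicForm]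
  calc _ ≤ ∫ y, |inner ℝ u (y - m)| ^ 3 ∂P := by
        refine integral_mono hint (hint.norm.congr (Eventually.of_forall fun y => ?_)) fun y => ?_
        · simp only [Real.norm_eq_abs, abs_mul]; ring
        · calc _ ≤ |inner ℝ u (y - m) * inner ℝ u (y - m) * inner ℝ u (y - m)| := le_abs_self _
            _ = _ := by rw [abs_mul, abs_mul]; ring
    _ = (∫⁻ y, ENNReal.ofReal (|inner ℝ u (y - m)| ^ 3) ∂P).toReal :=
        integral_eq_lintegral_of_nonneg_ae (Eventually.of_forall fun y => by positivity)
          (by fun_prop)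
    _ ≤ _ := by
        refine (ENNReal.toReal_mono ENNReal.ofReal_ne_top hlin).trans_eq (ENNReal.toReal_ofReal ?_)
        have := reverseHolderConst_pos
        positivity

lemma isAdmissibleC23_reverseHolderConst : IsAdmissibleC23 reverseHolderConst := by
  intro d n hd hn μ hμ hlc θ₀ hθ₀ s hs hsub
  have h0 := measure_ne_zero hμ hd
  refine iSup₂_le fun θ hθ => iSup₂_le fun u hu => ?_
  have hu0 : u ≠ 0 := by
    rintro rfl
    simp [vecNorm] at hu
  have hv0 := (covForm_self_pos hμ h0 (hsub hθ) hu0).le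
  refine (ENNReal.ofReal_le_ofReal (thirdMoment_le hμ hlc h0 (hsub hθ) hu0)).trans ?_
  rw [ENNReal.ofReal_mul reverseHolderConst_pos.le, ← ENNReal.ofReal_rpow_of_nonneg hv0
    (by norm_num)]
  gcongr
  rw [← dotProduct_fisher hμ h0 (hsub hθ)]
  exact (le_iSup₂ (f := fun (u : EuclideanSpace ℝ (Fin d)) (_ : vecNorm (fisher μ θ₀) u = 1) =>
    ENNReal.ofReal (u.ofLp ⬝ᵥ (fisher μ θ *ᵥ u.ofLp))) u hu).trans
    (le_iSup₂ (f := fun (θ : EuclideanSpace ℝ (Fin d)) (_ : θ ∈ nbhd n μ θ₀ s) =>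
      formNorm (fisher μ θ₀) fun u => u.ofLp ⬝ᵥ (fisher μ θ *ᵥ u.ofLp)) θ hθ)

end ReverseHolder

/-! ### Gaussian and exponential integrals on Euclidean space. -/

section GaussianIntegrals

open Set Filter Topology Real

variable {d : ℕ}

lemma integrable_exp_neg_mul_norm_sq {b : ℝ} (hb : 0 < b) :
    Integrable fun z : EuclideanSpace ℝ (Fin d) => rexp (-b * ‖z‖ ^ 2) := by
  -- The integral of a non-integrable function is 0 by convention, whereas the known value is
  -- positive; the formula therefore already contains integrability.
  by_contra h
  have h1 := GaussianFourier.integral_rexp_neg_mul_sq_norm (V := EuclideanSpace ℝ (Fin d)) hb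
  rw [integral_undef h] at h1
  have : 0 < (π / b) ^ ((Module.finrank ℝ (EuclideanSpace ℝ (Fin d)) : ℝ) / 2) := by positivity
  exact this.ne h1

lemma lintegral_exp_neg_mul_norm_sq {b : ℝ} (hb : 0 < b) :
    ∫⁻ z : EuclideanSpace ℝ (Fin d), ENNReal.ofReal (rexp (-b * ‖z‖ ^ 2)) =
      ENNReal.ofReal ((π / b) ^ ((d : ℝ) / 2)) := by
  rw [← ofReal_integral_eq_lintegral_ofReal (integrable_exp_neg_mul_norm_sq hb)
    (Eventually.of_forall fun _ => (exp_pos _).le), GaussianFourier.integral_rexp_neg_mul_sq_norm hb]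
  simp

/-- The normalising constant `(2π)^{d/2}` of the standard Gaussian. -/
noncomputable def gaussZ (d : ℕ) : ℝ := (2 * π) ^ ((d : ℝ) / 2)

lemma gaussZ_pos : 0 < gaussZ d := by unfold gaussZ; positivity

lemma lintegral_exp_neg_half_norm_sq :
    ∫⁻ z : EuclideanSpace ℝ (Fin d), ENNReal.ofReal (rexp (-(1 / 2) * ‖z‖ ^ 2)) =
      ENNReal.ofReal (gaussZ d) := by
  rw [lintegral_exp_neg_mul_norm_sq (by norm_num), gaussZ]
  congr 2
  ring

/-- The Lebesgue density of the standard Gaussian. -/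
noncomputable def gaussDensity (z : EuclideanSpace ℝ (Fin d)) : ℝ :=
  (gaussZ d)⁻¹ * rexp (-(1 / 2) * ‖z‖ ^ 2)

lemma measurable_gaussDensity : Measurable (gaussDensity (d := d)) := by
  unfold gaussDensity; fun_prop

lemma gaussDensity_nonneg (z : EuclideanSpace ℝ (Fin d)) : 0 ≤ gaussDensity z :=
  mul_nonneg (inv_nonneg.2 gaussZ_pos.le) (exp_pos _).le

lemma lintegral_gaussDensity :
    ∫⁻ z : EuclideanSpace ℝ (Fin d), ENNReal.ofReal (gaussDensity z) = 1 := by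
  simp only [gaussDensity, ENNReal.ofReal_mul (inv_nonneg.2 gaussZ_pos.le)]
  rw [lintegral_const_mul _ (by fun_prop), lintegral_exp_neg_half_norm_sq,
    ← ENNReal.ofReal_mul (inv_nonneg.2 gaussZ_pos.le), inv_mul_cancel₀ gaussZ_pos.ne',
    ENNReal.ofReal_one]

/-- The two finite measures have the same characteristic function. -/
lemma stdGaussian_eq_withDensity : stdGaussian (EuclideanSpace ℝ (Fin d)) =
    volume.withDensity fun z => ENNReal.ofReal (gaussDensity z) := by
  have hfin : IsFiniteMeasure ((volume : Measure (EuclideanSpace ℝ (Fin d))).withDensity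
      fun z => ENNReal.ofReal (gaussDensity z)) :=
    isFiniteMeasure_withDensity (by rw [lintegral_gaussDensity]; simp)
  refine Measure.ext_of_charFun ?_
  ext t
  rw [charFun_stdGaussian, charFun_apply, integral_withDensity_eq_integral_toReal_smul
    measurable_gaussDensity.ennreal_ofReal (Eventually.of_forall fun _ => ENNReal.ofReal_lt_top)]
  have h1 : ∀ x : EuclideanSpace ℝ (Fin d), (ENNReal.ofReal (gaussDensity x)).toReal •
      Complex.exp ((inner ℝ x t : ℝ) * Complex.I) = ((gaussZ d)⁻¹ : ℝ) *
        Complex.exp (-((1 / 2 : ℝ) : ℂ) * (‖x‖ : ℂ) ^ 2 + Complex.I * (inner ℝ t x : ℝ)) := by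
    intro x
    rw [ENNReal.toReal_ofReal (gaussDensity_nonneg x), gaussDensity, Complex.real_smul,
      Complex.exp_add, real_inner_comm]
    push_cast
    ring_nf
  simp_rw [h1]
  rw [integral_const_mul, GaussianFourier.integral_cexp_neg_mul_sq_norm_add (by simp)]
  have h2 : ((π : ℂ) / ((1 / 2 : ℝ) : ℂ)) ^
      ((Module.finrank ℝ (EuclideanSpace ℝ (Fin d)) : ℂ) / 2) = ((gaussZ d : ℝ) : ℂ) := by
    rw [gaussZ, Complex.ofReal_cpow (by positivity)]
    push_cast
    congr 1
    · field_simp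
    · simp
  rw [h2, ← mul_assoc, ← Complex.ofReal_mul, inv_mul_cancel₀ gaussZ_pos.ne']
  simp only [Complex.ofReal_one, one_mul, Complex.I_sq]
  congr 1
  push_cast
  ring

lemma lintegral_stdGaussian {f : EuclideanSpace ℝ (Fin d) → ℝ≥0∞} (hf : Measurable f)
    (s : Set (EuclideanSpace ℝ (Fin d))) (hs : MeasurableSet s) :
    ∫⁻ z in s, f z ∂stdGaussian (EuclideanSpace ℝ (Fin d)) =
      ∫⁻ z in s, ENNReal.ofReal (gaussDensity z) * f z := by
  rw [stdGaussian_eq_withDensity, restrict_withDensity hs,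
    lintegral_withDensity_eq_lintegral_mul _ measurable_gaussDensity.ennreal_ofReal hf]
  rfl

/-- Gaussian tails: `∫_{‖z‖ ≥ r} e^{-(a+b)‖z‖²} ≤ e^{-a r²} (π/b)^{d/2}`. -/
lemma setLIntegral_exp_neg_le {a b r : ℝ} (ha : 0 ≤ a) (hb : 0 < b) (hr : 0 ≤ r) :
    ∫⁻ z in {z : EuclideanSpace ℝ (Fin d) | r ≤ ‖z‖},
      ENNReal.ofReal (rexp (-(a + b) * ‖z‖ ^ 2)) ≤
      ENNReal.ofReal (rexp (-a * r ^ 2) * (π / b) ^ ((d : ℝ) / 2)) := by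
  rw [ENNReal.ofReal_mul (exp_pos _).le, ← lintegral_exp_neg_mul_norm_sq hb,
    ← lintegral_const_mul _ (by fun_prop)]
  refine (setLIntegral_mono (by fun_prop) fun z (hz : r ≤ ‖z‖) => ?_).trans
    (setLIntegral_le_lintegral _ _)
  rw [← ENNReal.ofReal_mul (exp_pos _).le, ← exp_add]
  refine ENNReal.ofReal_le_ofReal (exp_le_exp.2 ?_)
  nlinarith [mul_le_mul_of_nonneg_left (pow_le_pow_left₀ hr hz 2) ha]

lemma integral_exp_neg_mul_abs {β : ℝ} (hβ : 0 < β) :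
    ∫ x : ℝ, rexp (-β * |x|) = 2 / β := by
  rw [integral_comp_abs (f := fun x => rexp (-β * x)), integral_exp_mul_Ioi (by linarith)]
  simp
  ring

lemma integrable_exp_neg_mul_abs {β : ℝ} (hβ : 0 < β) :
    Integrable fun x : ℝ => rexp (-β * |x|) := by
  by_contra h
  have h1 := integral_exp_neg_mul_abs hβ
  rw [integral_undef h] at h1
  have : 0 < 2 / β := by positivity
  exact this.ne h1

lemma sum_abs_le_sqrt_mul_norm (z : EuclideanSpace ℝ (Fin d)) : ∑ i, |z i| ≤ √d * ‖z‖ := by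
  rw [EuclideanSpace.norm_eq, ← sqrt_mul (Nat.cast_nonneg d)]
  refine le_sqrt_of_sq_le ?_
  have := sq_sum_le_card_mul_sum_sq (s := Finset.univ) (f := fun i : Fin d => |z i|)
  simpa using this

/-- Since √d‖z‖ dominates the ℓ¹ norm, the integrand is at most a product of one-dimensional Laplace
densities. This avoids polar coordinates. -/
lemma lintegral_exp_neg_mul_norm_le {β : ℝ} (hβ : 0 < β) :
    ∫⁻ z : EuclideanSpace ℝ (Fin d), ENNReal.ofReal (rexp (-(β * √d) * ‖z‖)) ≤
      ENNReal.ofReal ((2 / β) ^ d) := by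
  have hp := PiLp.volume_preserving_toLp (Fin d)
  have h1 : Integrable fun x : Fin d → ℝ => ∏ i, rexp (-β * |x i|) :=
    Integrable.fintype_prod fun _ => integrable_exp_neg_mul_abs hβ
  have h2 : ∫ x : Fin d → ℝ, ∏ i, rexp (-β * |x i|) = (2 / β) ^ d := by
    have := integral_fintype_prod_volume_eq_pow (ι := Fin d) fun x : ℝ => rexp (-β * |x|)
    rw [this, integral_exp_neg_mul_abs hβ, Fintype.card_fin]
  rw [← h2, ofReal_integral_eq_lintegral_ofReal h1
    (Eventually.of_forall fun x => Finset.prod_nonneg fun i _ => (exp_pos _).le),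
    ← hp.lintegral_comp (by fun_prop)]
  refine lintegral_mono fun x => ENNReal.ofReal_le_ofReal ?_
  rw [← exp_sum]
  refine exp_le_exp.2 ?_
  rw [← Finset.mul_sum]
  have := sum_abs_le_sqrt_mul_norm (WithLp.toLp 2 x)
  simp only at this
  nlinarith

end GaussianIntegrals

/-! ### An L¹ Poincaré inequality for the Gaussian on balls. -/

section MaureyPisier

open Set Filter Topology Real

variable {d : ℕ}

/-- The bound |x| ≤ x²/(2‖L‖) + ‖L‖/2 is integrated against the variance ‖L‖². The sharp factor
√(2/π) is given away. -/
lemma lintegral_enorm_apply_stdGaussian_le (L : EuclideanSpace ℝ (Fin d) →L[ℝ] ℝ) :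
    ∫⁻ b, ‖L b‖ₑ ∂stdGaussian (EuclideanSpace ℝ (Fin d)) ≤ ‖L‖ₑ := by
  set γ := stdGaussian (EuclideanSpace ℝ (Fin d))
  rcases (norm_nonneg L).eq_or_lt with h0 | h0
  · have : L = 0 := norm_eq_zero.1 h0.symm
    simp [this]
  have hL2 : MemLp L 2 γ := IsGaussian.memLp_dual γ L 2 (by simp)
  have hv : ∫ b, L b ^ 2 ∂γ = ‖L‖ ^ 2 := by
    rw [← variance_dual_stdGaussian L, variance_of_integral_eq_zero L.continuous.aemeasurable
      (integral_strongDual_stdGaussian L)]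
  have hint : Integrable (fun b => L b ^ 2) γ := hL2.integrable_sq
  have hb : ∀ b, |L b| ≤ (2 * ‖L‖)⁻¹ * L b ^ 2 + ‖L‖ / 2 := by
    intro b
    have : (2 * ‖L‖)⁻¹ * L b ^ 2 + ‖L‖ / 2 - |L b| = (2 * ‖L‖)⁻¹ * (|L b| - ‖L‖) ^ 2 := by
      rw [← sq_abs (L b)]; field_simp; ring
    have h2 : 0 ≤ (2 * ‖L‖)⁻¹ * (|L b| - ‖L‖) ^ 2 := by positivity
    linarith
  calc ∫⁻ b, ‖L b‖ₑ ∂γ ≤ ∫⁻ b, ENNReal.ofReal ((2 * ‖L‖)⁻¹ * L b ^ 2 + ‖L‖ / 2) ∂γ := by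
        refine lintegral_mono fun b => ?_
        rw [Real.enorm_eq_ofReal_abs]
        exact ENNReal.ofReal_le_ofReal (hb b)
    _ = ENNReal.ofReal (∫ b, ((2 * ‖L‖)⁻¹ * L b ^ 2 + ‖L‖ / 2) ∂γ) :=
        (ofReal_integral_eq_lintegral_ofReal ((hint.const_mul _).add (integrable_const _))
          (Eventually.of_forall fun b => (abs_nonneg _).trans (hb b))).symm
    _ = ENNReal.ofReal ‖L‖ := by
        rw [integral_add (hint.const_mul _) (integrable_const _), integral_const_mul, hv]
        congr 1
        simp
        field_simp
        ring
    _ = ‖L‖ₑ := by rw [← ofReal_norm]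

/-- Since |cos t| + |sin t| ≤ √2, the rotation path between two points of the ball of radius R/√2
stays in the ball of radius R. This is the source of the radius R/√2 below. -/
lemma norm_cos_smul_add_sin_smul_lt {x y : EuclideanSpace ℝ (Fin d)} {R : ℝ}
    (hx : ‖x‖ < R / √2) (hy : ‖y‖ < R / √2) (t : ℝ) : ‖cos t • x + sin t • y‖ < R := by
  have h2 : (0 : ℝ) < √2 := by positivity
  have hcs : |cos t| + |sin t| ≤ √2 := by
    refine le_sqrt_of_sq_le ?_
    have h3 := Real.sin_sq_add_cos_sq t
    rw [← sq_abs (sin t), ← sq_abs (cos t)] at h3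
    nlinarith [sq_nonneg (|cos t| - |sin t|)]
  set m := max ‖x‖ ‖y‖
  have hm : m < R / √2 := max_lt hx hy
  have hm0 : 0 ≤ m := (norm_nonneg x).trans (le_max_left _ _)
  calc ‖cos t • x + sin t • y‖ ≤ |cos t| * ‖x‖ + |sin t| * ‖y‖ := by
        refine (norm_add_le _ _).trans ?_
        rw [norm_smul, norm_smul, Real.norm_eq_abs, Real.norm_eq_abs]
    _ ≤ |cos t| * m + |sin t| * m := by
        gcongr
        · exact le_max_left _ _
        · exact le_max_right _ _
    _ = (|cos t| + |sin t|) * m := by ring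
    _ ≤ √2 * m := by gcongr
    _ < √2 * (R / √2) := by gcongr
    _ = R := by field_simp

/-- The Maurey–Pisier Poincaré inequality in `L¹`, localised to balls. -/
lemma lintegral_enorm_sub_le {g : EuclideanSpace ℝ (Fin d) → ℝ} {R : ℝ}
    (hg : ContDiffOn ℝ 1 g (Metric.ball 0 R)) :
    ∫⁻ x in Metric.ball 0 (R / √2), ∫⁻ y in Metric.ball 0 (R / √2), ‖g y - g x‖ₑ
      ∂stdGaussian (EuclideanSpace ℝ (Fin d)) ∂stdGaussian (EuclideanSpace ℝ (Fin d)) ≤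
    ENNReal.ofReal (π / 2) * ∫⁻ x in Metric.ball 0 R, ‖fderiv ℝ g x‖ₑ
      ∂stdGaussian (EuclideanSpace ℝ (Fin d)) := by
  set γ := stdGaussian (EuclideanSpace ℝ (Fin d)) with hγ
  set B := Metric.ball (0 : EuclideanSpace ℝ (Fin d)) R
  set B' := Metric.ball (0 : EuclideanSpace ℝ (Fin d)) (R / √2)
  set Φ : EuclideanSpace ℝ (Fin d) × EuclideanSpace ℝ (Fin d) → ℝ≥0∞ := fun p =>
    B.indicator 1 p.1 * ‖fderiv ℝ g p.1 p.2‖ₑ with hΦ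
  have hB : MeasurableSet B := Metric.isOpen_ball.measurableSet
  have hB' : MeasurableSet B' := Metric.isOpen_ball.measurableSet
  -- Expanding in coordinates reduces the claim to directional derivatives, which are measurable
  -- even where g is not differentiable.
  have hap : Measurable fun p : EuclideanSpace ℝ (Fin d) × EuclideanSpace ℝ (Fin d) =>
      fderiv ℝ g p.1 p.2 := by
    have e : (fun p : EuclideanSpace ℝ (Fin d) × EuclideanSpace ℝ (Fin d) =>
        fderiv ℝ g p.1 p.2) = fun p => ∑ i, p.2 i *
          fderiv ℝ g p.1 (EuclideanSpace.single i (1 : ℝ)) := by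
      ext p
      have hy : p.2 = ∑ i, p.2 i • EuclideanSpace.single i (1 : ℝ) := by
        ext k; simp [Finset.sum_apply, Pi.single_apply]
      conv_lhs => rw [hy, map_sum]
      simp
    rw [e]
    refine Finset.measurable_sum _ fun i _ => Measurable.mul (by fun_prop) ?_
    exact (measurable_fderiv_apply_const ℝ g _).comp measurable_fst
  have hΦm : Measurable Φ :=
    ((measurable_one.indicator hB).comp measurable_fst).mul hap.enorm
  -- Integrate along t ↦ cos t x + sin t y, whose position and velocity are the two components of a
  -- rotation of (x, y).
  have hpath : ∀ x ∈ B', ∀ y ∈ B', ‖g y - g x‖ₑ ≤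
      ∫⁻ t in Ioc 0 (π / 2), Φ (ContinuousLinearMap.rotation t (x, y)) := by
    intro x hx y hy
    have hx' : ‖x‖ < R / √2 := by simpa [B'] using hx
    have hy' : ‖y‖ < R / √2 := by simpa [B'] using hy
    have hmem : ∀ t : ℝ, cos t • x + sin t • y ∈ B := fun t => by
      simpa [B] using norm_cos_smul_add_sin_smul_lt hx' hy' t
    have hcurve : ∀ t : ℝ, HasDerivAt (fun t : ℝ => cos t • x + sin t • y)
        (-sin t • x + cos t • y) t := fun t =>
      ((hasDerivAt_cos t).smul_const x).add ((hasDerivAt_sin t).smul_const y)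
    have hder : ∀ t ∈ uIcc 0 (π / 2), HasDerivAt (fun t : ℝ => g (cos t • x + sin t • y))
        (fderiv ℝ g (cos t • x + sin t • y) (-sin t • x + cos t • y)) t := by
      intro t _
      have h1 : DifferentiableAt ℝ g (cos t • x + sin t • y) :=
        (hg.differentiableOn one_ne_zero).differentiableAt (Metric.isOpen_ball.mem_nhds (hmem t))
      exact h1.hasFDerivAt.comp_hasDerivAt t (hcurve t)
    have hcont : Continuous fun t : ℝ =>
        fderiv ℝ g (cos t • x + sin t • y) (-sin t • x + cos t • y) := by
      have h1 : ContinuousOn (fderiv ℝ g) B :=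
        hg.continuousOn_fderiv_of_isOpen Metric.isOpen_ball le_rfl
      have h2 : Continuous fun t : ℝ => fderiv ℝ g (cos t • x + sin t • y) :=
        h1.comp_continuous (by fun_prop) hmem
      exact h2.clm_apply (by fun_prop)
    have hftc := intervalIntegral.integral_eq_sub_of_hasDerivAt hder (hcont.intervalIntegrable _ _)
    simp only [cos_pi_div_two, zero_smul, sin_pi_div_two, one_smul, zero_add, cos_zero, sin_zero,
      add_zero] at hftc
    rw [← hftc, intervalIntegral.integral_of_le (by positivity)]
    refine (enorm_integral_le_lintegral_enorm _).trans (lintegral_mono fun t => ?_)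
    simp only [hΦ, ContinuousLinearMap.rotation_apply, indicator_of_mem (hmem t), Pi.one_apply,
      one_mul, le_refl]
  have hrotm : Measurable fun q : ℝ × (EuclideanSpace ℝ (Fin d) × EuclideanSpace ℝ (Fin d)) =>
      Φ (ContinuousLinearMap.rotation q.1 q.2) := by
    refine hΦm.comp ?_
    simp only [ContinuousLinearMap.rotation_apply]
    fun_prop
  calc ∫⁻ x in B', ∫⁻ y in B', ‖g y - g x‖ₑ ∂γ ∂γ
      ≤ ∫⁻ x in B', ∫⁻ y in B', (∫⁻ t in Ioc 0 (π / 2),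
          Φ (ContinuousLinearMap.rotation t (x, y))) ∂γ ∂γ :=
        setLIntegral_mono' hB' fun x hx => setLIntegral_mono' hB' fun y hy => hpath x hx y hy
    _ ≤ ∫⁻ x, ∫⁻ y, (∫⁻ t in Ioc 0 (π / 2),
          Φ (ContinuousLinearMap.rotation t (x, y))) ∂γ ∂γ :=
        (setLIntegral_le_lintegral _ _).trans
          (lintegral_mono fun x => setLIntegral_le_lintegral _ _)
    _ = ∫⁻ p, (∫⁻ t in Ioc 0 (π / 2), Φ (ContinuousLinearMap.rotation t p)) ∂γ.prod γ := by
        rw [lintegral_prod]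
        exact (Measurable.lintegral_prod_left' hrotm).aemeasurable
    _ = ∫⁻ t in Ioc 0 (π / 2), ∫⁻ p, Φ (ContinuousLinearMap.rotation t p) ∂γ.prod γ :=
        lintegral_lintegral_swap (hrotm.comp measurable_swap).aemeasurable
    -- The product Gaussian is rotation invariant, so for each t position and velocity are again
    -- independent standard Gaussians.
    _ = ∫⁻ t in Ioc 0 (π / 2), ∫⁻ p, Φ p ∂γ.prod γ := by
        congr with t
        have hrot := IsGaussian.map_rotation_eq_self (μ := γ) (by simp [hγ]) t
        conv_rhs => rw [← hrot]
        rw [lintegral_map hΦm (by fun_prop)]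
    _ = ENNReal.ofReal (π / 2) * ∫⁻ p, Φ p ∂γ.prod γ := by
        rw [setLIntegral_const, Real.volume_Ioc, sub_zero, mul_comm]
    _ ≤ _ := by
        refine mul_le_mul' le_rfl ?_
        rw [lintegral_prod _ hΦm.aemeasurable, ← lintegral_indicator hB]
        refine lintegral_mono fun x => ?_
        simp only [hΦ]
        by_cases hx : x ∈ B
        · simp only [indicator_of_mem hx, Pi.one_apply, one_mul]
          exact lintegral_enorm_apply_stdGaussian_le _
        · simp [indicator_of_notMem hx]

end MaureyPisier

/-! ### Total variation from a comparison on one set. -/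

section TotalVariation

open Set Filter Topology

/-- The cross products P(A)Q(B) and Q(A)P(B) compare the measures conditioned on B without dividing.
Replacing Q(B) and P(B) by 1 costs only the masses of the complement. -/
lemma tv_le_of_local {α : Type*} [MeasurableSpace α] {P Q : Measure α} [IsProbabilityMeasure P]
    [IsProbabilityMeasure Q] {B : Set α} (hB : MeasurableSet B) {D p q : ℝ} (hD : 0 ≤ D)
    (hp : 0 ≤ p) (hq : 0 ≤ q)
    (h1 : ∀ A ⊆ B, MeasurableSet A → P A * Q B ≤ Q A * P B + ENNReal.ofReal D)
    (h2 : ∀ A ⊆ B, MeasurableSet A → Q A * P B ≤ P A * Q B + ENNReal.ofReal D)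
    (hP : P Bᶜ ≤ ENNReal.ofReal p) (hQ : Q Bᶜ ≤ ENNReal.ofReal q) :
    tv P Q ≤ ENNReal.ofReal (D + p + q) := by
  have key : ∀ (P Q : Measure α) [IsProbabilityMeasure P] [IsProbabilityMeasure Q] (p q : ℝ),
      0 ≤ p → 0 ≤ q →
      (∀ A ⊆ B, MeasurableSet A → P A * Q B ≤ Q A * P B + ENNReal.ofReal D) →
      P Bᶜ ≤ ENNReal.ofReal p → Q Bᶜ ≤ ENNReal.ofReal q → ∀ A, MeasurableSet A →
      P.real A ≤ Q.real A + (D + p + q) := by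
    intro P Q _ _ p q hp hq h1 hP hQ A hA
    have e1 : P A ≤ Q A + ENNReal.ofReal (D + p + q) := by
      have hAB := h1 (A ∩ B) inter_subset_right (hA.inter hB)
      have hQB : Q B + Q Bᶜ = 1 := by rw [measure_add_measure_compl hB, measure_univ]
      calc P A ≤ P (A ∩ B) + P Bᶜ := by
            refine (measure_mono (t := A ∩ B ∪ Bᶜ) fun x hx => ?_).trans (measure_union_le _ _)
            by_cases hxB : x ∈ B
            · exact Or.inl ⟨hx, hxB⟩
            · exact Or.inr hxB
        _ = P (A ∩ B) * Q B + P (A ∩ B) * Q Bᶜ + P Bᶜ := by rw [← mul_add, hQB, mul_one]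
        _ ≤ (Q (A ∩ B) * P B + ENNReal.ofReal D) + 1 * ENNReal.ofReal q + ENNReal.ofReal p := by
            gcongr
            exact prob_le_one
        _ ≤ (Q A * 1 + ENNReal.ofReal D) + 1 * ENNReal.ofReal q + ENNReal.ofReal p := by
            gcongr
            · exact inter_subset_left
            · exact prob_le_one
        _ = Q A + ENNReal.ofReal (D + p + q) := by
            rw [ENNReal.ofReal_add (by positivity) hq, ENNReal.ofReal_add hD hp]
            ring
    have e2 := ENNReal.toReal_mono (by simp) e1
    rwa [ENNReal.toReal_add (measure_ne_top _ _) ENNReal.ofReal_ne_top,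
      ENNReal.toReal_ofReal (by positivity)] at e2
  refine iSup₂_le fun A hA => ENNReal.ofReal_le_ofReal (abs_le.2 ⟨?_, ?_⟩)
  · have := key Q P q p hq hp h2 hQ hP A hA
    linarith
  · have := key P Q p q hp hq h1 hP hQ A hA
    linarith

lemma ennreal_inv_mul_le {Z X : ℝ≥0∞} {x z c : ℝ} (hz : 0 < z)
    (hX : X ≤ ENNReal.ofReal x) (hZ : ENNReal.ofReal z ≤ Z) (h : x ≤ c * z) :
    Z⁻¹ * X ≤ ENNReal.ofReal c := by
  calc Z⁻¹ * X ≤ (ENNReal.ofReal z)⁻¹ * ENNReal.ofReal (c * z) :=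
        mul_le_mul' (ENNReal.inv_le_inv.2 hZ) (hX.trans (ENNReal.ofReal_le_ofReal h))
    _ = ENNReal.ofReal c := by
        rw [← ENNReal.ofReal_inv_of_pos hz, ← ENNReal.ofReal_mul (inv_nonneg.2 hz.le)]
        congr 1
        field_simp

end TotalVariation

/-! ### Mass, first moment and tails of a nearly Gaussian density. -/

section NearGaussian

open Set Filter Topology Real

variable {d : ℕ}

/-- A density `e^{-W} q` on `Ω` that is close to the standard Gaussian density on the ball of
radius `R`. -/
structure NearGaussian (Ω : Set (EuclideanSpace ℝ (Fin d))) (W q : EuclideanSpace ℝ (Fin d) → ℝ)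
    (R ε L : ℝ) : Prop where
  ball_subset : Metric.ball 0 R ⊆ Ω
  W_zero : W 0 = 0
  W_contDiffOn : ContDiffOn ℝ 1 W (Metric.ball 0 R)
  W_fderiv : ∀ z ∈ Metric.ball 0 R, ∀ w, |fderiv ℝ W z w - inner ℝ z w| ≤ ε * ‖z‖ * ‖w‖
  q_contDiffOn : ContDiffOn ℝ 1 q (Metric.ball 0 R)
  q_pos : ∀ z ∈ Metric.ball 0 R, 0 < q z
  q_fderiv : ∀ z ∈ Metric.ball 0 R, ‖fderiv ℝ (fun z => log (q z)) z‖ ≤ L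
  R_pos : 0 < R
  ε_nonneg : 0 ≤ ε
  ε_le : ε ≤ 2 / 5
  L_nonneg : 0 ≤ L
  L_le : L ≤ √d / 6

variable {Ω : Set (EuclideanSpace ℝ (Fin d))} {W q : EuclideanSpace ℝ (Fin d) → ℝ} {R ε L s : ℝ}

/-- The density `e^{-W} q` on `Ω`. -/
noncomputable def modelDensity (Ω : Set (EuclideanSpace ℝ (Fin d)))
    (W q : EuclideanSpace ℝ (Fin d) → ℝ) : EuclideanSpace ℝ (Fin d) → ℝ≥0∞ :=
  Ω.indicator fun z => ENNReal.ofReal (rexp (-W z) * q z)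

/-- Integrate the gradient bound along the ray t ↦ t z. -/
lemma NearGaussian.abs_W_sub_le (h : NearGaussian Ω W q R ε L) {z : EuclideanSpace ℝ (Fin d)}
    (hz : z ∈ Metric.ball 0 R) : |W z - ‖z‖ ^ 2 / 2| ≤ ε * ‖z‖ ^ 2 / 2 := by
  have hzR : ‖z‖ < R := by simpa using hz
  have hmem : ∀ t ∈ Icc (0 : ℝ) 1, t • z ∈ Metric.ball 0 R := by
    intro t ht
    rw [mem_ball_zero_iff, norm_smul, Real.norm_of_nonneg ht.1]
    nlinarith [norm_nonneg z, ht.2]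
  have hder : ∀ t ∈ Icc (0 : ℝ) 1, HasDerivAt (fun t : ℝ => W (t • z) - t ^ 2 * ‖z‖ ^ 2 / 2)
      (fderiv ℝ W (t • z) z - t * ‖z‖ ^ 2) t := by
    intro t ht
    have h1 : DifferentiableAt ℝ W (t • z) :=
      (h.W_contDiffOn.differentiableOn one_ne_zero).differentiableAt
        (Metric.isOpen_ball.mem_nhds (hmem t ht))
    have h2 : HasDerivAt (fun t : ℝ => t • z) z t := by
      simpa using (hasDerivAt_id t).smul_const z
    have h3 : HasDerivAt (fun t : ℝ => t ^ 2 * ‖z‖ ^ 2 / 2) (t * ‖z‖ ^ 2) t := by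
      have := (((hasDerivAt_id t).pow 2).mul_const (‖z‖ ^ 2)).div_const 2
      refine this.congr_deriv ?_
      simp; ring
    exact (h1.hasFDerivAt.comp_hasDerivAt t h2).sub h3
  have key := image_norm_le_of_norm_deriv_right_le_deriv_boundary (a := 0) (b := 1)
    (f := fun t : ℝ => W (t • z) - t ^ 2 * ‖z‖ ^ 2 / 2)
    (f' := fun t => fderiv ℝ W (t • z) z - t * ‖z‖ ^ 2)
    (B := fun t => ε * ‖z‖ ^ 2 / 2 * t ^ 2) (B' := fun t => ε * ‖z‖ ^ 2 * t)
    (fun t ht => (hder t ht).continuousAt.continuousWithinAt)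
    (fun t ht => (hder t ⟨ht.1, ht.2.le⟩).hasDerivWithinAt)
    (by simp [h.W_zero])
    (fun t => by
      have := ((hasDerivAt_id t).pow 2).const_mul (ε * ‖z‖ ^ 2 / 2)
      refine this.congr_deriv ?_
      simp; ring)
    (fun t ht => by
      have h1 := h.W_fderiv (t • z) (hmem t ⟨ht.1, ht.2.le⟩) z
      rw [inner_smul_left, real_inner_self_eq_norm_sq, norm_smul, Real.norm_of_nonneg ht.1] at h1
      simp only [conj_trivial] at h1
      rw [Real.norm_eq_abs]
      exact h1.trans_eq (by ring))
    (x := 1) ⟨zero_le_one, le_rfl⟩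
  simpa [Real.norm_eq_abs] using key

lemma NearGaussian.abs_log_sub_le (h : NearGaussian Ω W q R ε L) {z : EuclideanSpace ℝ (Fin d)}
    (hz : z ∈ Metric.ball 0 R) : |log (q z) - log (q 0)| ≤ L * ‖z‖ := by
  have h1 := Convex.norm_image_sub_le_of_norm_fderiv_le (𝕜 := ℝ)
    (f := fun z => log (q z)) (C := L) (s := Metric.ball 0 R) (x := 0) (y := z)
    (fun x hx => ((h.q_contDiffOn.differentiableOn one_ne_zero).differentiableAt
      (Metric.isOpen_ball.mem_nhds hx)).log (h.q_pos x hx).ne')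
    h.q_fderiv (convex_ball 0 R) (Metric.mem_ball_self h.R_pos) hz
  simpa [Real.norm_eq_abs] using h1

lemma NearGaussian.exp_mul_le (h : NearGaussian Ω W q R ε L) {z : EuclideanSpace ℝ (Fin d)}
    (hz : z ∈ Metric.ball 0 R) :
    rexp (-W z) * q z ≤ q 0 * rexp (L * ‖z‖ - (1 - ε) * ‖z‖ ^ 2 / 2) := by
  have h1 := (abs_le.1 (h.abs_W_sub_le hz)).1
  have h2 := (abs_le.1 (h.abs_log_sub_le hz)).2
  rw [← exp_log (h.q_pos z hz), ← exp_log (h.q_pos 0 (Metric.mem_ball_self h.R_pos)), ← exp_add,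
    ← exp_add]
  refine exp_le_exp.2 ?_
  linarith

lemma NearGaussian.le_exp_mul (h : NearGaussian Ω W q R ε L) {z : EuclideanSpace ℝ (Fin d)}
    (hz : z ∈ Metric.ball 0 R) :
    q 0 * rexp (-(L * ‖z‖) - (1 + ε) * ‖z‖ ^ 2 / 2) ≤ rexp (-W z) * q z := by
  have h1 := (abs_le.1 (h.abs_W_sub_le hz)).2
  have h2 := (abs_le.1 (h.abs_log_sub_le hz)).1
  rw [← exp_log (h.q_pos z hz), ← exp_log (h.q_pos 0 (Metric.mem_ball_self h.R_pos)), ← exp_add,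
    ← exp_add]
  refine exp_le_exp.2 ?_
  linarith

lemma rpow_pi_div {b : ℝ} (hb : 0 < b) :
    (π / b) ^ ((d : ℝ) / 2) = gaussZ d * (1 / (2 * b)) ^ ((d : ℝ) / 2) := by
  rw [gaussZ, ← mul_rpow (by positivity) (by positivity)]
  congr 1
  field_simp

/-- The number 0.35 is just above (log 2)/2. -/
lemma two_pow_rpow_le (k : ℕ) : ((2 : ℝ) ^ k) ^ ((d : ℝ) / 2) ≤ rexp (0.35 * k * d) := by
  have h2 : (2 : ℝ) ^ k = rexp (k * log 2) := by
    rw [← Real.exp_log (show (0 : ℝ) < 2 by norm_num), ← Real.exp_nat_mul,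
      Real.exp_log (by norm_num)]
  rw [h2, ← exp_mul]
  refine exp_le_exp.2 ?_
  have := log_two_lt_d9
  have h3 : (0 : ℝ) ≤ (k : ℝ) * d := by positivity
  nlinarith

/-- Of the decay rate c, the part 1/(2·2^k) is kept for integrability, and it inflates the Gaussian
constant by 2^(kd/2); the part a produces the tail factor e^{-a r²}. -/
lemma setLIntegral_exp_neg_le_gaussZ (k : ℕ) {a c r : ℝ} (ha : 0 ≤ a) (hr : 0 ≤ r)
    (hc : a + 1 / (2 * 2 ^ k) ≤ c) :
    ∫⁻ z in {z : EuclideanSpace ℝ (Fin d) | r ≤ ‖z‖},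
      ENNReal.ofReal (rexp (-c * ‖z‖ ^ 2)) ≤
      ENNReal.ofReal (gaussZ d * rexp (0.35 * k * d - a * r ^ 2)) := by
  have hb : (0 : ℝ) < 1 / (2 * 2 ^ k) := by positivity
  have h1 := setLIntegral_exp_neg_le (d := d) ha hb hr
  refine (lintegral_mono fun z => ENNReal.ofReal_le_ofReal (exp_le_exp.2 ?_)).trans
    (h1.trans (ENNReal.ofReal_le_ofReal ?_))
  · nlinarith [sq_nonneg ‖z‖]
  · rw [rpow_pi_div hb]
    have e : (1 : ℝ) / (2 * (1 / (2 * 2 ^ k))) = 2 ^ k := by field_simp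
    rw [e, sub_eq_add_neg, exp_add, neg_mul]
    have := two_pow_rpow_le (d := d) k
    have h2 := gaussZ_pos (d := d)
    have h3 := exp_pos (-(a * r ^ 2))
    calc _ = gaussZ d * ((2 ^ k) ^ ((d : ℝ) / 2) * rexp (-(a * r ^ 2))) := by ring
      _ ≤ _ := by gcongr

lemma exp_neg_le_half {x : ℝ} (hx : 0.7 ≤ x) : rexp (-x) ≤ 1 / 2 := by
  have h1 : rexp (-log 2) = 1 / 2 := by rw [exp_neg, exp_log (by norm_num)]; norm_num
  rw [← h1]
  refine exp_le_exp.2 ?_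
  have := log_two_lt_d9
  linarith

/-- The ball of radius √(5d) carries at least half of the Gaussian mass, as the tail exponent 5d/4 -
0.35d = 0.9d exceeds log 2. -/
lemma gaussZ_half_le_setLIntegral (hd : 0 < d) : ENNReal.ofReal (gaussZ d / 2) ≤
    ∫⁻ z in {z : EuclideanSpace ℝ (Fin d) | √(5 * d) ≤ ‖z‖}ᶜ,
      ENNReal.ofReal (rexp (-(1 / 2) * ‖z‖ ^ 2)) := by
  have hd1 : (1 : ℝ) ≤ d := by exact_mod_cast hd
  have h1 := setLIntegral_exp_neg_le_gaussZ (d := d) 1 (a := 1 / 4) (c := 1 / 2) (r := √(5 * d))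
    (by norm_num) (by positivity) (by norm_num)
  rw [sq_sqrt (by positivity)] at h1
  have hm : MeasurableSet {z : EuclideanSpace ℝ (Fin d) | √(5 * d) ≤ ‖z‖} :=
    measurableSet_le measurable_const measurable_norm
  have h2 := lintegral_add_compl (μ := (volume : Measure (EuclideanSpace ℝ (Fin d))))
    (fun z => ENNReal.ofReal (rexp (-(1 / 2) * ‖z‖ ^ 2))) hm
  rw [lintegral_exp_neg_half_norm_sq] at h2
  have h3 : gaussZ d * rexp (0.35 * (1 : ℕ) * d - 1 / 4 * (5 * d)) ≤ gaussZ d / 2 := by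
    rw [div_eq_mul_one_div (gaussZ d)]
    refine mul_le_mul_of_nonneg_left ?_ gaussZ_pos.le
    have := exp_neg_le_half (x := -(0.35 * (1 : ℕ) * d - 1 / 4 * (5 * d))) (by
      push_cast; linarith)
    rwa [neg_neg] at this
  have h4 : ENNReal.ofReal (gaussZ d) = ENNReal.ofReal (gaussZ d / 2) +
      ENNReal.ofReal (gaussZ d / 2) := by
    rw [← ENNReal.ofReal_add (by linarith [gaussZ_pos (d := d)]) (by linarith [gaussZ_pos (d := d)])]
    congr 1; ring
  rw [h4] at h2
  have h5 := h1.trans (ENNReal.ofReal_le_ofReal h3)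
  by_contra hlt
  exact absurd h2 (ne_of_lt (ENNReal.add_lt_add_of_le_of_lt
    (ne_top_of_le_ne_top ENNReal.ofReal_ne_top h5) h5 (not_le.1 hlt)))

/-- A lower bound for the normalising constant. -/
noncomputable def massBound (d : ℕ) (q₀ : ℝ) : ℝ := q₀ * rexp (-(1.4 * d)) * (gaussZ d / 2)

lemma massBound_pos {q₀ : ℝ} (hq : 0 < q₀) : 0 < massBound d q₀ := by
  have := gaussZ_pos (d := d)
  unfold massBound; positivity

lemma NearGaussian.q_zero_pos (h : NearGaussian Ω W q R ε L) : 0 < q 0 :=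
  h.q_pos 0 (Metric.mem_ball_self h.R_pos)

lemma NearGaussian.massBound_le (h : NearGaussian Ω W q R ε L) (hd : 0 < d) (hR : 12 * √d ≤ R) :
    ENNReal.ofReal (massBound d (q 0)) ≤ ∫⁻ z, modelDensity Ω W q z := by
  have hq0 := h.q_zero_pos
  have hd1 : (1 : ℝ) ≤ d := by exact_mod_cast hd
  rw [massBound, ENNReal.ofReal_mul (by positivity)]
  refine (mul_le_mul' le_rfl (gaussZ_half_le_setLIntegral hd)).trans ?_
  rw [← lintegral_const_mul _ (by fun_prop)]
  refine le_trans ?_ (setLIntegral_le_lintegral {z | √(5 * d) ≤ ‖z‖}ᶜ _)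
  have hm : MeasurableSet {z : EuclideanSpace ℝ (Fin d) | √(5 * d) ≤ ‖z‖} :=
    measurableSet_le measurable_const measurable_norm
  refine setLIntegral_mono' hm.compl fun z hz => ?_
  have hz' : ‖z‖ < √(5 * d) := by simpa using hz
  have hsd : √(d : ℝ) ^ 2 = d := sq_sqrt (Nat.cast_nonneg d)
  have hzd : ‖z‖ ^ 2 ≤ 5 * d := by
    rw [← sq_sqrt (show (0 : ℝ) ≤ 5 * d by positivity)]
    exact pow_le_pow_left₀ (norm_nonneg z) hz'.le 2
  have hz2 : ‖z‖ ≤ 2.24 * √d := by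
    refine le_of_sq_le_sq (?_) (by positivity)
    nlinarith
  have hzR : z ∈ Metric.ball 0 R := by
    rw [mem_ball_zero_iff]
    have : 0 < √(d : ℝ) := sqrt_pos.2 (by linarith)
    linarith
  rw [← ENNReal.ofReal_mul (by positivity), modelDensity, indicator_of_mem (h.ball_subset hzR)]
  refine ENNReal.ofReal_le_ofReal (le_trans ?_ (h.le_exp_mul hzR))
  rw [mul_assoc, ← exp_add]
  refine mul_le_mul_of_nonneg_left (exp_le_exp.2 ?_) hq0.le
  -- On this ball the density loses at most 2.24d/6 through q and ε‖z‖²/2 ≤ d through W, together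
  -- less than the 1.4d in `massBound`.
  have h1 : L * ‖z‖ ≤ √d / 6 * (2.24 * √d) :=
    mul_le_mul h.L_le hz2 (norm_nonneg z) (by positivity)
  have h2 : ε * ‖z‖ ^ 2 ≤ 2 / 5 * (5 * d) :=
    mul_le_mul h.ε_le hzd (by positivity) (by norm_num)
  nlinarith

/-- The mean of ‖z‖ under the model is O(√d). Up to 10√d this is immediate, and the remaining tail
has mass far below `massBound`. -/
lemma NearGaussian.setLIntegral_norm_le (h : NearGaussian Ω W q R ε L) (hd : 0 < d)
    (hR : 12 * √d ≤ R) :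
    ∫⁻ z in Metric.ball 0 R, ENNReal.ofReal ‖z‖ * modelDensity Ω W q z ≤
      ENNReal.ofReal (11 * √d) * ∫⁻ z, modelDensity Ω W q z := by
  have hd1 : (1 : ℝ) ≤ d := by exact_mod_cast hd
  have hq0 := h.q_zero_pos
  have hsd : √(d : ℝ) ^ 2 = d := sq_sqrt (Nat.cast_nonneg d)
  have hsd0 : 0 < √(d : ℝ) := sqrt_pos.2 (by linarith)
  have hfar : ∀ z ∈ Metric.ball (0 : EuclideanSpace ℝ (Fin d)) R, 10 * √d ≤ ‖z‖ →
      ENNReal.ofReal ‖z‖ * modelDensity Ω W q z ≤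
        ENNReal.ofReal (√d * q 0) * ENNReal.ofReal (rexp (-(0.18) * ‖z‖ ^ 2)) := by
    intro z hz hz10
    rw [modelDensity, indicator_of_mem (h.ball_subset hz), ← ENNReal.ofReal_mul (norm_nonneg z),
      ← ENNReal.ofReal_mul (by positivity)]
    refine ENNReal.ofReal_le_ofReal ?_
    -- The factor ‖z‖ is paid for with ‖z‖²/10 in the exponent; together with ‖z‖²/60 from q and
    -- -0.3‖z‖² from W this leaves less than -0.18‖z‖².
    have h1 : ‖z‖ ≤ √d * rexp (‖z‖ ^ 2 / 10) := by
      have e1 : ‖z‖ / √d ≤ rexp (‖z‖ / √d) := by linarith [add_one_le_exp (‖z‖ / √d)]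
      have e2 : ‖z‖ / √d ≤ ‖z‖ ^ 2 / 10 := by
        rw [div_le_iff₀ hsd0]
        have : 10 ≤ ‖z‖ * √d := by nlinarith
        nlinarith [norm_nonneg z]
      rw [div_le_iff₀ hsd0] at e1
      refine e1.trans ?_
      rw [mul_comm]
      gcongr
    calc ‖z‖ * (rexp (-W z) * q z)
        ≤ (√d * rexp (‖z‖ ^ 2 / 10)) * (q 0 * rexp (L * ‖z‖ - (1 - ε) * ‖z‖ ^ 2 / 2)) :=
          mul_le_mul h1 (h.exp_mul_le hz) (mul_nonneg (exp_pos _).le (h.q_pos z hz).le)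
            (by positivity)
      _ = (√d * q 0) * rexp (‖z‖ ^ 2 / 10 + (L * ‖z‖ - (1 - ε) * ‖z‖ ^ 2 / 2)) := by
          rw [exp_add]; ring
      _ ≤ _ := by
          refine mul_le_mul_of_nonneg_left (exp_le_exp.2 ?_) (by positivity)
          have h3 : L * ‖z‖ ≤ ‖z‖ ^ 2 / 60 := by
            have : L ≤ ‖z‖ / 60 := by linarith [h.L_le]
            nlinarith [norm_nonneg z]
          have h4 : ε * ‖z‖ ^ 2 ≤ 2 / 5 * ‖z‖ ^ 2 := by gcongr; exact h.ε_le
          nlinarith [sq_nonneg ‖z‖]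
  have hρB : ∀ z ∈ Metric.ball (0 : EuclideanSpace ℝ (Fin d)) R,
      ENNReal.ofReal ‖z‖ * modelDensity Ω W q z ≤
      ENNReal.ofReal (10 * √d) * modelDensity Ω W q z +
      ({z : EuclideanSpace ℝ (Fin d) | 10 * √d ≤ ‖z‖}).indicator (fun z =>
        ENNReal.ofReal (√d * q 0) * ENNReal.ofReal (rexp (-(0.18) * ‖z‖ ^ 2))) z := by
    intro z hz
    by_cases hz10 : 10 * √d ≤ ‖z‖
    · rw [indicator_of_mem (by exact hz10)]
      exact (hfar z hz hz10).trans le_add_self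
    · refine le_trans ?_ le_self_add
      gcongr
      exact (not_le.1 hz10).le
  have hm : MeasurableSet {z : EuclideanSpace ℝ (Fin d) | 10 * √d ≤ ‖z‖} :=
    measurableSet_le measurable_const measurable_norm
  have htail : ∫⁻ z, ({z : EuclideanSpace ℝ (Fin d) | 10 * √d ≤ ‖z‖}).indicator (fun z =>
        ENNReal.ofReal (√d * q 0) * ENNReal.ofReal (rexp (-(0.18) * ‖z‖ ^ 2))) z ≤
      ENNReal.ofReal √d * ∫⁻ z, modelDensity Ω W q z := by
    rw [lintegral_indicator hm, lintegral_const_mul _ (by fun_prop)]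
    refine (mul_le_mul' le_rfl (setLIntegral_exp_neg_le_gaussZ 3 (a := 0.11) (by norm_num)
      (by positivity) (by norm_num))).trans ?_
    refine le_trans ?_ (mul_le_mul' le_rfl (h.massBound_le hd hR))
    rw [← ENNReal.ofReal_mul (by positivity), ← ENNReal.ofReal_mul (by positivity), massBound]
    refine ENNReal.ofReal_le_ofReal ?_
    have e : (10 * √(d : ℝ)) ^ 2 = 100 * d := by rw [mul_pow, hsd]; norm_num
    rw [e]
    have h1 : rexp (0.35 * (3 : ℕ) * d - 0.11 * (100 * d)) ≤ rexp (-(1.4 * d)) * (1 / 2) := by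
      have := exp_neg_le_half (x := 8 * (d : ℝ)) (by linarith)
      calc _ ≤ rexp (-(1.4 * d) + -(8 * d)) := exp_le_exp.2 (by push_cast; linarith)
        _ = rexp (-(1.4 * d)) * rexp (-(8 * d)) := exp_add _ _
        _ ≤ _ := by gcongr
    have hg := gaussZ_pos (d := d)
    calc √d * q 0 * (gaussZ d * rexp (0.35 * (3 : ℕ) * d - 0.11 * (100 * d)))
        ≤ √d * q 0 * (gaussZ d * (rexp (-(1.4 * d)) * (1 / 2))) := by gcongr
      _ = _ := by ring
  calc ∫⁻ z in Metric.ball 0 R, ENNReal.ofReal ‖z‖ * modelDensity Ω W q z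
      ≤ ∫⁻ z in Metric.ball 0 R, (ENNReal.ofReal (10 * √d) * modelDensity Ω W q z +
        ({z : EuclideanSpace ℝ (Fin d) | 10 * √d ≤ ‖z‖}).indicator (fun z =>
        ENNReal.ofReal (√d * q 0) * ENNReal.ofReal (rexp (-(0.18) * ‖z‖ ^ 2))) z) :=
        setLIntegral_mono' Metric.isOpen_ball.measurableSet hρB
    _ ≤ ∫⁻ z, (ENNReal.ofReal (10 * √d) * modelDensity Ω W q z +
        ({z : EuclideanSpace ℝ (Fin d) | 10 * √d ≤ ‖z‖}).indicator (fun z =>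
        ENNReal.ofReal (√d * q 0) * ENNReal.ofReal (rexp (-(0.18) * ‖z‖ ^ 2))) z) :=
        setLIntegral_le_lintegral _ _
    _ = ENNReal.ofReal (10 * √d) * (∫⁻ z, modelDensity Ω W q z) +
        ∫⁻ z, ({z : EuclideanSpace ℝ (Fin d) | 10 * √d ≤ ‖z‖}).indicator (fun z =>
        ENNReal.ofReal (√d * q 0) * ENNReal.ofReal (rexp (-(0.18) * ‖z‖ ^ 2))) z := by
        rw [lintegral_add_right _ ((by fun_prop : Measurable fun z : EuclideanSpace ℝ (Fin d) =>
          ENNReal.ofReal (√d * q 0) * ENNReal.ofReal (rexp (-(0.18) * ‖z‖ ^ 2))).indicator hm),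
          lintegral_const_mul' _ _ ENNReal.ofReal_ne_top]
    _ ≤ ENNReal.ofReal (10 * √d) * (∫⁻ z, modelDensity Ω W q z) +
        ENNReal.ofReal √d * ∫⁻ z, modelDensity Ω W q z := by gcongr
    _ = _ := by
        rw [← add_mul, ← ENNReal.ofReal_add (by positivity) (by positivity)]
        congr 2; ring

/-- On the sphere of radius r the function W is at least (1 - ε)r²/2 ≥ 0.3r². As W(0) = 0, convexity
along the ray extends this linearly beyond the ball, where nothing else is known about W. -/
lemma NearGaussian.linear_growth (h : NearGaussian Ω W q R ε L) (hconv : ConvexOn ℝ Ω W) {r : ℝ}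
    (hr : 0 < r) (hrR : r < R) {z : EuclideanSpace ℝ (Fin d)} (hz : z ∈ Ω) (hrz : r ≤ ‖z‖) :
    0.3 * (r * ‖z‖) ≤ W z := by
  have hz0 : 0 < ‖z‖ := hr.trans_le hrz
  set p := (r / ‖z‖) • z with hp
  have hpn : ‖p‖ = r := by
    rw [hp, norm_smul, Real.norm_of_nonneg (by positivity)]; field_simp
  have hpB : p ∈ Metric.ball 0 R := by rw [mem_ball_zero_iff, hpn]; exact hrR
  have h1 := (abs_le.1 (h.abs_W_sub_le hpB)).1
  rw [hpn] at h1
  have hle : r / ‖z‖ ≤ 1 := (div_le_one hz0).2 hrz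
  have h2 := hconv.2 hz (h.ball_subset (Metric.mem_ball_self h.R_pos))
    (show 0 ≤ r / ‖z‖ by positivity) (show 0 ≤ 1 - r / ‖z‖ by linarith) (by ring)
  rw [smul_zero, add_zero, h.W_zero, smul_zero, add_zero, smul_eq_mul, ← hp] at h2
  have h3 : ε * r ^ 2 ≤ 2 / 5 * r ^ 2 := by gcongr; exact h.ε_le
  have h4 : 0.3 * r ^ 2 ≤ r / ‖z‖ * W z := by linarith
  have h5 : ‖z‖ / r * (0.3 * r ^ 2) ≤ ‖z‖ / r * (r / ‖z‖ * W z) := by gcongr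
  have e1 : ‖z‖ / r * (0.3 * r ^ 2) = 0.3 * (r * ‖z‖) := by field_simp
  have e2 : ‖z‖ / r * (r / ‖z‖ * W z) = W z := by field_simp
  linarith

lemma two_pow_le_gaussZ : (2 : ℝ) ^ d ≤ gaussZ d := by
  have h1 : (2 : ℝ) ^ d = (4 : ℝ) ^ ((d : ℝ) / 2) := by
    rw [show (4 : ℝ) = 2 ^ (2 : ℝ) by norm_num, ← rpow_mul (by norm_num), ← rpow_natCast]
    congr 1; ring
  rw [h1, gaussZ]
  have := two_le_pi
  gcongr
  linarith

/-- Half of the linear growth yields e^{-0.15 r²}. The other half exceeds √d‖z‖ because 0.15·7 > 1,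
and e^{-√d‖z‖} has integral at most 2^d, which `gaussZ` dominates. -/
lemma NearGaussian.setLIntegral_outer_le (h : NearGaussian Ω W q R ε L) (hconv : ConvexOn ℝ Ω W)
    {r M : ℝ} (hr : 0 < r) (hrR : r < R) (hrd : 7 * √d ≤ r) (hM : ∀ z ∈ Ω, q z ≤ M)
    (hM0 : 0 ≤ M) :
    ∫⁻ z in {z | r ≤ ‖z‖}, modelDensity Ω W q z ≤
      ENNReal.ofReal (M * rexp (-(0.15 * r ^ 2)) * gaussZ d) := by
  have hm : MeasurableSet {z : EuclideanSpace ℝ (Fin d) | r ≤ ‖z‖} :=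
    measurableSet_le measurable_const measurable_norm
  calc ∫⁻ z in {z | r ≤ ‖z‖}, modelDensity Ω W q z
      ≤ ∫⁻ z in {z : EuclideanSpace ℝ (Fin d) | r ≤ ‖z‖},
        ENNReal.ofReal (M * rexp (-(0.15 * r ^ 2))) * ENNReal.ofReal (rexp (-(1 * √d) * ‖z‖)) := by
        refine setLIntegral_mono' hm fun z (hz : r ≤ ‖z‖) => ?_
        by_cases hzΩ : z ∈ Ω
        swap
        · simp [modelDensity, indicator_of_notMem hzΩ]
        rw [modelDensity, indicator_of_mem hzΩ, ← ENNReal.ofReal_mul (by positivity)]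
        refine ENNReal.ofReal_le_ofReal ?_
        have h1 := h.linear_growth hconv hr hrR hzΩ hz
        calc rexp (-W z) * q z ≤ rexp (-W z) * M := by gcongr; exact hM z hzΩ
          _ = M * rexp (-W z) := mul_comm _ _
          _ ≤ M * rexp (-(0.15 * r ^ 2) + -(1 * √d) * ‖z‖) := by
            refine mul_le_mul_of_nonneg_left (exp_le_exp.2 ?_) hM0
            have h2 : r * r ≤ r * ‖z‖ := by gcongr
            have h3 : 7 * √d * ‖z‖ ≤ r * ‖z‖ := by gcongr
            have h4 : 0 ≤ √d * ‖z‖ := by positivity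
            nlinarith
          _ = _ := by rw [exp_add]; ring
    _ ≤ ENNReal.ofReal (M * rexp (-(0.15 * r ^ 2))) * ENNReal.ofReal ((2 / 1) ^ d) := by
        rw [lintegral_const_mul _ (by fun_prop)]
        refine mul_le_mul' le_rfl ((setLIntegral_le_lintegral _ _).trans
          (lintegral_exp_neg_mul_norm_le one_pos))
    _ ≤ _ := by
        rw [← ENNReal.ofReal_mul (by positivity)]
        refine ENNReal.ofReal_le_ofReal ?_
        gcongr
        rw [div_one]
        exact two_pow_le_gaussZ

end NearGaussian

/-! ### Total variation between the model and the standard Gaussian. -/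

section ModelTotalVariation

open Set Filter Topology Real

variable {d : ℕ} {Ω : Set (EuclideanSpace ℝ (Fin d))} {W q : EuclideanSpace ℝ (Fin d) → ℝ}
  {R ε L s : ℝ}

/-- The logarithm of the density of the model with respect to the Gaussian. -/
noncomputable def logRatio (W q : EuclideanSpace ℝ (Fin d) → ℝ) (z : EuclideanSpace ℝ (Fin d)) :
    ℝ := ‖z‖ ^ 2 / 2 - W z + log (q z)

lemma NearGaussian.contDiffOn_logRatio (h : NearGaussian Ω W q R ε L) :
    ContDiffOn ℝ 1 (logRatio W q) (Metric.ball 0 R) :=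
  ((((contDiff_norm_sq ℝ).div_const 2).contDiffOn).sub h.W_contDiffOn).add
    (h.q_contDiffOn.log fun z hz => (h.q_pos z hz).ne')

lemma NearGaussian.norm_fderiv_logRatio_le (h : NearGaussian Ω W q R ε L)
    {z : EuclideanSpace ℝ (Fin d)} (hz : z ∈ Metric.ball 0 R) :
    ‖fderiv ℝ (logRatio W q) z‖ ≤ L + ε * ‖z‖ := by
  have hW : DifferentiableAt ℝ W z := (h.W_contDiffOn.differentiableOn one_ne_zero).differentiableAt
    (Metric.isOpen_ball.mem_nhds hz)
  have hq : DifferentiableAt ℝ (fun z => log (q z)) z :=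
    ((h.q_contDiffOn.differentiableOn one_ne_zero).differentiableAt
      (Metric.isOpen_ball.mem_nhds hz)).log (h.q_pos z hz).ne'
  have hn : HasFDerivAt (fun z : EuclideanSpace ℝ (Fin d) => ‖z‖ ^ 2 / 2) (innerSL ℝ z) z := by
    have := ((hasStrictFDerivAt_norm_sq z).hasFDerivAt).mul_const (1 / 2 : ℝ)
    refine (this.congr_of_eventuallyEq (Eventually.of_forall fun x => by ring)).congr_fderiv ?_
    ext w
    simp
  have hf := ((hn.sub hW.hasFDerivAt).add hq.hasFDerivAt).fderiv
  have e : logRatio W q = ((fun z : EuclideanSpace ℝ (Fin d) => ‖z‖ ^ 2 / 2) - W) +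
      fun z => log (q z) := rfl
  rw [e, hf]
  have h1 : ‖innerSL ℝ z - fderiv ℝ W z‖ ≤ ε * ‖z‖ := by
    refine ContinuousLinearMap.opNorm_le_bound _ (by have := h.ε_nonneg; positivity) fun w => ?_
    have := h.W_fderiv z hz w
    rw [abs_sub_comm] at this
    simpa using this
  have := norm_add_le (innerSL ℝ z - fderiv ℝ W z) (fderiv ℝ (fun z => log (q z)) z)
  linarith [h.q_fderiv z hz]

/-- The density of the model with respect to Lebesgue measure, divided by `e^{-‖z‖²/2}`. -/
noncomputable def gaussRatio (Ω : Set (EuclideanSpace ℝ (Fin d)))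
    (W q : EuclideanSpace ℝ (Fin d) → ℝ) (z : EuclideanSpace ℝ (Fin d)) : ℝ≥0∞ :=
  modelDensity Ω W q z * ENNReal.ofReal (rexp (1 / 2 * ‖z‖ ^ 2))

lemma NearGaussian.gaussRatio_eq (h : NearGaussian Ω W q R ε L) {z : EuclideanSpace ℝ (Fin d)}
    (hz : z ∈ Metric.ball 0 R) :
    gaussRatio Ω W q z = ENNReal.ofReal (rexp (logRatio W q z)) := by
  rw [gaussRatio, modelDensity, indicator_of_mem (h.ball_subset hz), ← ENNReal.ofReal_mul
    (mul_nonneg (exp_pos _).le (h.q_pos z hz).le), logRatio, exp_add, exp_log (h.q_pos z hz),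
    sub_eq_add_neg, exp_add]
  congr 1
  ring_nf

lemma gaussDensity_mul_gaussRatio (z : EuclideanSpace ℝ (Fin d)) :
    ENNReal.ofReal (gaussZ d) * (ENNReal.ofReal (gaussDensity z) * gaussRatio Ω W q z) =
      modelDensity Ω W q z := by
  have hg := gaussZ_pos (d := d)
  have e : ENNReal.ofReal (gaussZ d) * ENNReal.ofReal (gaussDensity z) *
      ENNReal.ofReal (rexp (1 / 2 * ‖z‖ ^ 2)) = 1 := by
    rw [← ENNReal.ofReal_mul hg.le, ← ENNReal.ofReal_mul (mul_nonneg hg.le (gaussDensity_nonneg z)),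
      gaussDensity, mul_inv_cancel_left₀ hg.ne', ← exp_add]
    simp
  calc _ = (ENNReal.ofReal (gaussZ d) * ENNReal.ofReal (gaussDensity z) *
      ENNReal.ofReal (rexp (1 / 2 * ‖z‖ ^ 2))) * modelDensity Ω W q z := by rw [gaussRatio]; ring
    _ = _ := by rw [e, one_mul]

lemma setLIntegral_gaussRatio (hρ : Measurable (modelDensity Ω W q))
    {f : EuclideanSpace ℝ (Fin d) → ℝ≥0∞} (hf : Measurable f)
    {A : Set (EuclideanSpace ℝ (Fin d))} (hA : MeasurableSet A) :
    ENNReal.ofReal (gaussZ d) * ∫⁻ z in A, f z * gaussRatio Ω W q z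
      ∂stdGaussian (EuclideanSpace ℝ (Fin d)) = ∫⁻ z in A, f z * modelDensity Ω W q z := by
  have hG : Measurable (gaussRatio Ω W q) := by unfold gaussRatio; fun_prop
  have hgd := measurable_gaussDensity (d := d)
  rw [lintegral_stdGaussian (f := fun z => f z * gaussRatio Ω W q z) (hf.mul hG) A hA, ← lintegral_const_mul _ (by fun_prop)]
  congr with z
  rw [← gaussDensity_mul_gaussRatio (Ω := Ω) (W := W) (q := q) z]
  ring

/-- The pair integral that controls the total variation distance on the small ball. -/
noncomputable def pairIntegral (W q : EuclideanSpace ℝ (Fin d) → ℝ) (R : ℝ) : ℝ≥0∞ :=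
  ∫⁻ x in Metric.ball 0 (R / √2), ∫⁻ y in Metric.ball 0 (R / √2),
    ‖rexp (logRatio W q y) - rexp (logRatio W q x)‖ₑ
      ∂stdGaussian (EuclideanSpace ℝ (Fin d)) ∂stdGaussian (EuclideanSpace ℝ (Fin d))

/-- The gradient of e^f, with f = `logRatio`, is at most (L + ε‖z‖)e^f, and integrating it against
the Gaussian gives a first moment of the model. The constant is 18 ≥ 11·1.6, with 1.6 ≥ π/2. -/
lemma NearGaussian.pairIntegral_le (h : NearGaussian Ω W q R ε L)
    (hρ : Measurable (modelDensity Ω W q)) (hd : 0 < d) (hR : 12 * √d ≤ R) :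
    ENNReal.ofReal (gaussZ d) * pairIntegral W q R ≤
      ENNReal.ofReal (18 * (L + ε * √d)) * ∫⁻ z, modelDensity Ω W q z := by
  have hB : MeasurableSet (Metric.ball (0 : EuclideanSpace ℝ (Fin d)) R) :=
    Metric.isOpen_ball.measurableSet
  have h1 := lintegral_enorm_sub_le h.contDiffOn_logRatio.exp
  have hε := h.ε_nonneg
  have hL := h.L_nonneg
  have h2 : ∫⁻ x in Metric.ball 0 R, ‖fderiv ℝ (fun x => rexp (logRatio W q x)) x‖ₑ
      ∂stdGaussian (EuclideanSpace ℝ (Fin d)) ≤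
      ∫⁻ x in Metric.ball 0 R, ENNReal.ofReal (L + ε * ‖x‖) * gaussRatio Ω W q x
        ∂stdGaussian (EuclideanSpace ℝ (Fin d)) := by
    refine setLIntegral_mono' hB fun x hx => ?_
    have hdiff : DifferentiableAt ℝ (logRatio W q) x :=
      (h.contDiffOn_logRatio.differentiableOn one_ne_zero).differentiableAt
        (Metric.isOpen_ball.mem_nhds hx)
    rw [hdiff.hasFDerivAt.exp.fderiv, h.gaussRatio_eq hx, enorm_smul,
      Real.enorm_eq_ofReal (exp_pos _).le, mul_comm]
    gcongr
    rw [← ofReal_norm]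
    exact ENNReal.ofReal_le_ofReal (h.norm_fderiv_logRatio_le hx)
  have h3 : ∫⁻ x in Metric.ball 0 R, ENNReal.ofReal (L + ε * ‖x‖) * modelDensity Ω W q x ≤
      ENNReal.ofReal (L + 11 * (ε * √d)) * ∫⁻ z, modelDensity Ω W q z := by
    calc ∫⁻ x in Metric.ball 0 R, ENNReal.ofReal (L + ε * ‖x‖) * modelDensity Ω W q x
        = ENNReal.ofReal L * (∫⁻ x in Metric.ball 0 R, modelDensity Ω W q x) +
          ENNReal.ofReal ε * ∫⁻ x in Metric.ball 0 R, ENNReal.ofReal ‖x‖ * modelDensity Ω W q x := by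
          rw [← lintegral_const_mul _ hρ, ← lintegral_const_mul _ (by fun_prop),
            ← lintegral_add_left (by fun_prop)]
          congr with x
          rw [ENNReal.ofReal_add hL (by positivity), ENNReal.ofReal_mul hε]
          ring
      _ ≤ ENNReal.ofReal L * (∫⁻ x, modelDensity Ω W q x) +
          ENNReal.ofReal ε * (ENNReal.ofReal (11 * √d) * ∫⁻ z, modelDensity Ω W q z) :=
          add_le_add (mul_le_mul' le_rfl (setLIntegral_le_lintegral _ _))
            (mul_le_mul' le_rfl (h.setLIntegral_norm_le hd hR))
      _ = _ := by
          rw [← mul_assoc, ← ENNReal.ofReal_mul hε, ← add_mul,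
            ← ENNReal.ofReal_add hL (by positivity)]
          congr 2; ring
  calc ENNReal.ofReal (gaussZ d) * pairIntegral W q R
      ≤ ENNReal.ofReal (gaussZ d) * (ENNReal.ofReal (π / 2) *
        ∫⁻ x in Metric.ball 0 R, ENNReal.ofReal (L + ε * ‖x‖) * gaussRatio Ω W q x
        ∂stdGaussian (EuclideanSpace ℝ (Fin d))) :=
        mul_le_mul' le_rfl (h1.trans (mul_le_mul' le_rfl h2))
    _ = ENNReal.ofReal (π / 2) * ∫⁻ x in Metric.ball 0 R, ENNReal.ofReal (L + ε * ‖x‖) *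
        modelDensity Ω W q x := by
        rw [← setLIntegral_gaussRatio hρ (by fun_prop) hB]; ring
    _ ≤ ENNReal.ofReal (π / 2) * (ENNReal.ofReal (L + 11 * (ε * √d)) *
        ∫⁻ z, modelDensity Ω W q z) := mul_le_mul' le_rfl h3
    _ ≤ _ := by
        rw [← mul_assoc, ← ENNReal.ofReal_mul (by positivity)]
        refine mul_le_mul' (ENNReal.ofReal_le_ofReal ?_) le_rfl
        have hp : π / 2 ≤ 1.6 := by linarith [pi_lt_d2]
        have h5 : 0 ≤ ε * √d := by positivity
        calc π / 2 * (L + 11 * (ε * √d)) ≤ 1.6 * (L + 11 * (ε * √d)) := by gcongr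
          _ ≤ _ := by linarith

/-- The difference of the two products is a double integral over A × A' of the density ratio at x
minus that at y, hence at most the pair integral. It is used with (A, B) and with (B, A) to get both
directions. -/
lemma NearGaussian.pair_le (h : NearGaussian Ω W q R ε L)
    (hρ : Measurable (modelDensity Ω W q)) {A A' : Set (EuclideanSpace ℝ (Fin d))}
    (hA : MeasurableSet A) (hA' : MeasurableSet A')
    (hAB : A ⊆ Metric.ball 0 (R / √2)) (hAB' : A' ⊆ Metric.ball 0 (R / √2)) :
    (∫⁻ z in A, modelDensity Ω W q z) * stdGaussian (EuclideanSpace ℝ (Fin d)) A' ≤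
      stdGaussian (EuclideanSpace ℝ (Fin d)) A * (∫⁻ z in A', modelDensity Ω W q z) +
        ENNReal.ofReal (gaussZ d) * pairIntegral W q R := by
  set γ := stdGaussian (EuclideanSpace ℝ (Fin d))
  have hG : Measurable (gaussRatio Ω W q) := by unfold gaussRatio; fun_prop
  have hsub : Metric.ball (0 : EuclideanSpace ℝ (Fin d)) (R / √2) ⊆ Metric.ball 0 R := by
    refine Metric.ball_subset_ball (div_le_self h.R_pos.le ?_)
    rw [one_le_sqrt]; norm_num
  have e : ∀ C : Set (EuclideanSpace ℝ (Fin d)), MeasurableSet C →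
      ∫⁻ z in C, modelDensity Ω W q z =
        ENNReal.ofReal (gaussZ d) * ∫⁻ z in C, gaussRatio Ω W q z ∂γ := by
    intro C hC
    have := setLIntegral_gaussRatio (f := fun _ => 1) hρ measurable_const hC
    simpa using this.symm
  rw [e A hA, e A' hA']
  have key : (∫⁻ z in A, gaussRatio Ω W q z ∂γ) * γ A' ≤
      γ A * (∫⁻ z in A', gaussRatio Ω W q z ∂γ) + pairIntegral W q R := by
    have hpt : ∀ x ∈ A, ∀ y ∈ A', gaussRatio Ω W q x ≤ gaussRatio Ω W q y +
        ‖rexp (logRatio W q y) - rexp (logRatio W q x)‖ₑ := by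
      intro x hx y hy
      rw [h.gaussRatio_eq (hsub (hAB hx)), h.gaussRatio_eq (hsub (hAB' hy)),
        Real.enorm_eq_ofReal_abs, ← ENNReal.ofReal_add (exp_pos _).le (abs_nonneg _)]
      refine ENNReal.ofReal_le_ofReal ?_
      have := neg_abs_le (rexp (logRatio W q y) - rexp (logRatio W q x))
      linarith
    calc (∫⁻ z in A, gaussRatio Ω W q z ∂γ) * γ A'
        = ∫⁻ x in A, ∫⁻ _y in A', gaussRatio Ω W q x ∂γ ∂γ := by
          simp only [setLIntegral_const]
          rw [lintegral_mul_const _ hG]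
      _ ≤ ∫⁻ x in A, ∫⁻ y in A', (gaussRatio Ω W q y +
          ‖rexp (logRatio W q y) - rexp (logRatio W q x)‖ₑ) ∂γ ∂γ :=
          setLIntegral_mono' hA fun x hx => setLIntegral_mono' hA' fun y hy => hpt x hx y hy
      _ = ∫⁻ x in A, ((∫⁻ y in A', gaussRatio Ω W q y ∂γ) +
          ∫⁻ y in A', ‖rexp (logRatio W q y) - rexp (logRatio W q x)‖ₑ ∂γ) ∂γ := by
          congr with x
          rw [lintegral_add_left hG]
      _ = γ A * (∫⁻ z in A', gaussRatio Ω W q z ∂γ) +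
          ∫⁻ x in A, ∫⁻ y in A', ‖rexp (logRatio W q y) - rexp (logRatio W q x)‖ₑ ∂γ ∂γ := by
          rw [lintegral_add_left measurable_const, setLIntegral_const, mul_comm]
      _ ≤ _ := by
          refine add_le_add le_rfl ?_
          exact (lintegral_mono fun x => lintegral_mono_set hAB').trans (lintegral_mono_set hAB)
  calc _ = ENNReal.ofReal (gaussZ d) * ((∫⁻ z in A, gaussRatio Ω W q z ∂γ) * γ A') := by ring
    _ ≤ ENNReal.ofReal (gaussZ d) * (γ A * (∫⁻ z in A', gaussRatio Ω W q z ∂γ) +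
        pairIntegral W q R) := mul_le_mul' le_rfl key
    _ = _ := by ring

/-- The probability measure with density proportional to `e^{-W} q` on `Ω`. -/
noncomputable def modelMeasure (Ω : Set (EuclideanSpace ℝ (Fin d)))
    (W q : EuclideanSpace ℝ (Fin d) → ℝ) : Measure (EuclideanSpace ℝ (Fin d)) :=
  (∫⁻ z, modelDensity Ω W q z)⁻¹ • volume.withDensity (modelDensity Ω W q)

lemma modelMeasure_apply {A : Set (EuclideanSpace ℝ (Fin d))} (hA : MeasurableSet A) :
    modelMeasure Ω W q A =
      (∫⁻ z, modelDensity Ω W q z)⁻¹ * ∫⁻ z in A, modelDensity Ω W q z := by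
  rw [modelMeasure, Measure.smul_apply, withDensity_apply _ hA, smul_eq_mul]

lemma NearGaussian.isProbabilityMeasure (h : NearGaussian Ω W q R ε L) (hd : 0 < d)
    (hR : 12 * √d ≤ R) (hfin : ∫⁻ z, modelDensity Ω W q z ≠ ∞) :
    IsProbabilityMeasure (modelMeasure Ω W q) := by
  constructor
  rw [modelMeasure_apply MeasurableSet.univ, setLIntegral_univ]
  refine ENNReal.inv_mul_cancel ?_ hfin
  have := h.massBound_le hd hR
  exact ((ENNReal.ofReal_pos.2 (massBound_pos h.q_zero_pos)).trans_le this).ne'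

/-- Beyond 7√d the linear growth of W applies, and inside that ball the density is bounded. -/
lemma NearGaussian.lintegral_ne_top (h : NearGaussian Ω W q R ε L) (hconv : ConvexOn ℝ Ω W)
    (hd : 0 < d) (hR : 12 * √d ≤ R) {M : ℝ} (hM : ∀ z ∈ Ω, q z ≤ M) :
    ∫⁻ z, modelDensity Ω W q z ≠ ∞ := by
  have hd1 : (1 : ℝ) ≤ d := by exact_mod_cast hd
  have hsd0 : 0 < √(d : ℝ) := sqrt_pos.2 (by linarith)
  have hq0 := h.q_zero_pos
  have hM0 : 0 ≤ M := hq0.le.trans (hM 0 (h.ball_subset (Metric.mem_ball_self h.R_pos)))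
  have h1 := h.setLIntegral_outer_le hconv (r := 7 * √d) (by positivity) (by linarith) le_rfl hM hM0
  have hm : MeasurableSet {z : EuclideanSpace ℝ (Fin d) | 7 * √d ≤ ‖z‖} :=
    measurableSet_le measurable_const measurable_norm
  rw [← lintegral_add_compl _ hm]
  refine ENNReal.add_ne_top.2 ⟨ne_top_of_le_ne_top ENNReal.ofReal_ne_top h1, ?_⟩
  have hsub : {z : EuclideanSpace ℝ (Fin d) | 7 * √d ≤ ‖z‖}ᶜ = Metric.ball 0 (7 * √d) := by
    ext z; simp
  rw [hsub]
  have h2 : ∫⁻ z in Metric.ball (0 : EuclideanSpace ℝ (Fin d)) (7 * √d), modelDensity Ω W q z ≤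
      ∫⁻ _z in Metric.ball (0 : EuclideanSpace ℝ (Fin d)) (7 * √d),
        ENNReal.ofReal (q 0 * rexp (L * (7 * √d))) := by
    refine setLIntegral_mono' Metric.isOpen_ball.measurableSet fun z hz => ?_
    have hz' : ‖z‖ < 7 * √d := by simpa using hz
    have hzR : z ∈ Metric.ball 0 R := by rw [mem_ball_zero_iff]; linarith
    rw [modelDensity, indicator_of_mem (h.ball_subset hzR)]
    refine ENNReal.ofReal_le_ofReal ((h.exp_mul_le hzR).trans ?_)
    gcongr
    have h3 : L * ‖z‖ ≤ L * (7 * √d) := mul_le_mul_of_nonneg_left hz'.le h.L_nonneg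
    have h4 : 0 ≤ (1 - ε) * ‖z‖ ^ 2 := mul_nonneg (by linarith [h.ε_le]) (by positivity)
    linarith
  refine ne_top_of_le_ne_top ?_ h2
  rw [setLIntegral_const]
  exact ENNReal.mul_ne_top ENNReal.ofReal_ne_top measure_ball_lt_top.ne

/-- In the application q₁ is the prior at θ₀, S the supremum of the prior relative to it, and q 0
the prior at the estimator. The hypothesis `hq0` pays for this change of reference point. -/
theorem NearGaussian.tv_modelMeasure_le (h : NearGaussian Ω W q R ε L) (hconv : ConvexOn ℝ Ω W)
    (hρ : Measurable (modelDensity Ω W q)) (hd : 0 < d) (hs : 12 ≤ s) (hRs : R = s * √d)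
    {S q₁ : ℝ} (hq₁ : 0 < q₁) (hS1 : 1 ≤ S) (hS : ∀ z ∈ Ω, q z ≤ S * q₁)
    (hq0 : q₁ * rexp (-(s * d / 6)) ≤ q 0) :
    tv (modelMeasure Ω W q) (stdGaussian (EuclideanSpace ℝ (Fin d))) ≤
      ENNReal.ofReal (20 * (L + ε * √d + S * rexp (-(d * (s / 12) ^ 2)))) := by
  have hd1 : (1 : ℝ) ≤ d := by exact_mod_cast hd
  have hsd : √(d : ℝ) ^ 2 = d := sq_sqrt (Nat.cast_nonneg d)
  have hsd0 : 0 < √(d : ℝ) := sqrt_pos.2 (by linarith)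
  have hR : 12 * √d ≤ R := by rw [hRs]; gcongr
  have hfin := h.lintegral_ne_top hconv hd hR hS
  have hprob := h.isProbabilityMeasure hd hR hfin
  set P := modelMeasure Ω W q
  set γ := stdGaussian (EuclideanSpace ℝ (Fin d))
  set r := R / √2 with hr
  set B := Metric.ball (0 : EuclideanSpace ℝ (Fin d)) r
  have hB : MeasurableSet B := Metric.isOpen_ball.measurableSet
  have h20 : (0 : ℝ) < √2 := by positivity
  have hr0 : 0 < r := div_pos h.R_pos h20
  have hr2 : r ^ 2 = s ^ 2 * d / 2 := by
    rw [hr, div_pow, sq_sqrt (by norm_num), hRs, mul_pow, hsd]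
  have hrR : r < R := by
    refine div_lt_self h.R_pos ?_
    rw [lt_sqrt] <;> norm_num
  have hrd : 7 * √d ≤ r := by
    rw [hr, le_div_iff₀ h20]
    have : √2 ≤ 1.5 := by
      rw [sqrt_le_left (by norm_num)]; norm_num
    nlinarith
  have hBc : Bᶜ = {z : EuclideanSpace ℝ (Fin d) | r ≤ ‖z‖} := by ext z; simp [B]
  set E := rexp (-(d * (s / 12) ^ 2)) with hE
  have hE0 : 0 < E := exp_pos _
  have hq00 := h.q_zero_pos
  have hg := gaussZ_pos (d := d)
  have hε := h.ε_nonneg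
  have hL := h.L_nonneg
  have hs2 : 12 * s ≤ s ^ 2 := by nlinarith
  have hds : 144 * (d : ℝ) ≤ s ^ 2 * d := by nlinarith
  have hds' : 12 * (s * d) ≤ s ^ 2 * d := by nlinarith
  have hP : P Bᶜ ≤ ENNReal.ofReal (2 * S * E) := by
    rw [modelMeasure_apply hB.compl]
    rw [hBc]
    refine ennreal_inv_mul_le (massBound_pos hq00)
      (h.setLIntegral_outer_le hconv hr0 hrR hrd hS (by positivity)) (h.massBound_le hd hR) ?_
    rw [massBound, hr2]
    -- For s ≥ 12 the exponent 0.075 s²d covers d(s/12)², the prior loss sd/6 and the mass loss 1.4d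
    -- together.
    have e1 : rexp (-(0.15 * (s ^ 2 * d / 2))) ≤ E * rexp (-(s * d / 6)) * rexp (-(1.4 * d)) := by
      rw [hE, ← exp_add, ← exp_add]
      refine exp_le_exp.2 ?_
      nlinarith
    calc S * q₁ * rexp (-(0.15 * (s ^ 2 * d / 2))) * gaussZ d
        ≤ S * q₁ * (E * rexp (-(s * d / 6)) * rexp (-(1.4 * d))) * gaussZ d := by gcongr
      _ = 2 * S * E * ((q₁ * rexp (-(s * d / 6))) * rexp (-(1.4 * d)) * (gaussZ d / 2)) := by ring
      _ ≤ _ := by gcongr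
  have hQ : γ Bᶜ ≤ ENNReal.ofReal E := by
    have h1 := setLIntegral_exp_neg_le_gaussZ (d := d) 1 (a := 1 / 4) (c := 1 / 2) (r := r)
      (by norm_num) hr0.le (by norm_num)
    have h2 : γ Bᶜ = ∫⁻ z in {z : EuclideanSpace ℝ (Fin d) | r ≤ ‖z‖},
        ENNReal.ofReal (gaussDensity z) := by
      rw [← hBc, show γ = _ from stdGaussian_eq_withDensity, withDensity_apply _ hB.compl]
    rw [h2]
    simp only [gaussDensity, ENNReal.ofReal_mul (inv_nonneg.2 hg.le)]
    rw [lintegral_const_mul _ (by fun_prop)]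
    refine (mul_le_mul' le_rfl h1).trans ?_
    rw [← ENNReal.ofReal_mul (inv_nonneg.2 hg.le), inv_mul_cancel_left₀ hg.ne', hE, hr2]
    refine ENNReal.ofReal_le_ofReal (exp_le_exp.2 ?_)
    push_cast
    nlinarith
  have hD : (∫⁻ z, modelDensity Ω W q z)⁻¹ * (ENNReal.ofReal (gaussZ d) * pairIntegral W q R) ≤
      ENNReal.ofReal (18 * (L + ε * √d)) := by
    refine (mul_le_mul' le_rfl (h.pairIntegral_le hρ hd hR)).trans ?_
    rw [mul_comm, mul_assoc, ENNReal.mul_inv_cancel ?_ hfin, mul_one]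
    exact ((ENNReal.ofReal_pos.2 (massBound_pos hq00)).trans_le (h.massBound_le hd hR)).ne'
  refine (tv_le_of_local hB (D := 18 * (L + ε * √d)) (p := 2 * S * E) (q := E)
    (by positivity) (by positivity) hE0.le ?_ ?_ hP hQ).trans (ENNReal.ofReal_le_ofReal ?_)
  · intro A hAB hA
    rw [modelMeasure_apply hA, modelMeasure_apply hB]
    calc _ = (∫⁻ z, modelDensity Ω W q z)⁻¹ * ((∫⁻ z in A, modelDensity Ω W q z) * γ B) := by ring
      _ ≤ (∫⁻ z, modelDensity Ω W q z)⁻¹ * (γ A * (∫⁻ z in B, modelDensity Ω W q z) +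
          ENNReal.ofReal (gaussZ d) * pairIntegral W q R) :=
          mul_le_mul' le_rfl (h.pair_le hρ hA hB hAB le_rfl)
      _ = γ A * ((∫⁻ z, modelDensity Ω W q z)⁻¹ * ∫⁻ z in B, modelDensity Ω W q z) +
          (∫⁻ z, modelDensity Ω W q z)⁻¹ * (ENNReal.ofReal (gaussZ d) * pairIntegral W q R) := by
          ring
      _ ≤ _ := add_le_add le_rfl hD
  · intro A hAB hA
    rw [modelMeasure_apply hA, modelMeasure_apply hB]
    calc _ = (∫⁻ z, modelDensity Ω W q z)⁻¹ * ((∫⁻ z in B, modelDensity Ω W q z) * γ A) := by ring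
      _ ≤ (∫⁻ z, modelDensity Ω W q z)⁻¹ * (γ B * (∫⁻ z in A, modelDensity Ω W q z) +
          ENNReal.ofReal (gaussZ d) * pairIntegral W q R) :=
          mul_le_mul' le_rfl (h.pair_le hρ hB hA le_rfl hAB)
      _ = ((∫⁻ z, modelDensity Ω W q z)⁻¹ * ∫⁻ z in A, modelDensity Ω W q z) * γ B +
          (∫⁻ z, modelDensity Ω W q z)⁻¹ * (ENNReal.ofReal (gaussZ d) * pairIntegral W q R) := by
          ring
      _ ≤ _ := add_le_add le_rfl hD
  · have : 0 ≤ ε * √d := by positivity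
    nlinarith

end ModelTotalVariation

/-! ### Whitened coordinates and control of the Hessian. -/

section Whitening

open scoped MatrixOrder

variable {d n : ℕ} {μ : Measure (EuclideanSpace ℝ (Fin d))} {θ θ₀ : EuclideanSpace ℝ (Fin d)}

/-- `T` is the symmetric square root of `(n F(θ₀))⁻¹`. -/
structure Whitens (n : ℕ) (μ : Measure (EuclideanSpace ℝ (Fin d)))
    (θ₀ : EuclideanSpace ℝ (Fin d))
    (T : EuclideanSpace ℝ (Fin d) ≃L[ℝ] EuclideanSpace ℝ (Fin d)) : Prop where
  symm_inner : ∀ z w, (inner ℝ (T z) w : ℝ) = inner ℝ z (T w)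
  cov : ∀ z w, n * covForm μ θ₀ (T z) (T w) = inner ℝ z w

lemma posDef_fisher (hμ : IsRegularMinimal μ) (h0 : μ ≠ 0) (hθ : θ ∈ natDomain μ) :
    (fisher μ θ).PosDef := by
  refine Matrix.PosDef.of_dotProduct_mulVec_pos ?_ fun x hx => ?_
  · ext i j
    simp only [Matrix.conjTranspose_apply, fisher, Matrix.of_apply, star_trivial]
    exact covariance_comm _ _
  · have := dotProduct_fisher hμ h0 hθ (WithLp.toLp 2 x) (WithLp.toLp 2 x)
    simp only [star_trivial]
    rw [this]
    exact covForm_self_pos hμ h0 hθ (by simpa using hx)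

lemma exists_whitens (hμ : IsRegularMinimal μ) (h0 : μ ≠ 0) (hθ : θ₀ ∈ natDomain μ) (hn : 0 < n) :
    ∃ T : EuclideanSpace ℝ (Fin d) ≃L[ℝ] EuclideanSpace ℝ (Fin d), Whitens n μ θ₀ T ∧
      ∀ η, multivariateGaussian η ((n : ℝ) • fisher μ θ₀)⁻¹ =
        (stdGaussian (EuclideanSpace ℝ (Fin d))).map fun x => η + T x := by
  set F := (n : ℝ) • fisher μ θ₀ with hF
  have hFp : F.PosDef := (posDef_fisher hμ h0 hθ).smul (by positivity)
  have hS : (F⁻¹).PosSemidef := hFp.inv.posSemidef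
  -- With A² = F⁻¹, the product A F inverts A, so no square root of F itself is needed.
  set A := CFC.sqrt F⁻¹ with hA
  have hAA : A * A = F⁻¹ := CFC.sqrt_mul_sqrt_self _ hS.nonneg
  have hdet : IsUnit F.det := (Matrix.isUnit_iff_isUnit_det _).1 hFp.isUnit
  have h1 : A * (A * F) = 1 := by
    rw [← mul_assoc, hAA, Matrix.nonsing_inv_mul _ hdet]
  have h2 : (A * F) * A = 1 := mul_eq_one_comm.1 h1
  have hsa : IsSelfAdjoint A := (CFC.sqrt_nonneg F⁻¹).isSelfAdjoint
  have hsT : IsSelfAdjoint (Matrix.toEuclideanCLM (𝕜 := ℝ) A) := hsa.map _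
  have hcomp : ∀ M N : Matrix (Fin d) (Fin d) ℝ, M * N = 1 → ∀ x,
      Matrix.toEuclideanCLM (𝕜 := ℝ) M (Matrix.toEuclideanCLM (𝕜 := ℝ) N x) = x := by
    intro M N h x
    have := map_mul (Matrix.toEuclideanCLM (n := Fin d) (𝕜 := ℝ)) M N
    rw [h, map_one] at this
    exact (DFunLike.congr_fun this x).symm
  let T : EuclideanSpace ℝ (Fin d) ≃L[ℝ] EuclideanSpace ℝ (Fin d) :=
    ContinuousLinearEquiv.equivOfInverse (Matrix.toEuclideanCLM (𝕜 := ℝ) A)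
      (Matrix.toEuclideanCLM (𝕜 := ℝ) (A * F)) (hcomp _ _ h2) (hcomp _ _ h1)
  have hT : ∀ x, T x = Matrix.toEuclideanCLM (𝕜 := ℝ) A x := fun x => rfl
  have hsymm : ∀ z w, (inner ℝ (T z) w : ℝ) = inner ℝ z (T w) := by
    intro z w
    rw [hT, hT]
    exact hsT.isSymmetric z w
  -- `multivariateGaussian` is by definition the image of the standard Gaussian under this square
  -- root followed by a shift.
  refine ⟨T, ⟨hsymm, fun z w => ?_⟩, fun η => rfl⟩
  have h3 : n * covForm μ θ₀ (T z) (T w) =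
      inner ℝ (T z) (Matrix.toEuclideanCLM (𝕜 := ℝ) F (T w)) := by
    rw [← dotProduct_fisher hμ h0 hθ, Matrix.inner_toEuclideanCLM]
    simp [hF, Matrix.smul_mulVec]
  rw [h3, hsymm, hT, hT]
  congr 1
  have h4 : A * F * A = 1 := h2
  have e := map_mul (Matrix.toEuclideanCLM (n := Fin d) (𝕜 := ℝ)) A F
  have e2 := DFunLike.congr_fun e (Matrix.toEuclideanCLM (𝕜 := ℝ) A w)
  rw [hcomp _ _ h2] at e2
  exact e2.symm

namespace Whitens

variable {T : EuclideanSpace ℝ (Fin d) ≃L[ℝ] EuclideanSpace ℝ (Fin d)}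

lemma vecNorm_map (hT : Whitens n μ θ₀ T) (hμ : IsRegularMinimal μ) (h0 : μ ≠ 0)
    (hθ : θ₀ ∈ natDomain μ) (hn : 0 < n) (z : EuclideanSpace ℝ (Fin d)) :
    vecNorm (fisher μ θ₀) (T z) = ‖z‖ / √n := by
  have hn' : (0 : ℝ) < n := by exact_mod_cast hn
  rw [vecNorm, dotProduct_fisher hμ h0 hθ]
  have := hT.cov z z
  rw [real_inner_self_eq_norm_sq] at this
  rw [show covForm μ θ₀ (T z) (T z) = ‖z‖ ^ 2 / n by rw [← this]; field_simp,
    Real.sqrt_div (by positivity), Real.sqrt_sq (norm_nonneg _)]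

lemma mem_nbhd_iff (hT : Whitens n μ θ₀ T) (hμ : IsRegularMinimal μ) (h0 : μ ≠ 0)
    (hθ : θ₀ ∈ natDomain μ) (hn : 0 < n) (s : ℝ) (z : EuclideanSpace ℝ (Fin d)) :
    θ₀ + T z ∈ nbhd n μ θ₀ s ↔ ‖z‖ ≤ s * √d := by
  have hn' : (0 : ℝ) < √n := by positivity
  rw [nbhd, Set.mem_ofPred_eq, add_sub_cancel_left, hT.vecNorm_map hμ h0 hθ hn,
    Real.sqrt_div (by positivity), ← mul_div_assoc, div_le_div_iff_of_pos_right hn']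

/-- A bound on a form over the unit sphere of `|·|_{F*}`, in whitened coordinates. -/
lemma le_of_formNorm_le (hT : Whitens n μ θ₀ T) (hμ : IsRegularMinimal μ) (h0 : μ ≠ 0)
    (hθ : θ₀ ∈ natDomain μ) (hn : 0 < n) {S : EuclideanSpace ℝ (Fin d) → ℝ} {K : ℝ} (hK : 0 ≤ K)
    (hS : formNorm (fisher μ θ₀) S ≤ ENNReal.ofReal K) {z : EuclideanSpace ℝ (Fin d)}
    (hz : ‖z‖ = 1) : S (√n • T z) ≤ K := by
  have hn' : (0 : ℝ) < √n := by positivity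
  have h1 : vecNorm (fisher μ θ₀) (√n • T z) = 1 := by
    rw [← map_smul, hT.vecNorm_map hμ h0 hθ hn, norm_smul, hz, mul_one, Real.norm_eq_abs,
      abs_of_pos hn', div_self hn'.ne']
  exact (ENNReal.ofReal_le_ofReal_iff hK).1 ((le_iSup₂ (f := fun u _ => ENNReal.ofReal (S u))
    (√n • T z) h1).trans hS)

/-- The n observations contribute n, while whitening contributes n^{-3/2} through the cube: the net
n^{-1/2} is the rate in the theorem. The bound is two-sided because the form is odd and u may be
replaced by -u. -/
lemma abs_thirdMoment_le (hT : Whitens n μ θ₀ T) (hμ : IsRegularMinimal μ) (h0 : μ ≠ 0)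
    (hθ₀ : θ₀ ∈ natDomain μ) (hθ : θ ∈ natDomain μ) (hn : 0 < n) {K : ℝ} (hK : 0 ≤ K)
    (hS : formNorm (fisher μ θ₀) (thirdMoment μ θ) ≤ ENNReal.ofReal K)
    (u : EuclideanSpace ℝ (Fin d)) :
    n * |thirdMoment μ θ (T u)| ≤ K / √n * ‖u‖ ^ 3 := by
  have hn' : (0 : ℝ) < √n := by positivity
  have hnn : (n : ℝ) = √n ^ 2 := (Real.sq_sqrt (by positivity)).symm
  rcases eq_or_ne u 0 with rfl | hu
  · have := thirdMoment_smul hμ h0 hθ 0 (T 0)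
    rw [zero_smul] at this
    rw [map_zero, this]
    simp
  have hu' : ‖u‖ ≠ 0 := norm_ne_zero_iff.2 hu
  have hle : ∀ c : ℝ, |c| = ‖u‖⁻¹ → (√n * c) ^ 3 * thirdMoment μ θ (T u) ≤ K := by
    intro c hc
    have h1 : ‖c • u‖ = 1 := by rw [norm_smul, Real.norm_eq_abs, hc, inv_mul_cancel₀ hu']
    have h2 := hT.le_of_formNorm_le hμ h0 hθ₀ hn hK hS h1
    rwa [map_smul, smul_smul, thirdMoment_smul hμ h0 hθ] at h2
  have e1 := hle ‖u‖⁻¹ (abs_of_nonneg (by positivity))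
  have e2 := hle (-‖u‖⁻¹) (by rw [abs_neg, abs_of_nonneg (by positivity)])
  have e3 : (√n * ‖u‖⁻¹) ^ 3 * |thirdMoment μ θ (T u)| ≤ K := by
    rcases abs_cases (thirdMoment μ θ (T u)) with ⟨h, -⟩ | ⟨h, -⟩ <;> rw [h]
    · exact e1
    · refine le_trans (le_of_eq ?_) e2
      ring
  calc n * |thirdMoment μ θ (T u)|
      = (√n * ‖u‖⁻¹) ^ 3 * |thirdMoment μ θ (T u)| * (‖u‖ ^ 3 / √n) := by
        field_simp; rw [← hnn]; ring
    _ ≤ K * (‖u‖ ^ 3 / √n) := by gcongr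
    _ = _ := by ring

end Whitens

lemma cubicForm_smul (c e : ℝ) (u w : EuclideanSpace ℝ (Fin d)) :
    cubicForm μ θ (c • u) (c • u) (e • w) = c ^ 2 * e * cubicForm μ θ u u w := by
  rw [cubicForm, cubicForm, ← integral_const_mul]
  congr with y
  simp only [inner_smul_left, conj_trivial]
  ring

/-- For unit vectors, ‖u + w‖³ + ‖u - w‖³ ≤ 2(‖u + w‖² + ‖u - w‖²) = 8, so polarization gives (8 +
2)/6 = 5/3. -/
lemma Whitens.abs_cubicForm_le {T : EuclideanSpace ℝ (Fin d) ≃L[ℝ] EuclideanSpace ℝ (Fin d)}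
    (hμ : IsRegularMinimal μ) (h0 : μ ≠ 0) (hθ : θ ∈ natDomain μ) {a : ℝ}
    (h3 : ∀ u, n * |thirdMoment μ θ (T u)| ≤ a * ‖u‖ ^ 3) (u w : EuclideanSpace ℝ (Fin d)) :
    n * |cubicForm μ θ (T u) (T u) (T w)| ≤ 5 / 3 * a * (‖u‖ ^ 2 * ‖w‖) := by
  have key : ∀ u w : EuclideanSpace ℝ (Fin d), ‖u‖ = 1 → ‖w‖ = 1 →
      n * |cubicForm μ θ (T u) (T u) (T w)| ≤ 5 / 3 * a := by
    intro u w hu hw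
    have ha : 0 ≤ a := by
      have := h3 u
      rw [hu] at this
      nlinarith [mul_nonneg (Nat.cast_nonneg (α := ℝ) n) (abs_nonneg (thirdMoment μ θ (T u)))]
    have e := cubicForm_polarization hμ h0 hθ (T u) (T w)
    rw [← map_add, ← map_sub] at e
    have e1 := h3 (u + w)
    have e2 := h3 (u - w)
    have e3 := h3 w
    rw [hw] at e3
    have par := parallelogram_law_with_norm ℝ u w
    rw [hu, hw] at par
    have n1 : ‖u + w‖ ≤ 2 := (norm_add_le _ _).trans (by rw [hu, hw]; norm_num)
    have n2 : ‖u - w‖ ≤ 2 := (norm_sub_le _ _).trans (by rw [hu, hw]; norm_num)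
    have n3 : ‖u + w‖ ^ 3 + ‖u - w‖ ^ 3 ≤ 8 := by
      nlinarith [mul_le_mul_of_nonneg_left n1 (sq_nonneg ‖u + w‖),
        mul_le_mul_of_nonneg_left n2 (sq_nonneg ‖u - w‖)]
    have n4 : a * (‖u + w‖ ^ 3 + ‖u - w‖ ^ 3) ≤ a * 8 := by gcongr
    have e4 : 6 * |cubicForm μ θ (T u) (T u) (T w)| ≤ |thirdMoment μ θ (T (u + w))| +
        |thirdMoment μ θ (T (u - w))| + 2 * |thirdMoment μ θ (T w)| := by
      rw [show 6 * |cubicForm μ θ (T u) (T u) (T w)| = |6 * cubicForm μ θ (T u) (T u) (T w)| by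
        rw [abs_mul]; norm_num, e]
      refine (abs_sub _ _).trans (add_le_add (abs_sub _ _) (le_of_eq ?_))
      rw [abs_mul]; norm_num
    have e5 := mul_le_mul_of_nonneg_left e4 (Nat.cast_nonneg (α := ℝ) n)
    linarith
  rcases eq_or_ne u 0 with rfl | hu
  · simp [cubicForm]
  rcases eq_or_ne w 0 with rfl | hw
  · simp [cubicForm]
  have hu' : ‖u‖ ≠ 0 := norm_ne_zero_iff.2 hu
  have hw' : ‖w‖ ≠ 0 := norm_ne_zero_iff.2 hw
  have := key (‖u‖⁻¹ • u) (‖w‖⁻¹ • w) (norm_smul_inv_norm hu) (norm_smul_inv_norm hw)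
  rw [map_smul, map_smul, cubicForm_smul, abs_mul, abs_of_nonneg (by positivity)] at this
  calc n * |cubicForm μ θ (T u) (T u) (T w)|
      = n * (‖u‖⁻¹ ^ 2 * ‖w‖⁻¹ * |cubicForm μ θ (T u) (T u) (T w)|) * (‖u‖ ^ 2 * ‖w‖) := by
        field_simp
    _ ≤ _ := by gcongr

/-- In whitened coordinates the Fisher information is close to the identity. -/
structure HessianNear (n : ℕ) (μ : Measure (EuclideanSpace ℝ (Fin d)))
    (θ₀ : EuclideanSpace ℝ (Fin d))
    (T : EuclideanSpace ℝ (Fin d) ≃L[ℝ] EuclideanSpace ℝ (Fin d)) (b ρ : ℝ) : Prop where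
  mem : ∀ v, ‖v‖ ≤ ρ → θ₀ + T v ∈ natDomain μ
  bound : ∀ v, ‖v‖ ≤ ρ → ∀ u w,
    |n * covForm μ (θ₀ + T v) (T u) (T w) - inner ℝ u w| ≤ b * ‖v‖ * ‖u‖ * ‖w‖

lemma Whitens.hessianNear {T : EuclideanSpace ℝ (Fin d) ≃L[ℝ] EuclideanSpace ℝ (Fin d)}
    (hT : Whitens n μ θ₀ T) (hμ : IsRegularMinimal μ) (h0 : μ ≠ 0) {a ρ : ℝ}
    (hmem : ∀ v, ‖v‖ ≤ ρ → θ₀ + T v ∈ natDomain μ)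
    (h3 : ∀ v, ‖v‖ ≤ ρ → ∀ u, n * |thirdMoment μ (θ₀ + T v) (T u)| ≤ a * ‖u‖ ^ 3) :
    HessianNear n μ θ₀ T (5 / 3 * a) ρ := by
  refine ⟨hmem, fun v hv => ?_⟩
  have hn0 : (0 : ℝ) ≤ n := Nat.cast_nonneg _
  have hmt : ∀ t ∈ Set.Icc (0 : ℝ) 1, ‖t • v‖ ≤ ρ := fun t ht => by
    rw [norm_smul, Real.norm_eq_abs, abs_of_nonneg ht.1]
    nlinarith [ht.2, norm_nonneg v]
  -- Along the segment from θ₀ the derivative of the variance in direction u is a cubic form with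
  -- two equal arguments, so only the diagonal is treated by the mean value inequality.
  have diag : ∀ u, |n * covForm μ (θ₀ + T v) (T u) (T u) - inner ℝ u u| ≤
      5 / 3 * a * ‖v‖ * ‖u‖ ^ 2 := by
    intro u
    have hd : ∀ t ∈ Set.Icc (0 : ℝ) 1, HasDerivWithinAt
        (fun t : ℝ => n * covForm μ (θ₀ + t • T v) (T u) (T u))
        (n * cubicForm μ (θ₀ + t • T v) (T u) (T u) (T v)) (Set.Icc 0 1) t := fun t ht => by
      have hm := hmem _ (hmt t ht)
      rw [map_smul] at hm
      exact ((hasDerivAt_covForm hμ h0 hm (T u)).const_mul (n : ℝ)).hasDerivWithinAt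
    have := norm_image_sub_le_of_norm_deriv_le_segment_01' hd
      (C := 5 / 3 * a * (‖u‖ ^ 2 * ‖v‖)) fun t ht => by
        have ht' := Set.Ico_subset_Icc_self ht
        have hm := hmem _ (hmt t ht')
        have hb := abs_cubicForm_le hμ h0 hm (h3 _ (hmt t ht')) u v
        rw [map_smul] at hb
        rwa [Real.norm_eq_abs, abs_mul, abs_of_nonneg hn0]
    simp only [one_smul, zero_smul, add_zero, hT.cov, Real.norm_eq_abs] at this
    exact this.trans (le_of_eq (by ring))
  have hm := hmem v hv
  set c := 5 / 3 * a * ‖v‖ with hc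
  set D : EuclideanSpace ℝ (Fin d) → EuclideanSpace ℝ (Fin d) → ℝ := fun u w =>
    n * covForm μ (θ₀ + T v) (T u) (T w) - inner ℝ u w with hD
  -- Polarization of the symmetric form D and the parallelogram law pass from the diagonal to all
  -- pairs with the same constant.
  have key : ∀ u w : EuclideanSpace ℝ (Fin d), ‖u‖ = 1 → ‖w‖ = 1 → |D u w| ≤ c := by
    intro u w hu hw
    have e : 4 * D u w = D (u + w) (u + w) - D (u - w) (u - w) := by
      have a1 : ∀ x y z : EuclideanSpace ℝ (Fin d), D (x + y) z = D x z + D y z := fun x y z => by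
        simp only [hD, map_add, covForm_add_left hμ h0 hm, inner_add_left]; ring
      have a2 : ∀ x y : EuclideanSpace ℝ (Fin d), D x y = D y x := fun x y => by
        simp only [hD]; rw [covForm_comm, real_inner_comm]
      have a3 : ∀ x z : EuclideanSpace ℝ (Fin d), D (-x) z = -D x z := fun x z => by
        have := covForm_smul_left (μ := μ) (θ := θ₀ + T v) (-1) (T x) (T z)
        simp only [neg_smul, one_smul] at this
        simp only [hD, map_neg, inner_neg_left, this]; ring
      have a4 : ∀ x y : EuclideanSpace ℝ (Fin d), D (x + y) (x + y) =
          D x x + 2 * D x y + D y y := fun x y => by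
        rw [a1, a2 x (x + y), a2 y (x + y), a1, a1, a2 y x]; ring
      rw [sub_eq_add_neg u w, a4, a4, a2 u (-w), a3, a2 w u, a3, a2 w (-w), a3]
      ring
    have par := parallelogram_law_with_norm ℝ u w
    rw [hu, hw] at par
    have d1 := abs_le.1 (diag (u + w))
    have d2 := abs_le.1 (diag (u - w))
    have par2 : c * ‖u + w‖ ^ 2 + c * ‖u - w‖ ^ 2 = 4 * c := by
      rw [← mul_add]
      linear_combination c * par
    rw [abs_le]
    simp only [hD] at e ⊢
    constructor <;> nlinarith
  intro u w
  rcases eq_or_ne u 0 with rfl | hu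
  · simp [covForm]
  rcases eq_or_ne w 0 with rfl | hw
  · simp [covForm]
  have hu' : ‖u‖ ≠ 0 := norm_ne_zero_iff.2 hu
  have hw' : ‖w‖ ≠ 0 := norm_ne_zero_iff.2 hw
  have := key (‖u‖⁻¹ • u) (‖w‖⁻¹ • w) (norm_smul_inv_norm hu) (norm_smul_inv_norm hw)
  have e : D (‖u‖⁻¹ • u) (‖w‖⁻¹ • w) = ‖u‖⁻¹ * ‖w‖⁻¹ * D u w := by
    simp only [hD, map_smul, inner_smul_left, inner_smul_right, covForm_smul_left, conj_trivial]
    rw [covForm_comm (T u), covForm_smul_left, covForm_comm (T w)]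
    ring
  rw [e, abs_mul, abs_of_nonneg (by positivity)] at this
  calc |D u w| = ‖u‖⁻¹ * ‖w‖⁻¹ * |D u w| * (‖u‖ * ‖w‖) := by field_simp
    _ ≤ c * (‖u‖ * ‖w‖) := by gcongr
    _ = _ := by ring

end Whitening

/-! ### Concentration of the score. -/

section Concentration

variable {d n : ℕ} {μ : Measure (EuclideanSpace ℝ (Fin d))} {θ θ₀ : EuclideanSpace ℝ (Fin d)}

lemma monotoneOn_Icc_of_hasDerivAt {f f' : ℝ → ℝ}
    (hf : ∀ t ∈ Set.Icc (0 : ℝ) 1, HasDerivAt f (f' t) t)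
    (hf' : ∀ t ∈ Set.Icc (0 : ℝ) 1, 0 ≤ f' t) : MonotoneOn f (Set.Icc 0 1) :=
  monotoneOn_of_hasDerivWithinAt_nonneg (convex_Icc 0 1)
    (fun t ht => (hf t ht).continuousAt.continuousWithinAt)
    (fun t ht => (hf t (interior_subset ht)).hasDerivWithinAt)
    fun t ht => hf' t (interior_subset ht)

/-- Taylor's inequality of order two. -/
lemma sub_le_of_second_deriv_le {f f' f'' : ℝ → ℝ} {c : ℝ}
    (h1 : ∀ t ∈ Set.Icc (0 : ℝ) 1, HasDerivAt f (f' t) t)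
    (h2 : ∀ t ∈ Set.Icc (0 : ℝ) 1, HasDerivAt f' (f'' t) t)
    (hb : ∀ t ∈ Set.Icc (0 : ℝ) 1, f'' t ≤ c) : f 1 - f 0 - f' 0 ≤ c / 2 := by
  have hm1 := monotoneOn_Icc_of_hasDerivAt (f := fun t => c * t - f' t)
    (f' := fun t => c - f'' t)
    (fun t ht => by
      have := ((hasDerivAt_id t).const_mul c).sub (h2 t ht)
      rw [mul_one] at this
      exact this)
    fun t ht => sub_nonneg.2 (hb t ht)
  have hm2 := monotoneOn_Icc_of_hasDerivAt (f := fun t => f' 0 * t + c / 2 * t ^ 2 - f t)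
    (f' := fun t => f' 0 + c * t - f' t)
    (fun t ht => by
      have := (((hasDerivAt_id t).const_mul (f' 0)).add
        (((hasDerivAt_id t).pow 2).const_mul (c / 2))).sub (h1 t ht)
      convert! this using 1
      simp; ring)
    fun t ht => by
      have := hm1 ⟨le_rfl, zero_le_one⟩ ht ht.1
      simp only at this
      linarith
  have := hm2 (Set.left_mem_Icc.2 zero_le_one) (Set.right_mem_Icc.2 zero_le_one) zero_le_one
  norm_num at this
  linarith

lemma HessianNear.covForm_le
    {T : EuclideanSpace ℝ (Fin d) ≃L[ℝ] EuclideanSpace ℝ (Fin d)} {b ρ : ℝ}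
    (h : HessianNear n μ θ₀ T b ρ) (hb : 0 ≤ b) (hbρ : b * ρ ≤ 2 / 5)
    {v : EuclideanSpace ℝ (Fin d)} (hv : ‖v‖ ≤ ρ) (u : EuclideanSpace ℝ (Fin d)) :
    n * covForm μ (θ₀ + T v) (T u) (T u) ≤ 7 / 5 * ‖u‖ ^ 2 := by
  have h1 := (abs_le.1 (h.bound v hv u u)).2
  rw [real_inner_self_eq_norm_sq] at h1
  have h2 : b * ‖v‖ ≤ 2 / 5 := (mul_le_mul_of_nonneg_left hv hb).trans hbρ
  nlinarith [mul_le_mul_of_nonneg_right h2 (sq_nonneg ‖u‖)]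

/-- Second-order Taylor expansion with Hessian at most 1 + 2/5. The left side is the cumulant
generating function of the whitened score, so this is a local sub-Gaussian bound. -/
lemma HessianNear.logPartition_sub_le
    {T : EuclideanSpace ℝ (Fin d) ≃L[ℝ] EuclideanSpace ℝ (Fin d)} {b ρ : ℝ}
    (h : HessianNear n μ θ₀ T b ρ) (hμ : IsRegularMinimal μ) (h0 : μ ≠ 0)
    (hb : 0 ≤ b) (hbρ : b * ρ ≤ 2 / 5)
    {v : EuclideanSpace ℝ (Fin d)} (hv : ‖v‖ ≤ ρ) :
    n * (logPartition μ (θ₀ + T v) - logPartition μ θ₀ - inner ℝ (T v) (mean μ θ₀)) ≤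
      7 / 10 * ‖v‖ ^ 2 := by
  have hn0 : (0 : ℝ) ≤ n := Nat.cast_nonneg _
  have hmt : ∀ t ∈ Set.Icc (0 : ℝ) 1, ‖t • v‖ ≤ ρ := fun t ht => by
    rw [norm_smul, Real.norm_eq_abs, abs_of_nonneg ht.1]
    nlinarith [ht.2, norm_nonneg v]
  have hm : ∀ t ∈ Set.Icc (0 : ℝ) 1, θ₀ + t • T v ∈ natDomain μ := fun t ht => by
    rw [← map_smul]; exact h.mem _ (hmt t ht)
  have := sub_le_of_second_deriv_le (f := fun t => n * logPartition μ (θ₀ + t • T v))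
    (f' := fun t => n * inner ℝ (T v) (mean μ (θ₀ + t • T v)))
    (f'' := fun t => n * covForm μ (θ₀ + t • T v) (T v) (T v)) (c := 7 / 5 * ‖v‖ ^ 2)
    (fun t ht => by
      have h1 := hasFDerivAt_logPartition hμ h0 (hm t ht)
      have h2 := hasDerivAt_line h1.differentiableAt
      rw [h1.fderiv] at h2
      rw [real_inner_comm]
      exact h2.const_mul (n : ℝ))
    (fun t ht => (hasDerivAt_inner_mean hμ h0 (hm t ht) (T v)).const_mul (n : ℝ))
    (fun t ht => by
      have := h.covForm_le hb hbρ (hmt t ht) v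
      rwa [map_smul] at this)
  simp only [one_smul, zero_smul, add_zero] at this
  linarith

lemma integral_exp_inner_sub_mean (h0 : μ ≠ 0) (hθ : θ ∈ natDomain μ)
    {v : EuclideanSpace ℝ (Fin d)} (hv : θ + v ∈ natDomain μ) (m : EuclideanSpace ℝ (Fin d)) :
    Integrable (fun y => Real.exp (inner ℝ v (y - m))) (expFamily μ θ) ∧
    ∫ y, Real.exp (inner ℝ v (y - m)) ∂expFamily μ θ =
      Real.exp (logPartition μ (θ + v) - logPartition μ θ - inner ℝ v m) := by
  have e : ∀ y : EuclideanSpace ℝ (Fin d), Real.exp (inner ℝ θ y) • Real.exp (inner ℝ v (y - m)) =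
      Real.exp (- inner ℝ v m) * Real.exp (inner ℝ (θ + v) y) := fun y => by
    rw [smul_eq_mul, ← Real.exp_add, ← Real.exp_add, inner_sub_right, inner_add_left]; ring_nf
  have p1 := tiltIntegral_one_pos h0 hθ
  have p2 := tiltIntegral_one_pos h0 hv
  constructor
  · rw [expFamily, integrable_withDensity_iff_integrable_smul'
      (measurable_expDensity.ennreal_ofReal) (Filter.Eventually.of_forall fun y => ENNReal.ofReal_lt_top)]
    refine (((integrable_exp_of_mem hv).const_mul (Real.exp (- inner ℝ v m))).const_mul
      (tiltIntegral μ (fun _ => (1 : ℝ)) θ)⁻¹).congr (Filter.Eventually.of_forall fun y => ?_)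
    beta_reduce
    rw [ENNReal.toReal_ofReal (show 0 ≤ expDensity μ θ y from (Real.exp_pos _).le),
      expDensity_eq h0 hθ, ← e, smul_eq_mul, smul_eq_mul, mul_assoc]
  · have e2 : tiltIntegral μ (fun y => Real.exp (inner ℝ v (y - m))) θ =
        Real.exp (- inner ℝ v m) * ∫ y, Real.exp (inner ℝ (θ + v) y) ∂μ := by
      rw [tiltIntegral, ← integral_const_mul]
      exact integral_congr_ae (Filter.Eventually.of_forall e)
    rw [integral_expFamily h0 hθ, e2, ← tiltIntegral_one_eq, logPartition, logPartition,
      ← tiltIntegral_one_eq, ← tiltIntegral_one_eq, Real.exp_sub, Real.exp_sub, Real.exp_log p1,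
      Real.exp_log p2, Real.exp_neg, smul_eq_mul]
    field_simp

/-- The whitened score at `θ₀`. -/
noncomputable def score (μ : Measure (EuclideanSpace ℝ (Fin d))) (θ₀ : EuclideanSpace ℝ (Fin d))
    (T : EuclideanSpace ℝ (Fin d) ≃L[ℝ] EuclideanSpace ℝ (Fin d))
    (Y : Fin n → EuclideanSpace ℝ (Fin d)) : EuclideanSpace ℝ (Fin d) :=
  T (∑ i, (Y i - mean μ θ₀))

lemma continuous_score (T : EuclideanSpace ℝ (Fin d) ≃L[ℝ] EuclideanSpace ℝ (Fin d)) :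
    Continuous (score (n := n) μ θ₀ T) := by
  unfold score
  fun_prop

lemma lintegral_exp_inner_score
    {T : EuclideanSpace ℝ (Fin d) ≃L[ℝ] EuclideanSpace ℝ (Fin d)} {b ρ : ℝ}
    (hT : Whitens n μ θ₀ T) (h : HessianNear n μ θ₀ T b ρ)
    (hμ : IsRegularMinimal μ) (h0 : μ ≠ 0) (hθ : θ₀ ∈ natDomain μ)
    (hb : 0 ≤ b) (hbρ : b * ρ ≤ 2 / 5)
    {v : EuclideanSpace ℝ (Fin d)} (hv : ‖v‖ ≤ ρ) :
    ∫⁻ Y, ENNReal.ofReal (Real.exp (inner ℝ v (score μ θ₀ T Y)))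
      ∂Measure.pi (fun _ : Fin n => expFamily μ θ₀) ≤
      ENNReal.ofReal (Real.exp (7 / 10 * ‖v‖ ^ 2)) := by
  have := isProbabilityMeasure_expFamily h0 hθ
  have e : ∀ Y : Fin n → EuclideanSpace ℝ (Fin d),
      Real.exp (inner ℝ v (score μ θ₀ T Y)) =
        ∏ i, Real.exp (inner ℝ (T v) (Y i - mean μ θ₀)) := fun Y => by
    rw [score, ← hT.symm_inner, inner_sum, Real.exp_sum]
  obtain ⟨h1, h2⟩ := integral_exp_inner_sub_mean h0 hθ (h.mem v hv) (mean μ θ₀)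
  simp_rw [e]
  rw [← ofReal_integral_eq_lintegral_ofReal
    (Integrable.fintype_prod (f := fun _ y => Real.exp (inner ℝ (T v) (y - mean μ θ₀)))
      fun _ => h1)
    (Filter.Eventually.of_forall fun Y => Finset.prod_nonneg fun i _ => (Real.exp_pos _).le),
    integral_fintype_prod_eq_pow (fun y => Real.exp (inner ℝ (T v) (y - mean μ θ₀))), h2,
    ← Real.exp_nat_mul, Fintype.card_fin]
  exact ENNReal.ofReal_le_ofReal (Real.exp_le_exp.2 (h.logPartition_sub_le hμ h0 hb hbρ hv))

/-- By the symmetry of the ball, the integrand may be averaged with its reflection, and e^x + e^{-x}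
≥ 2. -/
lemma volume_ball_le_lintegral_exp (x : EuclideanSpace ℝ (Fin d)) (r : ℝ) :
    volume (Metric.ball (0 : EuclideanSpace ℝ (Fin d)) r) ≤
      ∫⁻ w in Metric.ball (0 : EuclideanSpace ℝ (Fin d)) r,
        ENNReal.ofReal (Real.exp (inner ℝ w x)) := by
  set B := Metric.ball (0 : EuclideanSpace ℝ (Fin d)) r
  have hB : MeasurableSet B := Metric.isOpen_ball.measurableSet
  set I := ∫⁻ w in B, ENNReal.ofReal (Real.exp (inner ℝ w x))
  have h1 : ∫⁻ w in B, ENNReal.ofReal (Real.exp (-inner ℝ w x)) = I := by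
    rw [← lintegral_indicator hB, ← lintegral_neg_eq_self]
    refine Eq.trans ?_ (lintegral_indicator hB _)
    congr with w
    simp [Set.indicator, B]
  have h2 : 2 * volume B ≤ I + I := by
    conv_rhs => rw [← h1]
    rw [h1]
    calc 2 * volume B = ∫⁻ _ in B, 2 := by simp
      _ ≤ ∫⁻ w in B, (ENNReal.ofReal (Real.exp (inner ℝ w x)) +
          ENNReal.ofReal (Real.exp (-inner ℝ w x))) := by
        refine lintegral_mono fun w => ?_
        rw [← ENNReal.ofReal_add (Real.exp_pos _).le (Real.exp_pos _).le]
        refine (ENNReal.ofReal_ofNat 2).symm.le.trans (ENNReal.ofReal_le_ofReal ?_)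
        linarith [Real.add_one_le_exp (inner ℝ w x : ℝ), Real.add_one_le_exp (-inner ℝ w x : ℝ)]
      _ = I + I := by
        rw [lintegral_add_left (by fun_prop), h1]
  rw [← two_mul] at h2
  exact (ENNReal.mul_le_mul_iff_right (by simp) (by simp)).1 h2

/-- The ball of radius r centred at (R - r)x/‖x‖ lies in the ball of radius R. On it the exponent is
(R - r)‖x‖ plus a centred linear term, which the preceding symmetry bound discards. -/
lemma exp_mul_volume_ball_le (x : EuclideanSpace ℝ (Fin d)) {r R : ℝ} (hrR : r ≤ R) :
    ENNReal.ofReal (Real.exp ((R - r) * ‖x‖)) *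
        volume (Metric.ball (0 : EuclideanSpace ℝ (Fin d)) r) ≤
      ∫⁻ v in Metric.ball (0 : EuclideanSpace ℝ (Fin d)) R,
        ENNReal.ofReal (Real.exp (inner ℝ v x)) := by
  set c : EuclideanSpace ℝ (Fin d) := ((R - r) * ‖x‖⁻¹) • x with hc
  have hcn : ‖c‖ ≤ R - r := by
    rw [hc, norm_smul, Real.norm_eq_abs, abs_of_nonneg (by
      have := sub_nonneg.2 hrR; positivity), mul_assoc]
    exact mul_le_of_le_one_right (sub_nonneg.2 hrR) (inv_mul_le_one)
  have hcx : (inner ℝ c x : ℝ) = (R - r) * ‖x‖ := by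
    rw [hc, inner_smul_left, real_inner_self_eq_norm_sq, conj_trivial]
    rcases eq_or_ne ‖x‖ 0 with h | h
    · simp [h]
    · field_simp
  have hB : ∀ r : ℝ, MeasurableSet (Metric.ball (0 : EuclideanSpace ℝ (Fin d)) r) := fun r =>
    Metric.isOpen_ball.measurableSet
  calc _ ≤ ENNReal.ofReal (Real.exp ((R - r) * ‖x‖)) *
        ∫⁻ w in Metric.ball (0 : EuclideanSpace ℝ (Fin d)) r,
          ENNReal.ofReal (Real.exp (inner ℝ w x)) := by
        gcongr; exact volume_ball_le_lintegral_exp x r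
    _ = ∫⁻ w in Metric.ball (0 : EuclideanSpace ℝ (Fin d)) r,
          ENNReal.ofReal (Real.exp (inner ℝ (c + w) x)) := by
        rw [← lintegral_const_mul _ (by fun_prop)]
        congr with w
        rw [← ENNReal.ofReal_mul (Real.exp_pos _).le, ← Real.exp_add, inner_add_left, hcx]
    _ ≤ ∫⁻ w, (Metric.ball (0 : EuclideanSpace ℝ (Fin d)) R).indicator
          (fun v => ENNReal.ofReal (Real.exp (inner ℝ v x))) (c + w) := by
        rw [← lintegral_indicator (hB r)]
        refine lintegral_mono fun w => ?_
        by_cases hw : w ∈ Metric.ball (0 : EuclideanSpace ℝ (Fin d)) r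
        · rw [Set.indicator_of_mem hw, Set.indicator_of_mem]
          rw [mem_ball_zero_iff] at hw ⊢
          linarith [norm_add_le c w]
        · rw [Set.indicator_of_notMem hw]
          exact zero_le
    _ = _ := by rw [lintegral_add_left_eq_self, lintegral_indicator (hB R)]

/-- A norm tail bound from a local sub-Gaussian bound, by averaging the Chernoff bound
over a ball. -/
lemma measure_lt_norm_le {Ω : Type*} [MeasurableSpace Ω] {P : Measure Ω} [SFinite P]
    {H : Ω → EuclideanSpace ℝ (Fin d)} (hH : Measurable H) {c r R τ : ℝ} (hc : 0 ≤ c) (hr : 0 < r)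
    (hrR : r ≤ R) (hmgf : ∀ v, ‖v‖ ≤ R → ∫⁻ ω, ENNReal.ofReal (Real.exp (inner ℝ v (H ω))) ∂P ≤
      ENNReal.ofReal (Real.exp (c * ‖v‖ ^ 2))) :
    P {ω | τ < ‖H ω‖} ≤
      ENNReal.ofReal ((R / r) ^ d * Real.exp (c * R ^ 2 - (R - r) * τ)) := by
  have hR : 0 < R := hr.trans_le hrR
  set V := volume (Metric.ball (0 : EuclideanSpace ℝ (Fin d)) r) with hV
  have hV0 : V ≠ 0 := (Metric.measure_ball_pos _ _ hr).ne'
  have hV1 : V ≠ ∞ := measure_ball_lt_top.ne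
  have hVR : volume (Metric.ball (0 : EuclideanSpace ℝ (Fin d)) R) =
      ENNReal.ofReal ((R / r) ^ d) * V := by
    have := Measure.addHaar_ball_mul_of_pos (volume : Measure (EuclideanSpace ℝ (Fin d))) 0
      (div_pos hR hr) r
    rwa [div_mul_cancel₀ _ hr.ne', finrank_euclideanSpace, Fintype.card_fin] at this
  have h1 : ENNReal.ofReal (Real.exp ((R - r) * τ)) * V * P {ω | τ < ‖H ω‖} ≤
      ENNReal.ofReal (Real.exp (c * R ^ 2)) * (ENNReal.ofReal ((R / r) ^ d) * V) := by
    calc _ = ∫⁻ _ in {ω | τ < ‖H ω‖}, ENNReal.ofReal (Real.exp ((R - r) * τ)) * V ∂P := by simp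
      _ ≤ ∫⁻ ω in {ω | τ < ‖H ω‖}, ∫⁻ v in Metric.ball (0 : EuclideanSpace ℝ (Fin d)) R,
          ENNReal.ofReal (Real.exp (inner ℝ v (H ω))) ∂volume ∂P := by
        refine setLIntegral_mono' (measurableSet_lt measurable_const hH.norm) fun ω hω => ?_
        refine le_trans ?_ (exp_mul_volume_ball_le (H ω) hrR)
        have := sub_nonneg.2 hrR
        gcongr
        exact le_of_lt hω
      _ ≤ ∫⁻ ω, ∫⁻ v in Metric.ball (0 : EuclideanSpace ℝ (Fin d)) R,
          ENNReal.ofReal (Real.exp (inner ℝ v (H ω))) ∂volume ∂P := setLIntegral_le_lintegral _ _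
      _ = ∫⁻ v in Metric.ball (0 : EuclideanSpace ℝ (Fin d)) R, ∫⁻ ω,
          ENNReal.ofReal (Real.exp (inner ℝ v (H ω))) ∂P ∂volume := by
        rw [lintegral_lintegral_swap]
        fun_prop
      _ ≤ ∫⁻ v in Metric.ball (0 : EuclideanSpace ℝ (Fin d)) R,
          ENNReal.ofReal (Real.exp (c * R ^ 2)) := by
        refine setLIntegral_mono' Metric.isOpen_ball.measurableSet fun v hv => ?_
        rw [mem_ball_zero_iff] at hv
        refine (hmgf v hv.le).trans (ENNReal.ofReal_le_ofReal (Real.exp_le_exp.2 ?_))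
        gcongr
      _ = _ := by rw [setLIntegral_const, hVR]
  have e : ENNReal.ofReal ((R / r) ^ d * Real.exp (c * R ^ 2 - (R - r) * τ)) =
      (ENNReal.ofReal (Real.exp ((R - r) * τ)) * V)⁻¹ *
        (ENNReal.ofReal (Real.exp (c * R ^ 2)) * (ENNReal.ofReal ((R / r) ^ d) * V)) := by
    rw [ENNReal.mul_inv (by simp [hV1]) (by simp), Real.exp_sub,
      ENNReal.ofReal_mul (by positivity), ENNReal.ofReal_div_of_pos (Real.exp_pos _),
      ENNReal.div_eq_inv_mul]
    calc _ = (ENNReal.ofReal (Real.exp ((R - r) * τ)))⁻¹ * ENNReal.ofReal (Real.exp (c * R ^ 2)) *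
          ENNReal.ofReal ((R / r) ^ d) * (V⁻¹ * V) := by
          rw [ENNReal.inv_mul_cancel hV0 hV1]; ring
      _ = _ := by ring
  rw [e, ← ENNReal.div_eq_inv_mul, ENNReal.le_div_iff_mul_le
    (.inl (by simp [hV0, Real.exp_pos])) (.inl (by finiteness)), mul_comm]
  exact h1

lemma le_measure_norm_score_le
    {T : EuclideanSpace ℝ (Fin d) ≃L[ℝ] EuclideanSpace ℝ (Fin d)} {b s : ℝ}
    (hT : Whitens n μ θ₀ T) (h : HessianNear n μ θ₀ T b (2 * (s * √d)))
    (hμ : IsRegularMinimal μ) (h0 : μ ≠ 0) (hθ : θ₀ ∈ natDomain μ) (hd : 0 < d) (hs : 12 ≤ s)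
    (hb : 0 ≤ b) (hbρ : b * (2 * (s * √d)) ≤ 2 / 5) :
    ENNReal.ofReal (1 - Real.exp (-(d * s ^ 2 / 10))) ≤
      Measure.pi (fun _ : Fin n => expFamily μ θ₀) {Y | ‖score μ θ₀ T Y‖ ≤ 4 / 5 * (s * √d)} := by
  have := isProbabilityMeasure_expFamily h0 hθ
  set P := Measure.pi (fun _ : Fin n => expFamily μ θ₀)
  have hd' : (0 : ℝ) < √d := by positivity
  have hdd : √(d : ℝ) ^ 2 = d := Real.sq_sqrt (by positivity)
  have hsd : 0 < s * √d := by positivity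
  -- With R = (2/5)s√d and r = R/4 the exponent is (0.112 - 0.24)s²d = -0.128 s²d, and the volume
  -- ratio is 4^d ≤ e^{3d}. Since s ≥ 12, the surplus 0.028 s²d exceeds 3d and leaves -s²d/10.
  have h1 := measure_lt_norm_le (P := P) (H := score μ θ₀ T) (continuous_score T).measurable
    (c := 7 / 10) (r := s * √d / 10) (R := 2 / 5 * (s * √d)) (τ := 4 / 5 * (s * √d)) (by norm_num)
    (by positivity) (by linarith)
    fun v hv => lintegral_exp_inner_score hT h hμ h0 hθ hb hbρ (by linarith)
  have h2 : (2 / 5 * (s * √d) / (s * √d / 10)) ^ d *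
      Real.exp (7 / 10 * (2 / 5 * (s * √d)) ^ 2 -
        (2 / 5 * (s * √d) - s * √d / 10) * (4 / 5 * (s * √d))) ≤
      Real.exp (-(d * s ^ 2 / 10)) := by
    rw [show 2 / 5 * (s * √d) / (s * √d / 10) = 4 by field_simp; norm_num,
      show 7 / 10 * (2 / 5 * (s * √d)) ^ 2 -
        (2 / 5 * (s * √d) - s * √d / 10) * (4 / 5 * (s * √d)) =
        -(16 / 125) * (s ^ 2 * √d ^ 2) by ring, hdd]
    have h4 : (4 : ℝ) ≤ Real.exp 3 := by linarith [Real.add_one_le_exp (3 : ℝ)]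
    calc (4 : ℝ) ^ d * Real.exp (-(16 / 125) * (s ^ 2 * d))
        ≤ Real.exp 3 ^ d * Real.exp (-(16 / 125) * (s ^ 2 * d)) := by gcongr
      _ = Real.exp (d * 3 + -(16 / 125) * (s ^ 2 * d)) := by
        rw [← Real.exp_nat_mul, ← Real.exp_add]
      _ ≤ _ := by
        refine Real.exp_le_exp.2 ?_
        have : (0 : ℝ) ≤ d := Nat.cast_nonneg _
        have hs2 : 144 ≤ s ^ 2 := by nlinarith
        nlinarith [mul_le_mul_of_nonneg_left hs2 this]
  have h3 : {Y | ‖score (n := n) μ θ₀ T Y‖ ≤ 4 / 5 * (s * √d)} =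
      {Y | 4 / 5 * (s * √d) < ‖score μ θ₀ T Y‖}ᶜ := by ext; simp
  rw [h3, prob_compl_eq_one_sub (measurableSet_lt measurable_const
    (continuous_score T).measurable.norm), ENNReal.ofReal_sub _ (Real.exp_pos _).le,
    ENNReal.ofReal_one]
  exact tsub_le_tsub_left (h1.trans (ENNReal.ofReal_le_ofReal h2)) _

end Concentration

/-! ### Strict convexity of the likelihood and existence of the estimator. -/

section Likelihood

variable {d n : ℕ} {μ : Measure (EuclideanSpace ℝ (Fin d))} {θ θ₀ η : EuclideanSpace ℝ (Fin d)}

/-- Integrate e^x ≥ 1 + x at x = vᵀ(Y - E Y). Equality would force vᵀY to have zero variance. -/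
lemma inner_mean_lt_logPartition_sub (hμ : IsRegularMinimal μ) (h0 : μ ≠ 0) (hθ : θ ∈ natDomain μ)
    (hη : η ∈ natDomain μ) (hne : η ≠ θ) :
    inner ℝ (η - θ) (mean μ θ) < logPartition μ η - logPartition μ θ := by
  have hP := isProbabilityMeasure_expFamily h0 hθ
  set v := η - θ with hv
  have hv0 : v ≠ 0 := sub_ne_zero.2 hne
  have hθv : θ + v = η := add_sub_cancel _ _
  obtain ⟨h1, h2⟩ := integral_exp_inner_sub_mean h0 hθ (v := v) (by rwa [hθv]) (mean μ θ)
  have h3 := integrable_expFamily hμ h0 hθ (polyGrowth_inner_sub v (mean μ θ))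
  have h4 := integral_inner_sub_mean hμ h0 hθ v
  have hnn : ∀ y, 0 ≤ Real.exp (inner ℝ v (y - mean μ θ)) - (inner ℝ v (y - mean μ θ) + 1) :=
    fun y => sub_nonneg.2 (Real.add_one_le_exp _)
  have h5 : ∫ y, (Real.exp (inner ℝ v (y - mean μ θ)) - (inner ℝ v (y - mean μ θ) + 1))
      ∂expFamily μ θ = Real.exp (logPartition μ (θ + v) - logPartition μ θ -
        inner ℝ v (mean μ θ)) - 1 := by
    rw [integral_sub h1 (by exact h3.add (integrable_const 1)),
      integral_add h3 (integrable_const _), h4, h2]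
    simp
  have h6 : 0 < ∫ y, (Real.exp (inner ℝ v (y - mean μ θ)) - (inner ℝ v (y - mean μ θ) + 1))
      ∂expFamily μ θ := by
    refine (integral_nonneg hnn).lt_of_ne' fun h => ?_
    rw [integral_eq_zero_iff_of_nonneg hnn (h1.sub (h3.add (integrable_const _)))] at h
    refine (covForm_self_pos hμ h0 hθ hv0).ne' ?_
    rw [covForm]
    refine integral_eq_zero_of_ae ?_
    filter_upwards [h] with y hy
    by_contra hne
    have : (inner ℝ v (y - mean μ θ) : ℝ) ≠ 0 := fun h => hne (by simp [h])
    have := Real.add_one_lt_exp this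
    simp only [Pi.zero_apply] at hy
    linarith
  rw [h5, sub_pos, Real.one_lt_exp_iff, hθv] at h6
  linarith

lemma convex_natDomain : Convex ℝ (natDomain μ) := by
  intro x hx y hy a b ha hb hab
  have h : ∀ z : EuclideanSpace ℝ (Fin d),
      ENNReal.ofReal (Real.exp (inner ℝ (a • x + b • y) z)) ≤
        ENNReal.ofReal (Real.exp (inner ℝ x z)) + ENNReal.ofReal (Real.exp (inner ℝ y z)) := by
    intro z
    rw [← ENNReal.ofReal_add (Real.exp_pos _).le (Real.exp_pos _).le]
    refine ENNReal.ofReal_le_ofReal ?_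
    have h1 := convexOn_exp.2 (Set.mem_univ (inner ℝ x z : ℝ)) (Set.mem_univ (inner ℝ y z : ℝ))
      ha hb hab
    simp only [smul_eq_mul] at h1
    rw [inner_add_left, inner_smul_left, inner_smul_left]
    refine h1.trans (add_le_add ?_ ?_)
    · exact mul_le_of_le_one_left (Real.exp_pos _).le (by linarith)
    · exact mul_le_of_le_one_left (Real.exp_pos _).le (by linarith)
  refine (lintegral_mono h).trans_lt ?_
  rw [lintegral_add_left (by fun_prop)]
  exact ENNReal.add_lt_top.2 ⟨hx, hy⟩

/-- The unnormalized negative log-likelihood `n ℓ`. -/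
noncomputable def potential (μ : Measure (EuclideanSpace ℝ (Fin d)))
    (Y : Fin n → EuclideanSpace ℝ (Fin d)) (θ : EuclideanSpace ℝ (Fin d)) : ℝ :=
  n * logPartition μ θ - inner ℝ θ (∑ i, Y i)

variable {Y : Fin n → EuclideanSpace ℝ (Fin d)}

lemma mul_negLogLik (hn : 0 < n) : n * negLogLik μ Y θ = potential μ Y θ := by
  have hn' : (n : ℝ) ≠ 0 := by positivity
  rw [negLogLik, likelihood, Real.log_prod (f := fun i => expDensity μ θ (Y i))
    fun i _ => (Real.exp_pos _).ne', potential, inner_sum]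
  simp only [expDensity, Real.log_exp, Finset.sum_sub_distrib, Finset.sum_const, Finset.card_univ,
    Fintype.card_fin, nsmul_eq_mul]
  field_simp
  ring

lemma potential_add_lt (hμ : IsRegularMinimal μ) (h0 : μ ≠ 0) (hn : 0 < n) (hθ : θ ∈ natDomain μ)
    (hη : η ∈ natDomain μ) (hne : η ≠ θ) :
    potential μ Y θ + inner ℝ (η - θ) ((n : ℝ) • mean μ θ - ∑ i, Y i) < potential μ Y η := by
  have h := inner_mean_lt_logPartition_sub hμ h0 hθ hη hne
  have hn' : (0 : ℝ) < n := by positivity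
  have h2 := mul_lt_mul_of_pos_left h hn'
  rw [inner_sub_right, inner_smul_right, potential, potential, inner_sub_left η θ (∑ i, Y i)]
  linarith

lemma potential_add_le (hμ : IsRegularMinimal μ) (h0 : μ ≠ 0) (hn : 0 < n) (hθ : θ ∈ natDomain μ)
    (hη : η ∈ natDomain μ) :
    potential μ Y θ + inner ℝ (η - θ) ((n : ℝ) • mean μ θ - ∑ i, Y i) ≤ potential μ Y η := by
  rcases eq_or_ne η θ with rfl | hne
  · simp
  · exact (potential_add_lt hμ h0 hn hθ hη hne).le

/-- A function lying above its tangent plane at every point of a convex set is convex. -/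
lemma convexOn_potential (hμ : IsRegularMinimal μ) (h0 : μ ≠ 0) (hn : 0 < n) :
    ConvexOn ℝ (natDomain μ) (potential μ Y) := by
  refine ⟨convex_natDomain, fun x hx y hy a b ha hb hab => ?_⟩
  have hz := convex_natDomain hx hy ha hb hab
  set z := a • x + b • y with hzdef
  set G := (n : ℝ) • mean μ z - ∑ i, Y i
  have h1 := potential_add_le (Y := Y) hμ h0 hn hz hx
  have h2 := potential_add_le (Y := Y) hμ h0 hn hz hy
  have h3 : a * inner ℝ (x - z) G + b * inner ℝ (y - z) G = (0 : ℝ) := by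
    rw [← real_inner_smul_left, ← real_inner_smul_left, ← inner_add_left,
      show a • (x - z) + b • (y - z) = (1 - (a + b)) • z by rw [hzdef]; module, hab]
    simp
  have h4 := mul_le_mul_of_nonneg_left h1 ha
  have h5 := mul_le_mul_of_nonneg_left h2 hb
  have h6 : potential μ Y z = a * potential μ Y z + b * potential μ Y z := by
    rw [← add_mul, hab, one_mul]
  simp only [smul_eq_mul]
  linarith

lemma hasFDerivAt_potential (hμ : IsRegularMinimal μ) (h0 : μ ≠ 0) (hθ : θ ∈ natDomain μ) :
    HasFDerivAt (potential μ Y) (innerSL ℝ ((n : ℝ) • mean μ θ - ∑ i, Y i)) θ := by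
  have h1 := (hasFDerivAt_logPartition hμ h0 hθ).const_mul (n : ℝ)
  have h2 : HasFDerivAt (fun θ => (inner ℝ θ (∑ i, Y i) : ℝ)) (innerSL ℝ (∑ i, Y i)) θ := by
    simp_rw [fun θ : EuclideanSpace ℝ (Fin d) => real_inner_comm (∑ i, Y i) θ]
    exact (innerSL ℝ (∑ i, Y i)).hasFDerivAt
  convert! h1.sub h2 using 1
  rw [map_sub, map_smul]

lemma contDiffOn_potential (hμ : IsRegularMinimal μ) (h0 : μ ≠ 0) :
    ContDiffOn ℝ 1 (potential μ Y) (natDomain μ) := by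
  rw [show (1 : WithTop ℕ∞) = 0 + 1 by norm_num, contDiffOn_succ_iff_fderiv_of_isOpen hμ.isOpen]
  refine ⟨fun θ hθ => (hasFDerivAt_potential hμ h0 hθ).differentiableAt.differentiableWithinAt,
    by simp, ?_⟩
  rw [contDiffOn_zero]
  have : ContinuousOn (fun θ => innerSL ℝ ((n : ℝ) • mean μ θ - ∑ i, Y i)) (natDomain μ) := by
    refine (innerSL ℝ).continuous.comp_continuousOn ?_
    have hm : ContinuousOn (mean μ) (natDomain μ) := fun θ hθ => ?_
    · exact (hm.const_smul (n : ℝ)).sub continuousOn_const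
    exact (differentiableAt_integral_expFamily hμ h0 hθ
      polyGrowth_id).continuousAt.continuousWithinAt
  exact this.congr fun θ hθ => (hasFDerivAt_potential hμ h0 hθ).fderiv

lemma isUniqueMLE_of_critical (hμ : IsRegularMinimal μ) (h0 : μ ≠ 0) (hn : 0 < n)
    (hθ : θ ∈ natDomain μ) (hcrit : (n : ℝ) • mean μ θ = ∑ i, Y i) : IsUniqueMLE μ Y θ := by
  refine ⟨hθ, fun η hη hne => ?_⟩
  have h := potential_add_lt (Y := Y) hμ h0 hn hθ hη hne
  rw [hcrit, sub_self, inner_zero_right, add_zero, ← mul_negLogLik hn, ← mul_negLogLik hn] at h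
  exact lt_of_mul_lt_mul_left h (Nat.cast_nonneg n)

variable {T : EuclideanSpace ℝ (Fin d) ≃L[ℝ] EuclideanSpace ℝ (Fin d)} {b r : ℝ}

/-- Increments of the mean parameter, in whitened coordinates. -/
lemma HessianNear.inner_mean_sub (h : HessianNear n μ θ₀ T b (2 * r)) (hμ : IsRegularMinimal μ)
    (h0 : μ ≠ 0) (hb : 0 ≤ b) {ρ : ℝ} (hρ : ρ ≤ 2 * r) {v z : EuclideanSpace ℝ (Fin d)}
    (hv : ‖v‖ ≤ ρ) (hvz : ‖v + z‖ ≤ ρ) (w : EuclideanSpace ℝ (Fin d)) :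
    |n * inner ℝ (T w) (mean μ (θ₀ + T (v + z)) - mean μ (θ₀ + T v)) - inner ℝ z w| ≤
      b * ρ * ‖z‖ * ‖w‖ := by
  have hmt : ∀ t ∈ Set.Icc (0 : ℝ) 1, ‖v + t • z‖ ≤ ρ := fun t ht => by
    have := (convex_closedBall (0 : EuclideanSpace ℝ (Fin d)) ρ)
      (mem_closedBall_zero_iff.2 hv) (mem_closedBall_zero_iff.2 hvz)
      (sub_nonneg.2 ht.2) ht.1 (sub_add_cancel _ _)
    rw [mem_closedBall_zero_iff] at this
    rwa [show v + t • z = (1 - t) • v + t • (v + z) by module]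
  have hmem : ∀ t ∈ Set.Icc (0 : ℝ) 1, θ₀ + T v + t • T z ∈ natDomain μ := fun t ht => by
    have := h.mem _ ((hmt t ht).trans hρ)
    rwa [map_add, map_smul, ← add_assoc] at this
  have hd : ∀ t ∈ Set.Icc (0 : ℝ) 1, HasDerivWithinAt
      (fun t : ℝ => n * inner ℝ (T w) (mean μ (θ₀ + T v + t • T z)) - t * inner ℝ w z)
      (n * covForm μ (θ₀ + T v + t • T z) (T w) (T z) - inner ℝ w z) (Set.Icc 0 1) t :=
    fun t ht => by
      have h1 := (hasDerivAt_inner_mean hμ h0 (hmem t ht) (T w)).const_mul (n : ℝ)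
      have h2 := (hasDerivAt_id t).mul_const (inner ℝ w z : ℝ)
      rw [one_mul] at h2
      exact (h1.sub h2).hasDerivWithinAt
  have := norm_image_sub_le_of_norm_deriv_le_segment_01' hd (C := b * ρ * ‖w‖ * ‖z‖)
    fun t ht => by
      have ht' := Set.Ico_subset_Icc_self ht
      have hb1 := h.bound _ ((hmt t ht').trans hρ) w z
      rw [map_add, map_smul, ← add_assoc] at hb1
      rw [Real.norm_eq_abs]
      refine hb1.trans ?_
      gcongr
      exact hmt t ht'
  simp only [one_smul, zero_smul, add_zero, one_mul, zero_mul, sub_zero, Real.norm_eq_abs] at this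
  rw [inner_sub_right, map_add, ← add_assoc, real_inner_comm w z]
  refine le_trans (le_of_eq ?_) (this.trans (le_of_eq (by ring)))
  congr 1
  ring

/-- If the score is small, the likelihood has a critical point near `θ₀`. -/
lemma HessianNear.exists_critical (hT : Whitens n μ θ₀ T) (h : HessianNear n μ θ₀ T b (2 * r))
    (hμ : IsRegularMinimal μ) (h0 : μ ≠ 0) (hn : 0 < n) (hb : 0 ≤ b) (hr : 0 < r)
    (hbr : b * (2 * r) ≤ 48 / 125) (hY : ‖score μ θ₀ T Y‖ ≤ 4 / 5 * r) :
    ∃ v, ‖v‖ < r ∧ (n : ℝ) • mean μ (θ₀ + T v) = ∑ i, Y i := by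
  set f := fun v => potential μ Y (θ₀ + T v) with hf
  have hmem : ∀ v, ‖v‖ ≤ r → θ₀ + T v ∈ natDomain μ := fun v hv => h.mem v (by linarith)
  have hder : ∀ v, ‖v‖ ≤ r → HasFDerivAt f
      ((innerSL ℝ ((n : ℝ) • mean μ (θ₀ + T v) - ∑ i, Y i)).comp
        (T : EuclideanSpace ℝ (Fin d) →L[ℝ] EuclideanSpace ℝ (Fin d))) v := fun v hv =>
    HasFDerivAt.comp (g := potential μ Y) v (hasFDerivAt_potential hμ h0 (hmem v hv))
      (T.hasFDerivAt.const_add θ₀)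
  -- Minimise over a compact ball and exclude the boundary; an interior minimiser is a critical
  -- point.
  obtain ⟨v, hv, hmin⟩ := (isCompact_closedBall (0 : EuclideanSpace ℝ (Fin d)) r).exists_isMinOn
    ⟨0, Metric.mem_closedBall_self hr.le⟩
    (fun v hv => (hder v (mem_closedBall_zero_iff.1 hv)).continuousAt.continuousWithinAt)
  rw [mem_closedBall_zero_iff] at hv
  have hlt : ‖v‖ < r := by
    refine hv.lt_of_ne fun hvr => ?_
    -- If ‖v‖ = r, the tangent plane at the slightly smaller point t v would force a nonpositive
    -- radial derivative there. That derivative is at least (t(1 - 24/125) - 4/5)r² > 0. This is why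
    -- 48/125 is required rather than 2/5, for which the limit t = 1 would already give 0.
    set t : ℝ := 199 / 200 with ht
    have htv : ‖t • v‖ ≤ r := by
      rw [norm_smul, hvr, ht, Real.norm_eq_abs, abs_of_pos (by norm_num)]; linarith
    have h1 := potential_add_le (Y := Y) hμ h0 hn (hmem _ htv) (hmem v hv)
    have h2 : f v ≤ f (t • v) := hmin (mem_closedBall_zero_iff.2 htv)
    have h3 := (abs_le.1 (h.inner_mean_sub hμ h0 hb (ρ := r) (by linarith) (v := 0) (z := t • v)
      (by simpa using hr.le) (by simpa using htv) v)).1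
    have h4 : (inner ℝ (T v) (∑ i, Y i) : ℝ) ≤ n * inner ℝ (T v) (mean μ θ₀) + 4 / 5 * r * r := by
      have e : (inner ℝ v (score μ θ₀ T Y) : ℝ) =
          inner ℝ (T v) (∑ i, Y i) - n * inner ℝ (T v) (mean μ θ₀) := by
        rw [score, ← hT.symm_inner, Finset.sum_sub_distrib, inner_sub_right]
        simp [← Nat.cast_smul_eq_nsmul ℝ, inner_smul_right]
      have := real_inner_le_norm v (score μ θ₀ T Y)
      rw [hvr] at this
      nlinarith
    have h5 : θ₀ + T v - (θ₀ + T (t • v)) = (1 - t) • T v := by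
      rw [map_smul]; module
    rw [h5, inner_smul_left, inner_sub_right, inner_smul_right, conj_trivial] at h1
    simp only [zero_add, map_zero, add_zero, inner_sub_right, inner_smul_left, conj_trivial,
      real_inner_self_eq_norm_sq, norm_smul, hvr, Real.norm_eq_abs] at h3
    rw [abs_of_pos (by norm_num : 0 < t)] at h3
    have h6 : f v = potential μ Y (θ₀ + T v) := rfl
    have h7 : f (t • v) = potential μ Y (θ₀ + T (t • v)) := rfl
    have h8 : b * r ≤ 24 / 125 := by linarith
    have h9 : b * r * (t * r) * r ≤ 24 / 125 * (t * r) * r := by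
      have : 0 ≤ t * r := by positivity
      gcongr
    have h10 : (1 - t) * (n * inner ℝ (T v) (mean μ (θ₀ + T (t • v))) -
        inner ℝ (T v) (∑ i, Y i)) ≤ 0 := by linarith
    have h11 : n * inner ℝ (T v) (mean μ (θ₀ + T (t • v))) - inner ℝ (T v) (∑ i, Y i) ≤ 0 := by
      rw [ht] at h10 ⊢
      linarith
    have h12 : 0 < r * r := by positivity
    rw [ht] at h3 h9 h11
    nlinarith
  refine ⟨v, hlt, ?_⟩
  have hloc : IsLocalMin f v :=
    hmin.isLocalMin (Metric.closedBall_mem_nhds_of_mem (by simpa using hlt))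
  have hz := hloc.hasFDerivAt_eq_zero (hder v hv)
  have := DFunLike.congr_fun hz (T.symm ((n : ℝ) • mean μ (θ₀ + T v) - ∑ i, Y i))
  rw [ContinuousLinearMap.comp_apply, ContinuousLinearEquiv.coe_coe, T.apply_symm_apply,
    innerSL_apply_apply, _root_.zero_apply, inner_self_eq_zero] at this
  exact sub_eq_zero.1 this

end Likelihood

/-! ### The recentred posterior as a nearly Gaussian density. -/

section LocalModel

variable {d n : ℕ} {μ : Measure (EuclideanSpace ℝ (Fin d))} {θ θ₀ : EuclideanSpace ℝ (Fin d)}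
  {T : EuclideanSpace ℝ (Fin d) ≃L[ℝ] EuclideanSpace ℝ (Fin d)}
  {π₀ : EuclideanSpace ℝ (Fin d) → ℝ} {s : ℝ}

lemma contDiffOn_of_delta01_ne_top (h : delta01 n μ θ₀ π₀ s ≠ ∞) :
    ContDiffOn ℝ 1 π₀ (nbhd n μ θ₀ s) ∧ (∀ θ ∈ nbhd n μ θ₀ s, 0 < π₀ θ) ∧
      ∀ θ ∈ nbhd n μ θ₀ s, formNorm (fisher μ θ₀) (fun u =>
        inner ℝ (gradientWithin (fun t => Real.log (π₀ t)) (nbhd n μ θ₀ s) θ) u) ≤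
          delta01 n μ θ₀ π₀ s := by
  by_cases hc : ContDiffOn ℝ 1 π₀ (nbhd n μ θ₀ s) ∧ ∀ θ ∈ nbhd n μ θ₀ s, 0 < π₀ θ
  · refine ⟨hc.1, hc.2, fun θ hθ => ?_⟩
    rw [delta01, if_pos hc]
    exact le_iSup₂ (f := fun θ (_ : θ ∈ nbhd n μ θ₀ s) => formNorm (fisher μ θ₀) fun u =>
      inner ℝ (gradientWithin (fun t => Real.log (π₀ t)) (nbhd n μ θ₀ s) θ) u) θ hθ
  · rw [delta01, if_neg hc] at h
    exact absurd rfl h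

/-- Strict inequality places the point in the interior, where the derivatives within the
neighbourhood used by `delta01` are ordinary derivatives. -/
lemma Whitens.nbhd_mem_nhds (hT : Whitens n μ θ₀ T) (hμ : IsRegularMinimal μ) (h0 : μ ≠ 0)
    (hθ : θ₀ ∈ natDomain μ) (hn : 0 < n) {v : EuclideanSpace ℝ (Fin d)} (hv : ‖v‖ < s * √d) :
    nbhd n μ θ₀ s ∈ nhds (θ₀ + T v) := by
  have hc : Continuous fun θ => ‖T.symm (θ - θ₀)‖ := by fun_prop
  have h1 : {θ | ‖T.symm (θ - θ₀)‖ < s * √d} ∈ nhds (θ₀ + T v) :=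
    (isOpen_lt hc continuous_const).mem_nhds (by simpa using hv)
  filter_upwards [h1] with θ hθ'
  have h2 := (hT.mem_nbhd_iff hμ h0 hθ hn s (T.symm (θ - θ₀))).2 (le_of_lt hθ')
  rwa [T.apply_symm_apply, add_sub_cancel] at h2

lemma Whitens.logPrior (hT : Whitens n μ θ₀ T) (hμ : IsRegularMinimal μ) (h0 : μ ≠ 0)
    (hθ : θ₀ ∈ natDomain μ) (hn : 0 < n) (h : delta01 n μ θ₀ π₀ s ≠ ∞)
    {v : EuclideanSpace ℝ (Fin d)} (hv : ‖v‖ < s * √d) :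
    DifferentiableAt ℝ (fun v => Real.log (π₀ (θ₀ + T v))) v ∧
      ‖fderiv ℝ (fun v => Real.log (π₀ (θ₀ + T v))) v‖ ≤ (delta01 n μ θ₀ π₀ s).toReal / √n := by
  obtain ⟨hC, hpos, hle⟩ := contDiffOn_of_delta01_ne_top h
  have hnb := hT.nbhd_mem_nhds hμ h0 hθ hn hv
  have hmem := mem_of_mem_nhds hnb
  set θ := θ₀ + T v with hθdef
  have hd : DifferentiableAt ℝ (fun t => Real.log (π₀ t)) θ :=
    ((hC.differentiableOn (by norm_num)).differentiableAt hnb).log (hpos θ hmem).ne'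
  have hcomp : HasFDerivAt (fun v => Real.log (π₀ (θ₀ + T v)))
      ((fderiv ℝ (fun t => Real.log (π₀ t)) θ).comp
        (T : EuclideanSpace ℝ (Fin d) →L[ℝ] EuclideanSpace ℝ (Fin d))) v :=
    HasFDerivAt.comp (g := fun t => Real.log (π₀ t)) v hd.hasFDerivAt
      (T.hasFDerivAt.const_add θ₀)
  refine ⟨hcomp.differentiableAt, ?_⟩
  rw [hcomp.fderiv]
  have hn' : (0 : ℝ) < √n := by positivity
  have hS : ∀ u, inner ℝ (gradientWithin (fun t => Real.log (π₀ t)) (nbhd n μ θ₀ s) θ) u =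
      fderiv ℝ (fun t => Real.log (π₀ t)) θ u := fun u => by
    rw [inner_gradientWithin_left, fderivWithin_of_mem_nhds hnb]
  have hb := hle θ hmem
  simp_rw [hS] at hb
  rw [← ENNReal.ofReal_toReal h] at hb
  have hunit : ∀ w : EuclideanSpace ℝ (Fin d), ‖w‖ = 1 →
      fderiv ℝ (fun t => Real.log (π₀ t)) θ (T w) ≤ (delta01 n μ θ₀ π₀ s).toReal / √n := by
    intro w hw
    have := hT.le_of_formNorm_le hμ h0 hθ hn ENNReal.toReal_nonneg hb hw
    rw [map_smul, smul_eq_mul] at this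
    rw [le_div_iff₀ hn']
    linarith
  refine ContinuousLinearMap.opNorm_le_of_unit_norm (by positivity) fun w hw => ?_
  rw [Real.norm_eq_abs, abs_le]
  constructor
  · have := hunit (-w) (by rwa [norm_neg])
    rw [map_neg, map_neg] at this
    simpa using neg_le_neg this
  · exact hunit w hw

variable {b r : ℝ} {Y : Fin n → EuclideanSpace ℝ (Fin d)} {v₀ : EuclideanSpace ℝ (Fin d)}

lemma norm_add_lt_of_mem_ball (hv₀ : ‖v₀‖ < r) {z : EuclideanSpace ℝ (Fin d)}
    (hz : z ∈ Metric.ball (0 : EuclideanSpace ℝ (Fin d)) r) : ‖v₀ + z‖ < 2 * r := by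
  rw [mem_ball_zero_iff] at hz
  linarith [norm_add_le v₀ z]

/-- Recentered and whitened at the maximum likelihood estimator, the posterior is near Gaussian. -/
lemma HessianNear.nearGaussian (hT : Whitens n μ θ₀ T)
    (h : HessianNear n μ θ₀ T b (2 * (s * √d)))
    (hμ : IsRegularMinimal μ) (h0 : μ ≠ 0) (hθ : θ₀ ∈ natDomain μ) (hn : 0 < n)
    (hs : 0 < s * √d) (hb : 0 ≤ b) (hbr : b * (2 * (s * √d)) ≤ 2 / 5)
    (hδ : delta01 n μ θ₀ π₀ (2 * s) ≠ ∞)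
    (hδ' : (delta01 n μ θ₀ π₀ (2 * s)).toReal / √n ≤ √d / 6)
    (hv₀ : ‖v₀‖ < s * √d) (hcrit : (n : ℝ) • mean μ (θ₀ + T v₀) = ∑ i, Y i) :
    NearGaussian {z | θ₀ + T v₀ + T z ∈ natDomain μ}
      (fun z => potential μ Y (θ₀ + T v₀ + T z) - potential μ Y (θ₀ + T v₀))
      (fun z => π₀ (θ₀ + T v₀ + T z)) (s * √d) (b * (2 * (s * √d)))
      ((delta01 n μ θ₀ π₀ (2 * s)).toReal / √n) := by
  obtain ⟨hC, hpos, -⟩ := contDiffOn_of_delta01_ne_top hδ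
  have hlt : ∀ z ∈ Metric.ball (0 : EuclideanSpace ℝ (Fin d)) (s * √d),
      ‖v₀ + z‖ < 2 * (s * √d) := fun z hz => norm_add_lt_of_mem_ball hv₀ hz
  have hadd : ∀ z, θ₀ + T v₀ + T z = θ₀ + T (v₀ + z) := fun z => by rw [map_add, add_assoc]
  have hmem : ∀ z ∈ Metric.ball (0 : EuclideanSpace ℝ (Fin d)) (s * √d),
      θ₀ + T v₀ + T z ∈ natDomain μ := fun z hz => by
    rw [hadd]; exact h.mem _ (hlt z hz).le
  have hnb : ∀ z ∈ Metric.ball (0 : EuclideanSpace ℝ (Fin d)) (s * √d),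
      θ₀ + T v₀ + T z ∈ nbhd n μ θ₀ (2 * s) := fun z hz => by
    rw [hadd, hT.mem_nbhd_iff hμ h0 hθ hn, mul_assoc]; exact (hlt z hz).le
  have haff : ContDiff ℝ 1 fun z => θ₀ + T v₀ + T z := by fun_prop
  refine
    { ball_subset := hmem
      W_zero := by simp
      W_contDiffOn := ?_
      W_fderiv := ?_
      q_contDiffOn := ContDiffOn.comp (g := π₀) hC haff.contDiffOn hnb
      q_pos := fun z hz => hpos _ (hnb z hz)
      q_fderiv := ?_
      R_pos := hs
      ε_nonneg := by positivity
      ε_le := hbr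
      L_nonneg := by positivity
      L_le := hδ' }
  · have hc : ContDiffOn ℝ 1 (potential μ Y ∘ fun z => θ₀ + T v₀ + T z)
        (Metric.ball 0 (s * √d)) :=
      ContDiffOn.comp (contDiffOn_potential hμ h0) haff.contDiffOn hmem
    exact hc.sub contDiffOn_const
  · intro z hz w
    have hm := hmem z hz
    have hg := hasFDerivAt_potential (Y := Y) hμ h0 hm
    have haf : HasFDerivAt (fun z => θ₀ + T v₀ + T z)
        (T : EuclideanSpace ℝ (Fin d) →L[ℝ] EuclideanSpace ℝ (Fin d)) z :=
      T.hasFDerivAt.const_add (θ₀ + T v₀)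
    have hd : HasFDerivAt
        (fun z => potential μ Y (θ₀ + T v₀ + T z) - potential μ Y (θ₀ + T v₀))
        ((innerSL ℝ ((n : ℝ) • mean μ (θ₀ + T v₀ + T z) - ∑ i, Y i)).comp
          (T : EuclideanSpace ℝ (Fin d) →L[ℝ] EuclideanSpace ℝ (Fin d))) z :=
      (HasFDerivAt.comp z hg haf).sub_const (potential μ Y (θ₀ + T v₀))
    -- Criticality replaces the data sum by n times the mean at the estimator, so the gradient is an
    -- increment of the mean parameter. Its endpoints are within 2s√d of θ₀ in whitened coordinates.
    rw [hd.fderiv, ContinuousLinearMap.comp_apply, ContinuousLinearEquiv.coe_coe,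
      innerSL_apply_apply, ← hcrit, ← smul_sub, inner_smul_left, conj_trivial, real_inner_comm,
      hadd]
    exact h.inner_mean_sub hμ h0 hb le_rfl (by linarith) (hlt z hz).le w
  · intro z hz
    have h1 := (hT.logPrior hμ h0 hθ hn hδ (v := v₀ + z) (by
      rw [mul_assoc]; exact hlt z hz)).2
    rw [← fderiv_comp_add_left] at h1
    simp_rw [hadd]
    exact h1

/-- The log-prior is (√d/6)-Lipschitz in whitened coordinates, and the estimator is at distance less
than s√d, so the loss is at most sd/6. -/
lemma Whitens.prior_le (hT : Whitens n μ θ₀ T) (hμ : IsRegularMinimal μ) (h0 : μ ≠ 0)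
    (hθ : θ₀ ∈ natDomain μ) (hn : 0 < n) (hs : 0 < s * √d)
    (hδ : delta01 n μ θ₀ π₀ (2 * s) ≠ ∞)
    (hδ' : (delta01 n μ θ₀ π₀ (2 * s)).toReal / √n ≤ √d / 6) (hv₀ : ‖v₀‖ < s * √d) :
    π₀ θ₀ * Real.exp (-(s * d / 6)) ≤ π₀ (θ₀ + T v₀) := by
  obtain ⟨-, hpos, -⟩ := contDiffOn_of_delta01_ne_top hδ
  have hp : ∀ v : EuclideanSpace ℝ (Fin d), ‖v‖ < 2 * s * √d → 0 < π₀ (θ₀ + T v) := fun v hv =>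
    hpos _ ((hT.mem_nbhd_iff hμ h0 hθ hn _ v).2 hv.le)
  have hm0 : ‖(0 : EuclideanSpace ℝ (Fin d))‖ < 2 * s * √d := by rw [norm_zero]; linarith
  have hmv : ‖v₀‖ < 2 * s * √d := by linarith
  have h1 := (convex_ball (0 : EuclideanSpace ℝ (Fin d)) (2 * s * √d)).norm_image_sub_le_of_norm_fderiv_le
    (𝕜 := ℝ) (f := fun v => Real.log (π₀ (θ₀ + T v)))
    (fun v hv => (hT.logPrior hμ h0 hθ hn hδ (mem_ball_zero_iff.1 hv)).1)
    (fun v hv => (hT.logPrior hμ h0 hθ hn hδ (mem_ball_zero_iff.1 hv)).2)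
    (mem_ball_zero_iff.2 hmv) (mem_ball_zero_iff.2 hm0)
  have hp0 := hp 0 hm0
  simp only [map_zero, add_zero, zero_sub, norm_neg, Real.norm_eq_abs] at h1 hp0
  have h2 : Real.log (π₀ θ₀) - Real.log (π₀ (θ₀ + T v₀)) ≤ s * d / 6 := by
    refine (le_abs_self _).trans (h1.trans ?_)
    calc _ ≤ √d / 6 * (s * √d) := by gcongr
      _ = s * √(d : ℝ) ^ 2 / 6 := by ring
      _ = _ := by rw [Real.sq_sqrt (by positivity)]
  rw [← Real.exp_log hp0, ← Real.exp_log (hp v₀ hmv), ← Real.exp_add]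
  exact Real.exp_le_exp.2 (by linarith)

end LocalModel

/-! ### Transfer between the posterior and the whitened model. -/

section Transfer

/-- The Jacobian and the factor e^{nℓ(θhat)} enter only through κ, which normalisation removes;
neither is ever computed. -/
lemma map_normalize {α β : Type*} [MeasurableSpace α] [MeasurableSpace β] {D : Measure α}
    {U : Measure β} {φ : α → β} (hφ : Measurable φ) {κ : ℝ≥0∞} (hκ0 : κ ≠ 0) (hκ : κ ≠ ∞)
    (h : D.map φ = κ • U) :
    ((D Set.univ)⁻¹ • D).map φ = (U Set.univ)⁻¹ • U := by
  have h1 : D Set.univ = κ * U Set.univ := by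
    have := congrArg (fun ν => ν Set.univ) h
    simpa [Measure.map_apply hφ MeasurableSet.univ] using this
  rw [Measure.map_smul, h, h1, smul_smul, ENNReal.mul_inv (.inl hκ0) (.inl hκ), mul_right_comm,
    ENNReal.inv_mul_cancel hκ0 hκ, one_mul]

lemma tv_map_le {α β : Type*} [MeasurableSpace α] [MeasurableSpace β] (P Q : Measure α)
    {φ : α → β} (hφ : Measurable φ) : tv (P.map φ) (Q.map φ) ≤ tv P Q := by
  refine iSup₂_le fun A hA => ?_
  rw [map_measureReal_apply hφ hA, map_measureReal_apply hφ hA]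
  exact le_iSup₂ (f := fun (A : Set α) (_ : MeasurableSet A) =>
    ENNReal.ofReal |P.real A - Q.real A|) (φ ⁻¹' A) (hφ hA)

variable {d n : ℕ} {μ : Measure (EuclideanSpace ℝ (Fin d))} {θ θ₀ : EuclideanSpace ℝ (Fin d)}
  {π₀ : EuclideanSpace ℝ (Fin d) → ℝ}

lemma exists_map_affine_volume (T : EuclideanSpace ℝ (Fin d) ≃L[ℝ] EuclideanSpace ℝ (Fin d))
    (c : EuclideanSpace ℝ (Fin d)) :
    ∃ κ : ℝ≥0∞, κ ≠ 0 ∧ κ ≠ ∞ ∧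
      (volume : Measure (EuclideanSpace ℝ (Fin d))).map (fun z => c + T z) = κ • volume := by
  have hdet : LinearMap.det (T.toLinearEquiv : EuclideanSpace ℝ (Fin d) →ₗ[ℝ]
      EuclideanSpace ℝ (Fin d)) ≠ 0 := (LinearEquiv.isUnit_det' T.toLinearEquiv).ne_zero
  have h1 := Measure.map_linearMap_addHaar_eq_smul_addHaar
    (volume : Measure (EuclideanSpace ℝ (Fin d))) hdet
  have h2 : (volume : Measure (EuclideanSpace ℝ (Fin d))).map (fun z => c + T z) =
      (volume.map T).map (fun z => c + z) :=
    (Measure.map_map (measurable_const_add c) T.continuous.measurable).symm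
  refine ⟨ENNReal.ofReal |(LinearMap.det (T.toLinearEquiv : EuclideanSpace ℝ (Fin d) →ₗ[ℝ]
    EuclideanSpace ℝ (Fin d)))⁻¹|, ?_, ENNReal.ofReal_ne_top, ?_⟩
  · exact (ENNReal.ofReal_pos.2 (abs_pos.2 (inv_ne_zero hdet))).ne'
  · rw [h2]
    exact (congrArg (Measure.map fun z => c + z) h1).trans (by
      rw [Measure.map_smul, map_add_left_eq_self])

/-- Measurability of a parameter integral requires an s-finite base measure, which the Lebesgue
density of μ supplies. -/
lemma measurable_logPartition (hlc : HasLogConcaveDensity μ) : Measurable (logPartition μ) := by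
  obtain ⟨h, hm, -, -, rfl⟩ := hlc
  refine Real.measurable_log.comp (StronglyMeasurable.measurable ?_)
  refine StronglyMeasurable.integral_prod_right
    (f := fun θ y : EuclideanSpace ℝ (Fin d) => Real.exp (inner ℝ θ y)) ?_
  exact (by fun_prop : Continuous fun p : EuclideanSpace ℝ (Fin d) × EuclideanSpace ℝ (Fin d) =>
      Real.exp (inner ℝ p.1 p.2)).stronglyMeasurable

variable {Y : Fin n → EuclideanSpace ℝ (Fin d)}

lemma measurable_potential (hlc : HasLogConcaveDensity μ) : Measurable (potential μ Y) := by
  have := measurable_logPartition hlc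
  unfold potential
  fun_prop

lemma measurable_modelDensity_affine (hμ : IsRegularMinimal μ) (hlc : HasLogConcaveDensity μ)
    (hπ : Measurable π₀) (T : EuclideanSpace ℝ (Fin d) ≃L[ℝ] EuclideanSpace ℝ (Fin d))
    (c : EuclideanSpace ℝ (Fin d)) :
    Measurable (modelDensity {z | c + T z ∈ natDomain μ}
      (fun z => potential μ Y (c + T z) - potential μ Y c) fun z => π₀ (c + T z)) := by
  have h1 := measurable_potential (Y := Y) hlc
  have hφ : Measurable fun z => c + T z := by fun_prop
  refine Measurable.indicator ?_ (hφ hμ.isOpen.measurableSet)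
  fun_prop

/-- The posterior is the image of the model measure under the whitening map. -/
lemma exists_map_withDensity_modelDensity (hμ : IsRegularMinimal μ) (hlc : HasLogConcaveDensity μ)
    (hn : 0 < n) (hπ : Measurable π₀)
    (T : EuclideanSpace ℝ (Fin d) ≃L[ℝ] EuclideanSpace ℝ (Fin d))
    (c : EuclideanSpace ℝ (Fin d)) :
    ∃ κ : ℝ≥0∞, κ ≠ 0 ∧ κ ≠ ∞ ∧
      (volume.withDensity (modelDensity {z | c + T z ∈ natDomain μ}
        (fun z => potential μ Y (c + T z) - potential μ Y c) fun z => π₀ (c + T z))).map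
          (fun z => c + T z) = κ • unnormalizedPosterior μ π₀ Y := by
  obtain ⟨k, hk0, hk, hmap⟩ := exists_map_affine_volume T c
  have hV := measurable_potential (Y := Y) hlc
  have hφ : Measurable fun z => c + T z := by fun_prop
  have hΘ : MeasurableSet (natDomain μ) := hμ.isOpen.measurableSet
  set e := ENNReal.ofReal (Real.exp (potential μ Y c)) with he
  set G : EuclideanSpace ℝ (Fin d) → ℝ≥0∞ :=
    (natDomain μ).indicator fun θ => ENNReal.ofReal (Real.exp (-potential μ Y θ) * π₀ θ) with hG
  have hGm : Measurable G := Measurable.indicator (by fun_prop) hΘ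
  have hdens : modelDensity {z | c + T z ∈ natDomain μ}
      (fun z => potential μ Y (c + T z) - potential μ Y c) (fun z => π₀ (c + T z)) =
      fun z => e * G (c + T z) := by
    ext z
    by_cases hz : c + T z ∈ natDomain μ
    · rw [modelDensity, Set.indicator_of_mem (by exact hz), hG, Set.indicator_of_mem hz, he,
        ← ENNReal.ofReal_mul (Real.exp_pos _).le, ← mul_assoc, ← Real.exp_add]
      ring_nf
    · rw [modelDensity, Set.indicator_of_notMem (by exact hz), hG, Set.indicator_of_notMem hz,
        mul_zero]
  have hU : unnormalizedPosterior μ π₀ Y = volume.withDensity G := by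
    rw [unnormalizedPosterior, hG, ← withDensity_indicator hΘ]
    simp_rw [mul_negLogLik hn]
  refine ⟨e * k, mul_ne_zero (by simp [he, Real.exp_pos]) hk0,
    ENNReal.mul_ne_top ENNReal.ofReal_ne_top hk, ?_⟩
  ext A hA
  rw [Measure.map_apply hφ hA, withDensity_apply _ (hφ hA), hdens, hU, Measure.smul_apply,
    withDensity_apply _ hA, smul_eq_mul, mul_assoc]
  refine (lintegral_const_mul _ (hGm.comp hφ)).trans ?_
  congr 1
  refine (setLIntegral_map hA hGm hφ).symm.trans ?_
  rw [hmap, Measure.restrict_smul, lintegral_smul_measure,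
    smul_eq_mul]

/-- For an integrable prior it suffices that the likelihood is bounded by its value at the
maximiser. -/
lemma unnormalizedPosterior_univ_ne_top (hn : 0 < n) (hint : IntegrableOn π₀ (natDomain μ))
    (hΘ : MeasurableSet (natDomain μ)) (hpos : ∀ θ ∈ natDomain μ, 0 ≤ π₀ θ)
    (hmle : IsUniqueMLE μ Y θ) : unnormalizedPosterior μ π₀ Y Set.univ ≠ ∞ := by
  rw [unnormalizedPosterior, withDensity_apply _ MeasurableSet.univ, Measure.restrict_univ]
  have h1 : ∫⁻ η in natDomain μ, ENNReal.ofReal (Real.exp (-(n * negLogLik μ Y η)) * π₀ η) ≤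
      ∫⁻ η in natDomain μ, ENNReal.ofReal (Real.exp (-(n * negLogLik μ Y θ))) *
        ENNReal.ofReal (π₀ η) := by
    refine setLIntegral_mono' hΘ fun η hη => ?_
    rw [← ENNReal.ofReal_mul (Real.exp_pos _).le]
    refine ENNReal.ofReal_le_ofReal (mul_le_mul_of_nonneg_right (Real.exp_le_exp.2 ?_)
      (hpos η hη))
    have : negLogLik μ Y θ ≤ negLogLik μ Y η := by
      rcases eq_or_ne η θ with rfl | hne
      · exact le_rfl
      · exact (hmle.2 η hη hne).le
    gcongr
  refine ne_top_of_le_ne_top ?_ h1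
  rw [lintegral_const_mul' _ _ ENNReal.ofReal_ne_top]
  exact ENNReal.mul_ne_top ENNReal.ofReal_ne_top (Integrable.lintegral_lt_top hint).ne

lemma ofReal_le_exp_M0 (hd : 0 < d) (hθ : θ₀ ∈ natDomain μ) (hpos : 0 < π₀ θ₀) (x : ℝ)
    (h : (⨆ θ ∈ natDomain μ, ENNReal.ofReal (π₀ θ / π₀ θ₀)) ≠ ∞) :
    ENNReal.ofReal ((⨆ θ ∈ natDomain μ, ENNReal.ofReal (π₀ θ / π₀ θ₀)).toReal *
      Real.exp (-(d * x))) ≤ EReal.exp ((d : EReal) * (M0 μ θ₀ π₀ - (x : EReal))) := by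
  have hd' : (d : ℝ) ≠ 0 := by positivity
  set M := ⨆ θ ∈ natDomain μ, ENNReal.ofReal (π₀ θ / π₀ θ₀) with hM
  have h1 : 1 ≤ M := by
    have := le_iSup₂ (f := fun θ (_ : θ ∈ natDomain μ) => ENNReal.ofReal (π₀ θ / π₀ θ₀)) θ₀ hθ
    rwa [div_self hpos.ne', ENNReal.ofReal_one] at this
  have hM0 : M ≠ 0 := (zero_lt_one.trans_le h1).ne'
  have hMr : 0 < M.toReal := ENNReal.toReal_pos hM0 h
  have e : (d : EReal) * (M0 μ θ₀ π₀ - (x : EReal)) =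
      ((Real.log M.toReal + -(d * x) : ℝ) : EReal) := by
    rw [M0, ← hM, ENNReal.log_pos_real hM0 h, ← EReal.coe_coe_eq_natCast, ← EReal.coe_div,
      ← EReal.coe_sub, ← EReal.coe_mul]
    congr 1
    field_simp
    ring
  rw [e, EReal.exp_coe, Real.exp_add, Real.exp_log hMr]

lemma exp_M0_eq_top (hd : 0 < d) (x : ℝ)
    (h : (⨆ θ ∈ natDomain μ, ENNReal.ofReal (π₀ θ / π₀ θ₀)) = ∞) :
    EReal.exp ((d : EReal) * (M0 μ θ₀ π₀ - (x : EReal))) = ∞ := by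
  have hd' : (0 : ℝ) < d := by positivity
  have hd0 : (0 : EReal) < (d : EReal) := by
    rw [← EReal.coe_coe_eq_natCast]; exact_mod_cast hd'
  rw [M0, h, ENNReal.log_top, EReal.top_div_of_pos_ne_top hd0 (EReal.natCast_ne_top d),
    EReal.top_sub_coe, EReal.mul_top_of_pos hd0, EReal.exp_top]

end Transfer

/-! ### From admissible constants to the Hessian bound. -/

section Curvature

variable {d n : ℕ} {μ : Measure (EuclideanSpace ℝ (Fin d))} {θ₀ : EuclideanSpace ℝ (Fin d)}
  {T : EuclideanSpace ℝ (Fin d) ≃L[ℝ] EuclideanSpace ℝ (Fin d)} {s : ℝ}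

lemma delta3_le_of_delta2_le (hd : 0 < d) (hn : 0 < n) (hμ : IsRegularMinimal μ)
    (hlc : HasLogConcaveDensity μ) (hθ : θ₀ ∈ natDomain μ) (hs : 0 ≤ s)
    (h2 : delta2 n μ θ₀ s ≤ ENNReal.ofReal (3 / 2)) (hsub : nbhd n μ θ₀ s ⊆ natDomain μ) {C : ℝ}
    (hC0 : 0 < C) (hC : IsAdmissibleC23 C) :
    delta3 n μ θ₀ s ≤ ENNReal.ofReal (C * (3 / 2) ^ (3 / 2 : ℝ)) := by
  refine (hC d n hd hn μ hμ hlc θ₀ hθ s hs hsub).trans ?_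
  rw [ENNReal.ofReal_mul hC0.le, ← ENNReal.ofReal_rpow_of_nonneg (by norm_num) (by norm_num)]
  gcongr

lemma three_halves_rpow_le : (3 / 2 : ℝ) ^ (3 / 2 : ℝ) ≤ 46 / 25 := by
  refine abs_le_of_sq_le_sq' ?_ (by norm_num) |>.2
  rw [← Real.rpow_natCast, ← Real.rpow_mul (by norm_num)]
  norm_num

lemma Whitens.hessianNear_of_delta3_le (hT : Whitens n μ θ₀ T) (hμ : IsRegularMinimal μ)
    (h0 : μ ≠ 0) (hθ : θ₀ ∈ natDomain μ) (hn : 0 < n) (hsub : nbhd n μ θ₀ (2 * s) ⊆ natDomain μ)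
    {K : ℝ} (hK : 0 ≤ K) (h3 : delta3 n μ θ₀ (2 * s) ≤ ENNReal.ofReal K) :
    HessianNear n μ θ₀ T (5 / 3 * (K / √n)) (2 * (s * √d)) := by
  have hnb : ∀ v, ‖v‖ ≤ 2 * (s * √d) → θ₀ + T v ∈ nbhd n μ θ₀ (2 * s) := fun v hv => by
    rwa [hT.mem_nbhd_iff hμ h0 hθ hn, mul_assoc]
  refine hT.hessianNear hμ h0 (fun v hv => hsub (hnb v hv)) fun v hv u => ?_
  refine hT.abs_thirdMoment_le hμ h0 hθ (hsub (hnb v hv)) hn hK ?_ u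
  exact (le_iSup₂ (f := fun θ (_ : θ ∈ nbhd n μ θ₀ (2 * s)) =>
    formNorm (fisher μ θ₀) (thirdMoment μ θ)) _ (hnb v hv)).trans h3

end Curvature

end BvM

/-! ### Assembly of the theorem. -/

open BvM

theorem proposition4p6 :
    (∃ C₂₃ : ℝ, 0 < C₂₃ ∧ IsAdmissibleC23 C₂₃) ∧
    ∃ C : ℝ, 0 < C ∧ ∀ C₂₃ : ℝ, 0 < C₂₃ → IsAdmissibleC23 C₂₃ →
      ∀ (d n : ℕ), 0 < d → 0 < n →
      ∀ μ : Measure (EuclideanSpace ℝ (Fin d)), IsRegularMinimal μ → HasLogConcaveDensity μ →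
      ∀ θ₀ ∈ natDomain μ,
      ∀ π₀ : EuclideanSpace ℝ (Fin d) → ℝ, Measurable π₀ → (∀ θ ∈ natDomain μ, 0 ≤ π₀ θ) →
      (IntegrableOn π₀ (natDomain μ) ∨ BddAbove (π₀ '' natDomain μ)) →
      ∀ s : ℝ, 12 ≤ s →
      delta2 n μ θ₀ (2 * s) ≤ ENNReal.ofReal (3 / 2) →
      s * √((d : ℝ) / n) ≤ (16 * C₂₃)⁻¹ →
      delta01 n μ θ₀ π₀ (2 * s) ≤ ENNReal.ofReal (√((n : ℝ) * d) / 6) →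
      nbhd n μ θ₀ (2 * s) ⊆ natDomain μ →
      ∃ A : Set (Fin n → EuclideanSpace ℝ (Fin d)), MeasurableSet A ∧
        ENNReal.ofReal (1 - Real.exp (-(d * s ^ 2 / 10)))
          ≤ Measure.pi (fun _ : Fin n => expFamily μ θ₀) A ∧
        ∀ Y ∈ A, ∃ θhat : EuclideanSpace ℝ (Fin d), IsUniqueMLE μ Y θhat ∧
          IsProbabilityMeasure (bayesPosterior μ π₀ Y) ∧
          tv (bayesPosterior μ π₀ Y) (multivariateGaussian θhat ((n : ℝ) • fisher μ θ₀)⁻¹) ≤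
            ENNReal.ofReal C *
              (delta01 n μ θ₀ π₀ (2 * s) / ENNReal.ofReal (√n)
                + ENNReal.ofReal (s * (d / √n))
                + EReal.exp ((d : EReal) * (M0 μ θ₀ π₀ - (((s / 12) ^ 2 : ℝ) : EReal)))) := by
  have hC0 := reverseHolderConst_pos
  refine ⟨⟨reverseHolderConst, hC0, isAdmissibleC23_reverseHolderConst⟩,
    -- The factor 20 comes from `NearGaussian.tv_modelMeasure_le`, and 7 is an upper bound for
    -- (10/3)(46/25).
    20 * (1 + 7 * reverseHolderConst), by positivity, ?_⟩
  intro C hC hCadm d n hd hn μ hμ hlc θ₀ hθ π₀ hπm hπ hπb s hs h2 hsC h01 hsub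
  have h0 := measure_ne_zero hμ hd
  have hs0 : 0 < s := by linarith
  have hn' : 0 < √(n : ℝ) := by positivity
  have hd' : 0 < √(d : ℝ) := by positivity
  have hdd : √(d : ℝ) ^ 2 = d := Real.sq_sqrt (by positivity)
  have hsd : 0 < s * √d := by positivity
  obtain ⟨T, hT, hgauss⟩ := exists_whitens (θ₀ := θ₀) hμ h0 hθ hn
  set k : ℝ := (3 / 2) ^ (3 / 2 : ℝ) with hk
  have hk0 : 0 < k := by positivity
  have hk1 : k ≤ 46 / 25 := three_halves_rpow_le
  -- Both constants bound the third moments. The given C is needed because the smallness assumption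
  -- is phrased with it; the fixed one keeps the final constant absolute however large C is.
  set K := min reverseHolderConst C * k with hKdef
  have hK0 : 0 ≤ K := by have := lt_min hC0 hC; positivity
  have h3 : delta3 n μ θ₀ (2 * s) ≤ ENNReal.ofReal K := by
    have hs2 : 0 ≤ 2 * s := by linarith
    rcases min_choice reverseHolderConst C with h | h <;> rw [hKdef, h]
    · exact delta3_le_of_delta2_le hd hn hμ hlc hθ hs2 h2 hsub hC0
        isAdmissibleC23_reverseHolderConst
    · exact delta3_le_of_delta2_le hd hn hμ hlc hθ hs2 h2 hsub hC hCadm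
  have hH := hT.hessianNear_of_delta3_le hμ h0 hθ hn hsub hK0 h3
  set b := 5 / 3 * (K / √n) with hb
  have hb0 : 0 ≤ b := by positivity
  have hbr : b * (2 * (s * √d)) ≤ 48 / 125 := by
    rw [Real.sqrt_div (by positivity), ← mul_div_assoc] at hsC
    have h1 : C * (s * √d / √n) ≤ 1 / 16 := by
      calc _ ≤ C * (16 * C)⁻¹ := by gcongr
        _ = 1 / 16 := by field_simp
    have h4 : K ≤ C * k := by rw [hKdef]; gcongr; exact min_le_right _ _
    calc b * (2 * (s * √d)) = 10 / 3 * (K * (s * √d / √n)) := by rw [hb]; ring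
      _ ≤ 10 / 3 * (C * k * (s * √d / √n)) := by gcongr
      _ = 10 / 3 * k * (C * (s * √d / √n)) := by ring
      _ ≤ 10 / 3 * (46 / 25) * (1 / 16) := by gcongr
      _ ≤ _ := by norm_num
  have hbr2 : b * (2 * (s * √d)) ≤ 2 / 5 := by linarith
  refine ⟨{Y | ‖score μ θ₀ T Y‖ ≤ 4 / 5 * (s * √d)},
    measurableSet_le (continuous_score T).measurable.norm measurable_const,
    le_measure_norm_score_le hT hH hμ h0 hθ hd hs hb0 hbr2, fun Y hY => ?_⟩
  obtain ⟨v₀, hv₀, hcrit⟩ := hH.exists_critical hT hμ h0 hn hb0 hsd hbr hY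
  set θhat := θ₀ + T v₀ with hθhat
  have hθhatm : θhat ∈ natDomain μ := hH.mem v₀ (by linarith)
  have hmle := isUniqueMLE_of_critical hμ h0 hn hθhatm hcrit
  have hδ : delta01 n μ θ₀ π₀ (2 * s) ≠ ∞ := ne_top_of_le_ne_top ENNReal.ofReal_ne_top h01
  set δ := delta01 n μ θ₀ π₀ (2 * s) with hδdef
  have hδ' : δ.toReal / √n ≤ √d / 6 := by
    have := ENNReal.toReal_le_of_le_ofReal (by positivity) h01
    rw [Real.sqrt_mul (by positivity)] at this
    rw [div_le_iff₀ hn']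
    linarith
  have hNG := hH.nearGaussian (Y := Y) hT hμ h0 hθ hn hsd hb0 hbr2 hδ hδ' hv₀ hcrit
  rw [← hθhat, ← hδdef] at hNG
  set Ω := {z | θhat + T z ∈ natDomain μ} with hΩ
  set W := fun z => potential μ Y (θhat + T z) - potential μ Y θhat with hW
  set q := fun z => π₀ (θhat + T z) with hq
  have hφ : Measurable fun z => θhat + T z := by fun_prop
  obtain ⟨κ, hκ0, hκ, hmap⟩ :=
    exists_map_withDensity_modelDensity (Y := Y) hμ hlc hn hπm T θhat
  have hDu : volume.withDensity (modelDensity Ω W q) Set.univ = ∫⁻ z, modelDensity Ω W q z := by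
    rw [withDensity_apply _ MeasurableSet.univ, Measure.restrict_univ]
  have hpost : bayesPosterior μ π₀ Y = (modelMeasure Ω W q).map fun z => θhat + T z := by
    rw [bayesPosterior, ← map_normalize hφ hκ0 hκ hmap, modelMeasure, ← hDu]
  have hconv : ConvexOn ℝ Ω W := by
    have h1 := (convexOn_potential (Y := Y) hμ h0 hn).comp_affineMap
      ((T : EuclideanSpace ℝ (Fin d) →ₗ[ℝ] EuclideanSpace ℝ (Fin d)).toAffineMap +
        AffineMap.const ℝ _ θhat)
    have h4 := h1.add_const (-potential μ Y θhat)
    convert! h4 using 1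
    · ext z; simp [hΩ, add_comm]
    · ext z; simp [hW, add_comm, sub_eq_add_neg]
  have hR : 12 * √(d : ℝ) ≤ s * √d := by gcongr
  -- An integrable prior uses the boundedness of the likelihood; a bounded prior uses the growth of
  -- W.
  have hfin : ∫⁻ z, modelDensity Ω W q z ≠ ∞ := by
    rcases hπb with hint | ⟨M, hM⟩
    · have h1 := congrArg (fun ν => ν Set.univ) hmap
      simp only [Measure.map_apply hφ MeasurableSet.univ, Set.preimage_univ] at h1
      rw [← hDu, h1]
      exact ENNReal.mul_ne_top hκ (unnormalizedPosterior_univ_ne_top hn hint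
        hμ.isOpen.measurableSet hπ hmle)
    · exact hNG.lintegral_ne_top hconv hd hR fun z hz => hM ⟨_, hz, rfl⟩
  have hprob := hNG.isProbabilityMeasure hd hR hfin
  refine ⟨θhat, hmle, hpost ▸ Measure.isProbabilityMeasure_map hφ.aemeasurable, ?_⟩
  rw [hpost, hgauss]
  refine (tv_map_le _ _ hφ).trans ?_
  -- If the prior is unbounded relative to its value at θ₀, the right side is infinite and nothing
  -- remains to be shown.
  by_cases hsup : (⨆ θ ∈ natDomain μ, ENNReal.ofReal (π₀ θ / π₀ θ₀)) = ∞
  · rw [exp_M0_eq_top hd _ hsup, add_top, ENNReal.mul_top (by simp; positivity)]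
    exact le_top
  have hπ0 : 0 < π₀ θ₀ := by
    refine (contDiffOn_of_delta01_ne_top hδ).2.1 θ₀ ?_
    have := (hT.mem_nbhd_iff hμ h0 hθ hn (2 * s) 0).2 (by rw [norm_zero]; positivity)
    rwa [map_zero, add_zero] at this
  set M := ⨆ θ ∈ natDomain μ, ENNReal.ofReal (π₀ θ / π₀ θ₀) with hM
  have hMle : ∀ θ ∈ natDomain μ, ENNReal.ofReal (π₀ θ / π₀ θ₀) ≤ M := fun θ hθ =>
    le_iSup₂ (f := fun θ (_ : θ ∈ natDomain μ) => ENNReal.ofReal (π₀ θ / π₀ θ₀)) θ hθ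
  have hS1 : 1 ≤ M.toReal := by
    have := hMle θ₀ hθ
    rwa [div_self hπ0.ne', ENNReal.ofReal_le_iff_le_toReal hsup] at this
  have hS : ∀ z ∈ Ω, q z ≤ M.toReal * π₀ θ₀ := fun z hz => by
    have := hMle _ hz
    rwa [ENNReal.ofReal_le_iff_le_toReal hsup, div_le_iff₀ hπ0] at this
  have hq0 : π₀ θ₀ * Real.exp (-(s * d / 6)) ≤ q 0 := by
    have := hT.prior_le hμ h0 hθ hn hsd hδ hδ' hv₀
    simpa [hq, hθhat] using this
  have hmain := hNG.tv_modelMeasure_le hconv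
    (measurable_modelDensity_affine hμ hlc hπm T θhat) hd hs rfl hπ0 hS1 hS hq0
  refine hmain.trans ?_
  -- The term ε√d of the model bound is the sd/√n term of the theorem.
  have hbd : b * (2 * (s * √d)) * √d ≤ 7 * reverseHolderConst * (s * (d / √n)) := by
    have h4 : K ≤ reverseHolderConst * (46 / 25) := by
      rw [hKdef]; gcongr; exact min_le_left _ _
    calc b * (2 * (s * √d)) * √d = 10 / 3 * K * (s * (√(d : ℝ) ^ 2 / √n)) := by rw [hb]; ring
      _ = 10 / 3 * K * (s * (d / √n)) := by rw [hdd]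
      _ ≤ 10 / 3 * (reverseHolderConst * (46 / 25)) * (s * (d / √n)) := by gcongr
      _ = 92 / 15 * reverseHolderConst * (s * (d / √n)) := by ring
      _ ≤ _ := by gcongr; norm_num
  have hE := ofReal_le_exp_M0 (π₀ := π₀) hd hθ hπ0 ((s / 12) ^ 2) hsup
  have hx : 0 ≤ δ.toReal / √n := by positivity
  have hy : 0 ≤ s * (d / √n) := by positivity
  have hz : 0 ≤ M.toReal * Real.exp (-(d * (s / 12) ^ 2)) := by positivity
  calc ENNReal.ofReal (20 * (δ.toReal / √n + b * (2 * (s * √d)) * √d +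
        M.toReal * Real.exp (-(d * (s / 12) ^ 2))))
      ≤ ENNReal.ofReal (20 * (1 + 7 * reverseHolderConst) *
          (δ.toReal / √n + s * (d / √n) + M.toReal * Real.exp (-(d * (s / 12) ^ 2)))) := by
        refine ENNReal.ofReal_le_ofReal ?_
        nlinarith [mul_nonneg hC0.le hx, mul_nonneg hC0.le hz]
    _ = ENNReal.ofReal (20 * (1 + 7 * reverseHolderConst)) *
          (δ / ENNReal.ofReal √n + ENNReal.ofReal (s * (d / √n)) +
            ENNReal.ofReal (M.toReal * Real.exp (-(d * (s / 12) ^ 2)))) := by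
        rw [ENNReal.ofReal_mul (by positivity), ENNReal.ofReal_add (by positivity) hz,
          ENNReal.ofReal_add hx hy, ENNReal.ofReal_div_of_pos hn', ENNReal.ofReal_toReal hδ]
    _ ≤ _ := by gcongr
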